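/- Throughout, $(p_n),(q_n),(u_n),(s_n)_{n\ge 0}$ are real sequences and $s\in\mathbb R$. Put $v_0=u_0$ and $v_n=u_n-u_{n-1}$ for $n\ge 1$, and let $a_n=(p\circ qs)_n$ be the Voronoi convolution of $(p_n)$ and $(q_ns_n)$: $a_0=p_0q_0s_0$ and $a_n=\sum_{k=0}^n p_{n-k}q_ks_k-\sum_{k=0}^{n-1}p_{n-1-k}q_ks_k$ for $n\ge1$. Let $$U(x)=\sum_{0\le k\le x}a_k,\qquad N(x)=\sum_{n\ge0}a_nx^n,\qquad D(x)=\sum_{n\ge0}v_nx^n .$$ - $s_n\to s$ $(V,p_n,q_n,u_n)$ means $\frac1{u_n}\sum_{k=0}^np_{n-k}q_ks_k\to s$ as $n\to\infty$. - For a function $w$, $s_n\to s$ $(V_x,p_n,q_n,w(x))$ means $U(x)/w(x)\to s$ as $x\to\infty$. - $s_n\to s$ $(\mathcal P)$ at $R$ means that $N(x)$ and $D(x)$ converge for $0\le x<R$ and $N(x)/D(x)\to s$ as $x\to R-$. A sequence $(c_n)$, positive for all large $n$, is regularly varying of index $\rho$ if $c_{\lfloor\lambda n\rfloor}/c_n\to\lambda^\rho$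 for every $\lambda>0$. A function $\ell$, positive and measurable on some half-line $[A,\infty)$, is slowly varying if $\ell(\lambda x)/\ell(x)\to1$ as $x\to\infty$ for every $\lambda>0$. Finally, $f_n=O_L(g_n)$ means that $f_n\ge -Cg_n$ for some constant $C$ and all large $n$. Quotients are only considered for those large $n$ or $x$ for which their denominators are non-zero. **Theorem.** (i) Let $v_n>0$ for all $n$, let $u_n\to\infty$, let $D$ have radius of convergence $R\in(0,\infty)$, and let $D(x)\to\infty$ as $x\to R-$ (this is automatic if $R=1$). If $s_n\to s$ $(V,p_n,q_n,u_n)$, then $s_n\to s$ $(\mathcal P)$ at $R$. (ii) Let $\rho\ge-1$, let $(v_n)$ be regularly varying of index $\rho$, let $u_n\to\infty$, and let $D$ have radius of convergence $1$. If $a_n/v_n=O_L(1)$ and $s_n\to s$ $(\mathcal P)$ at $1$, then $s_n\to s$ $(V,p_n,q_n,u_n)$. (iii) Let $\rho>-1$, $s\ge0$, let $U(x)\ge0$ for all $x\ge0$, and let $\int_0^\infty e^{-\sigma x}U(x)\,dx$ converge for every $\sigma>0$. Let $\ell$ be slowly varying and $w(x)=x^\rho\ell(x)/\Gamma(1+\rho)$.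 Let $D(x)$ converge for $0\le x<1$, with $$\frac{D(x)\,(-\log x)^\rho}{\ell(-1/\log x)}\to1\qquad(x\to1-).$$ If $s_n\to s$ $(V_x,p_n,q_n,w(x))$, then $s_n\to s$ $(\mathcal P)$ at $1$. Conversely, suppose that $s_n\to s$ $(\mathcal P)$ at $1$. Then $s_n\to s$ $(V_x,p_n,q_n,w(x))$ if and only if $$\lim_{\lambda\downarrow1}\ \liminf_{x\to\infty}\ \inf_{t\in[1,\lambda]}\ \frac1{x^\rho\ell(x)}\sum_{x<k\le tx}a_k\ \ge\ 0 .$$ (iv) Let $\rho\ge-1$ with $\rho\notin\{0,1,2,\dots\}$, let $(v_n)$ be regularly varying of index $\rho$, let $u_n\to\infty$, and let $D$ have radius of convergence $1$. If $a_n/v_n-a_{n-1}/v_{n-1}=O_L(v_n/u_n)$ and $s_n\to s$ $(\mathcal P)$ at $1$, then $a_n/v_n\to s$. (v) Let $v_n>0$ for all $n$, $v_n=O(1/n)$, $u_n\to\infty$, and let $D$ have radius of convergence $1$. If $a_n/v_n-a_{n-1}/v_{n-1}=o(v_n/u_n)$ and $s_n\to s$ $(\mathcal P)$ at $1$, then $a_n/v_n\to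 s$. -/

import Mathlib

open Filter Topology Asymptotics

noncomputable section

namespace Voronoi

/-- The convolution `(p ∗ q)ₙ = ∑_{k=0}^n p_{n-k} q_k`. -/
def conv (p q : ℕ → ℝ) (n : ℕ) : ℝ :=
  ∑ k ∈ Finset.range (n + 1), p (n - k) * q k

/-- The backward difference of a sequence: `u₀` for `n = 0`, and `uₙ - uₙ₋₁` for `n ≥ 1`. -/
def diff (u : ℕ → ℝ) : ℕ → ℝ
  | 0 => u 0
  | n + 1 => u (n + 1) - u n

/-- The Voronoi convolution `(p ∘ q)ₙ`: `p₀ q₀` for `n = 0`, and `(p ∗ q)ₙ - (p ∗ q)ₙ₋₁` for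
`n ≥ 1`. -/
def vconv (p q : ℕ → ℝ) : ℕ → ℝ
  | 0 => p 0 * q 0
  | n + 1 => conv p q (n + 1) - conv p q n

/-- The Voronoi convolution `(p ∘ qs)ₙ` of `p` with the sequence `qₙ sₙ`. -/
def term (p q s : ℕ → ℝ) (n : ℕ) : ℝ :=
  vconv p (fun k => q k * s k) n

/-- `sₙ → l (V, pₙ, qₙ, uₙ)`: the Voronoi means `(1 / uₙ) ∑_{k=0}^n p_{n-k} q_k s_k` tend to `l`. -/
def MeanTendsto (p q u s : ℕ → ℝ) (l : ℝ) : Prop :=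
  Tendsto (fun n => (1 / u n) * ∑ k ∈ Finset.range (n + 1), p (n - k) * q k * s k) atTop (𝓝 l)

/-- `U(x) = ∑_{0 ≤ k ≤ x} (p ∘ qs)_k`, for `x ≥ 0`. -/
def partialSum (p q s : ℕ → ℝ) (x : ℝ) : ℝ :=
  ∑ k ∈ Finset.range (⌊x⌋₊ + 1), term p q s k

/-- `sₙ → l (V_x, pₙ, qₙ, w(x))`: the continuous Voronoi means `U(x) / w(x)` tend to `l`. -/
def ContMeanTendsto (p q : ℕ → ℝ) (w : ℝ → ℝ) (s : ℕ → ℝ) (l : ℝ) : Prop :=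
  Tendsto (fun x : ℝ => (1 / w x) * partialSum p q s x) atTop (𝓝 l)

/-- The sum `∑ cₙ xⁿ` (used only where the series converges). -/
def powerSum (c : ℕ → ℝ) (x : ℝ) : ℝ := ∑' n, c n * x ^ n

/-- The radius of convergence of the real power series `∑ cₙ xⁿ`. -/
def radius (c : ℕ → ℝ) : ENNReal := (FormalMultilinearSeries.ofScalars ℝ c).radius

/-- Summability to `l` by the Voronoi power series with denominator `D(x) = ∑ vₙ xⁿ`, as `x → R-`:
the series `N(x) = ∑ (p ∘ qs)ₙ xⁿ` and `D(x)` converge for `0 ≤ x < R`, and `N(x) / D(x) → l`. -/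
def PowerTendsto (p q v : ℕ → ℝ) (R : ℝ) (s : ℕ → ℝ) (l : ℝ) : Prop :=
  (∀ x : ℝ, 0 ≤ x → x < R → Summable fun n => v n * x ^ n) ∧
  (∀ x : ℝ, 0 ≤ x → x < R → Summable fun n => term p q s n * x ^ n) ∧
  Tendsto (fun x => powerSum (term p q s) x / powerSum v x) (𝓝[<] R) (𝓝 l)

/-- A sequence, positive from some index on, that is regularly varying of index `ρ`. -/
def RegVarSeq (v : ℕ → ℝ) (ρ : ℝ) : Prop :=
  (∀ᶠ n in atTop, 0 < v n) ∧
  ∀ c : ℝ, 0 < c → Tendsto (fun n : ℕ => v ⌊c * n⌋₊ / v n) atTop (𝓝 (c ^ ρ))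

/-- A slowly varying function: positive and measurable on some half-line `[A, ∞)`, with
`ℓ(cx) / ℓ(x) → 1` as `x → ∞`, for every `c > 0`. -/
def SlowlyVarying (ℓ : ℝ → ℝ) : Prop :=
  (∃ A : ℝ, (∀ x, A ≤ x → 0 < ℓ x) ∧ Measurable ((Set.Ici A).domRestrict ℓ)) ∧
  ∀ c : ℝ, 0 < c → Tendsto (fun x => ℓ (c * x) / ℓ x) atTop (𝓝 1)

/-- `f = O_L(g)`: for some constant `C`, `fₙ ≥ -C gₙ` for all large `n`. -/
def IsBigOL (f g : ℕ → ℝ) : Prop :=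
  ∃ C : ℝ, ∀ᶠ n in atTop, -(C * g n) ≤ f n

/-- `lim_{λ ↓ 1} liminf_{x → ∞} inf_{t ∈ [1, λ]} (1 / g(x)) ∑_{x < k ≤ tx} (p ∘ qs)_k ≥ 0`, with the
lower limits and infima taken in the extended reals. -/
def SlowDecrease (p q s : ℕ → ℝ) (g : ℝ → ℝ) : Prop :=
  ∃ L : EReal, 0 ≤ L ∧
    Tendsto
      (fun c : ℝ => liminf
        (fun x : ℝ => ⨅ t ∈ Set.Icc (1 : ℝ) c,
          (((1 / g x) * ∑ k ∈ Finset.Ioc ⌊x⌋₊ ⌊t * x⌋₊, term p q s k : ℝ) : EReal))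
        atTop)
      (𝓝[>] 1) (𝓝 L)

end Voronoi

end

open Filter Topology Asymptotics

namespace Voronoi

open MeasureTheory

/-! Write `A` for the partial sums of `a = term p q s`, and `v = diff u`, so that `u` is the
sequence of partial sums of `v`. The Voronoi means are then `A n / u n`, and everything rests on the
identity `∑ aₙ xⁿ = (1 - x) ∑ Aₙ xⁿ`.

(i) `N / D` is the quotient of `∑ Aₙ xⁿ` by `∑ uₙ xⁿ`, that is, an average of `A n / u n` with
weights `uₙ xⁿ`. The total weight diverges, so finitely many terms do not matter
(`tendsto_powerSum_div`).

(ii) Karamata's method. A multiple of `v` is added to make the coefficients nonnegative. With `z =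
exp (-1/n)`, the hypothesis at the points `z ^ (j+1)` compares `∑ aₖ zᵏ P(zᵏ)` with `l ∑ vₖ zᵏ
P(zᵏ)` for polynomials `P`; Weierstrass extends this to continuous functions, and continuous cutoffs
of `1 / y` at `y = exp (-1)` bracket `A n`. Regular variation enters only through `RatioNearOne`: `v
m / v n` is near `1` when `m / n` is. This passes to `u`, makes `D` doubling, and gives `D(exp
(-1/n)) = O(u n)`. `RatioNearOne` itself comes from pointwise regular variation by Baire's theorem.

(iii) The weights are taken to be `g(n) = D(exp (-1/n))`, asymptotic to `n ^ ρ ℓ(n)` and, unlike it,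
continuous in the variable `n`. Karamata's Abelian theorem, proved by dominated convergence under
Potter's bounds, gives `(1 - x) ∑ g(n) xⁿ ∼ Γ(1 + ρ) D(x)`. Hence `N / D` is, up to `Γ(1 + ρ)`, the
quotient of `∑ Aₙ xⁿ` by `∑ g(n) xⁿ`. In one direction this is the averaging of (i). In the other,
`A ≥ 0` lets the theorem behind (ii) act on `A` itself, and slow decrease turns convergence of the
averages of `A` into that of `A n / g(n)` (`tendsto_div_of_slowDecrease`).

(iv) Put `r = a / v`. The one-sided condition on differences sums to `r m ≥ r n - C log (u m / u n)`
for `n ≤ m`. Vijayaraghavan's argument (`exists_forall_neg_le`) shows that `r` is bounded below;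
this is the hypothesis of (ii), so the means of `r` with weights `v` converge, and slow decrease in
the scale `log u` yields convergence of `r` (`tendsto_of_tendsto_weighted_mean`).

(v) As in Tauber's original theorem, `r n D(x) - N(x)` is estimated directly at `x = exp (-1/n)`,
split at the index `n` (`abs_mul_powerSum_sub_le`). -/

/-- The partial sums `c₀ + ⋯ + cₙ`. -/
def cumSum (c : ℕ → ℝ) (n : ℕ) : ℝ := ∑ k ∈ Finset.range (n + 1), c k

/-! ### Partial sums, power series and multiplication by `1 / (1 - x)` -/

lemma cumSum_zero (c : ℕ → ℝ) : cumSum c 0 = c 0 := by simp [cumSum]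

lemma cumSum_succ (c : ℕ → ℝ) (n : ℕ) : cumSum c (n + 1) = cumSum c n + c (n + 1) := by
  simp [cumSum, Finset.sum_range_succ]

lemma cumSum_diff (u : ℕ → ℝ) : cumSum (diff u) = u := by
  funext n
  induction n with
  | zero => simp [cumSum_zero, diff]
  | succ n ih => rw [cumSum_succ, ih]; simp [diff]

lemma cumSum_term (p q s : ℕ → ℝ) (n : ℕ) :
    cumSum (term p q s) n = ∑ k ∈ Finset.range (n + 1), p (n - k) * q k * s k := by
  have h : cumSum (term p q s) n = conv p (fun k => q k * s k) n := by
    induction n with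
    | zero => simp [cumSum_zero, term, vconv, conv]
    | succ n ih => rw [cumSum_succ, ih]; simp [term, vconv]
  rw [h, conv]
  exact Finset.sum_congr rfl fun k _ => (mul_assoc _ _ _).symm

lemma meanTendsto_iff (p q u s : ℕ → ℝ) (l : ℝ) :
    MeanTendsto p q u s l ↔
      Tendsto (fun n => cumSum (term p q s) n / cumSum (diff u) n) atTop (𝓝 l) := by
  simp only [MeanTendsto, cumSum_diff, cumSum_term, one_div, inv_mul_eq_div]

lemma cumSum_sub_cumSum (c : ℕ → ℝ) {n m : ℕ} (h : n ≤ m) :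
    cumSum c m - cumSum c n = ∑ k ∈ Finset.Ioc n m, c k := by
  induction m, h using Nat.le_induction with
  | base => simp
  | succ m hm ih =>
    rw [cumSum_succ, ← Finset.insert_Ioc_right_eq_Ioc_add_one (by omega), Finset.sum_insert (by simp), ← ih]
    ring

/-- Cauchy product with the geometric series. -/
lemma summable_cumSum {c : ℕ → ℝ} {x : ℝ} (h0 : 0 ≤ x) (h1 : x < 1)
    (h : Summable fun n => c n * x ^ n) :
    (Summable fun n => cumSum c n * x ^ n) ∧
      powerSum c x = (1 - x) * powerSum (cumSum c) x := by
  have hg : Summable fun n : ℕ => x ^ n := summable_geometric_of_lt_one h0 h1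
  have hs := summable_norm_sum_mul_range_of_summable_norm h.norm hg.norm
  have ht := tsum_mul_tsum_eq_tsum_sum_range_of_summable_norm h.norm hg.norm
  have he : ∀ n, ∑ k ∈ Finset.range (n + 1), c k * x ^ k * x ^ (n - k) = cumSum c n * x ^ n := by
    intro n
    rw [cumSum, Finset.sum_mul]
    refine Finset.sum_congr rfl fun k hk => ?_
    rw [mul_assoc, ← pow_add, Nat.add_sub_of_le (by simpa [Nat.lt_succ_iff] using hk)]
  simp only [he] at hs ht
  refine ⟨hs.of_norm, ?_⟩
  rw [tsum_geometric_of_lt_one h0 h1] at ht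
  have : (1 - x) ≠ 0 := by linarith
  simp only [powerSum]
  rw [← ht]
  field_simp

lemma summable_of_cumSum {c : ℕ → ℝ} {x : ℝ} (h : Summable fun n => cumSum c n * x ^ n) :
    Summable fun n => c n * x ^ n := by
  rw [← summable_nat_add_iff 1] at h ⊢
  have h' : Summable fun n => cumSum c n * x ^ n := (summable_nat_add_iff 1).1 h
  refine (h.sub (h'.mul_left x)).congr fun n => ?_
  rw [cumSum_succ]; ring

lemma summable_of_abs_le {c w : ℕ → ℝ} {x K : ℝ} (h0 : 0 ≤ x) (h : Summable fun n => w n * x ^ n)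
    (hc : ∀ᶠ n in atTop, |c n| ≤ K * w n) : Summable fun n => c n * x ^ n := by
  refine Summable.of_norm_bounded_eventually_nat (h.mul_left K) ?_
  filter_upwards [hc] with n hn
  rw [Real.norm_eq_abs, abs_mul, abs_of_nonneg (pow_nonneg h0 n)]
  calc |c n| * x ^ n ≤ K * w n * x ^ n := by gcongr
    _ = _ := by ring

/-- A power series with eventually nonnegative coefficients is bounded below on `[0, R]`. -/
lemma exists_le_powerSum {c : ℕ → ℝ} (R : ℝ) (hc : ∀ᶠ n in atTop, 0 ≤ c n) :
    ∃ K, ∀ x, 0 ≤ x → x ≤ R → (Summable fun n => c n * x ^ n) → -K ≤ powerSum c x := by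
  obtain ⟨N, hN⟩ := eventually_atTop.1 hc
  refine ⟨∑ k ∈ Finset.range N, |c k| * R ^ k, fun x h0 h1 hs => ?_⟩
  have h2 : ∑ k ∈ Finset.range N, c k * x ^ k ≤ powerSum c x := by
    refine hs.sum_le_tsum _ fun i hi => mul_nonneg (hN i ?_) (pow_nonneg h0 i)
    simpa using hi
  refine le_trans ?_ h2
  rw [← Finset.sum_neg_distrib]
  refine Finset.sum_le_sum fun k _ => ?_
  have h3 : |c k * x ^ k| ≤ |c k| * R ^ k := by
    rw [abs_mul, abs_of_nonneg (pow_nonneg h0 k)]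
    gcongr
  exact (abs_le.1 h3).1

lemma powerSum_add {c d : ℕ → ℝ} {x : ℝ} (hc : Summable fun n => c n * x ^ n)
    (hd : Summable fun n => d n * x ^ n) :
    powerSum (fun n => c n + d n) x = powerSum c x + powerSum d x := by
  simp only [powerSum, ← hc.tsum_add hd, add_mul]

lemma powerSum_sub {c d : ℕ → ℝ} {x : ℝ} (hc : Summable fun n => c n * x ^ n)
    (hd : Summable fun n => d n * x ^ n) :
    powerSum (fun n => c n - d n) x = powerSum c x - powerSum d x := by
  simp only [powerSum, ← hc.tsum_sub hd, sub_mul]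

lemma powerSum_const_mul (K : ℝ) (c : ℕ → ℝ) (x : ℝ) :
    powerSum (fun n => K * c n) x = K * powerSum c x := by
  simp only [powerSum, ← tsum_mul_left, mul_assoc]

lemma summable_const_mul {c : ℕ → ℝ} {x : ℝ} (K : ℝ) (hc : Summable fun n => c n * x ^ n) :
    Summable fun n => K * c n * x ^ n := by
  simpa only [mul_assoc] using hc.mul_left K

lemma summable_sub {c d : ℕ → ℝ} {x : ℝ} (hc : Summable fun n => c n * x ^ n)
    (hd : Summable fun n => d n * x ^ n) : Summable fun n => (c n - d n) * x ^ n := by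
  simpa only [sub_mul] using hc.sub hd

/-! ### Averaging: comparison of coefficients and of power series -/

lemma eventually_mem_Ico_left {R : ℝ} (hR : 0 < R) : ∀ᶠ x in 𝓝[<] R, 0 ≤ x ∧ x < R := by
  filter_upwards [Ioo_mem_nhdsLT hR] with x hx using ⟨hx.1.le, hx.2⟩

/-- If `cₙ / wₙ → l` and the series `∑ wₙ xⁿ` tends to `∞`, then the quotient of the two power series
tends to `l`. -/
lemma tendsto_powerSum_div {c w : ℕ → ℝ} {R l : ℝ} (hR : 0 < R)
    (hw : ∀ᶠ n in atTop, 0 < w n) (hs : ∀ x, 0 ≤ x → x < R → Summable fun n => w n * x ^ n)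
    (ht : Tendsto (powerSum w) (𝓝[<] R) atTop)
    (hc : Tendsto (fun n => c n / w n) atTop (𝓝 l)) :
    (∀ x, 0 ≤ x → x < R → Summable fun n => c n * x ^ n) ∧
      Tendsto (fun x => powerSum c x / powerSum w x) (𝓝[<] R) (𝓝 l) := by
  have hsc : ∀ x, 0 ≤ x → x < R → Summable fun n => c n * x ^ n := by
    intro x h0 h1
    refine summable_of_abs_le (K := |l| + 1) h0 (hs x h0 h1) ?_
    have := hc.abs.eventually (ge_mem_nhds (show |l| < |l| + 1 by linarith))
    filter_upwards [hw, this] with n h1 h2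
    rwa [abs_div, abs_of_pos h1, div_le_iff₀ h1] at h2
  refine ⟨hsc, ?_⟩
  rw [Metric.tendsto_nhds]
  intro ε hε
  have h1 := hc.eventually (Metric.ball_mem_nhds l (half_pos hε))
  -- Both `(l + ε/2) w - c` and `c - (l - ε/2) w` have eventually nonnegative coefficients, so their
  -- power series are bounded below; the bounds are absorbed by `(ε/2) ∑ wₙ xⁿ`, which tends to
  -- infinity.
  have e1 : ∀ᶠ n in atTop, 0 ≤ (l + ε / 2) * w n - c n := by
    filter_upwards [h1, hw] with n h2 h3
    rw [Real.dist_eq, abs_lt] at h2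
    have := (div_lt_iff₀ h3).1 (show c n / w n < l + ε / 2 by linarith)
    linarith
  have e2 : ∀ᶠ n in atTop, 0 ≤ c n - (l - ε / 2) * w n := by
    filter_upwards [h1, hw] with n h2 h3
    rw [Real.dist_eq, abs_lt] at h2
    have := (lt_div_iff₀ h3).1 (show l - ε / 2 < c n / w n by linarith)
    linarith
  obtain ⟨K1, hK1⟩ := exists_le_powerSum R e1
  obtain ⟨K2, hK2⟩ := exists_le_powerSum R e2
  filter_upwards [eventually_mem_Ico_left hR, ht.eventually_gt_atTop 0,
    ht.eventually_gt_atTop (K1 * (2 / ε)), ht.eventually_gt_atTop (K2 * (2 / ε))] with x hx h0 h2 h3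
  have a1 := hK1 x hx.1 hx.2.le
    (summable_sub (summable_const_mul _ (hs x hx.1 hx.2)) (hsc x hx.1 hx.2))
  have a2 := hK2 x hx.1 hx.2.le
    (summable_sub (hsc x hx.1 hx.2) (summable_const_mul _ (hs x hx.1 hx.2)))
  rw [powerSum_sub (summable_const_mul _ (hs x hx.1 hx.2)) (hsc x hx.1 hx.2),
    powerSum_const_mul] at a1
  rw [powerSum_sub (hsc x hx.1 hx.2) (summable_const_mul _ (hs x hx.1 hx.2)),
    powerSum_const_mul] at a2
  have b1 : K1 < powerSum w x * (ε / 2) := by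
    have := mul_lt_mul_of_pos_right h2 (half_pos hε)
    rwa [mul_assoc, show 2 / ε * (ε / 2) = 1 by field_simp, mul_one] at this
  have b2 : K2 < powerSum w x * (ε / 2) := by
    have := mul_lt_mul_of_pos_right h3 (half_pos hε)
    rwa [mul_assoc, show 2 / ε * (ε / 2) = 1 by field_simp, mul_one] at this
  rw [Real.dist_eq, abs_lt]
  constructor
  · rw [lt_sub_iff_add_lt, lt_div_iff₀ h0]; nlinarith
  · rw [sub_lt_iff_lt_add, div_lt_iff₀ h0]; nlinarith

/-- A finite section of the series is continuous at `1`, where it takes a value above `M`; the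
section is taken long enough for the omitted terms to be positive. -/
lemma tendsto_powerSum_atTop {v : ℕ → ℝ} (hv : ∀ᶠ n in atTop, 0 < v n)
    (hs : ∀ x, 0 ≤ x → x < 1 → Summable fun n => v n * x ^ n)
    (hu : Tendsto (cumSum v) atTop atTop) : Tendsto (powerSum v) (𝓝[<] 1) atTop := by
  rw [tendsto_atTop]
  intro M
  obtain ⟨N, hN⟩ := eventually_atTop.1 hv
  obtain ⟨n, hn, hM⟩ := ((eventually_ge_atTop N).and (hu.eventually_gt_atTop M)).exists
  have hc : Tendsto (fun x : ℝ => ∑ k ∈ Finset.range (n + 1), v k * x ^ k) (𝓝[<] 1)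
      (𝓝 (cumSum v n)) := by
    have : Continuous (fun x : ℝ => ∑ k ∈ Finset.range (n + 1), v k * x ^ k) := by fun_prop
    have h := (this.tendsto 1).mono_left (nhdsWithin_le_nhds (s := Set.Iio 1))
    simpa [cumSum] using h
  filter_upwards [hc.eventually (lt_mem_nhds hM), eventually_mem_Ico_left one_pos] with x hx hx1
  refine hx.le.trans ((hs x hx1.1 hx1.2).sum_le_tsum _ fun i hi => ?_)
  refine mul_nonneg (hN i ?_).le (pow_nonneg hx1.1 i)
  have : n + 1 ≤ i := by simpa using hi
  omega

/-! ### Changing finitely many coefficients -/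

/-- The sequence `c` with its first `n₀` terms replaced by `d`. -/
def trunc (n₀ : ℕ) (d : ℝ) (c : ℕ → ℝ) (n : ℕ) : ℝ := if n < n₀ then d else c n

lemma trunc_of_le {n₀ n : ℕ} (h : n₀ ≤ n) (d : ℝ) (c : ℕ → ℝ) : trunc n₀ d c n = c n := by
  simp [trunc, h]

lemma trunc_eventuallyEq (n₀ : ℕ) (d : ℝ) (c : ℕ → ℝ) : trunc n₀ d c =ᶠ[atTop] c := by
  filter_upwards [eventually_ge_atTop n₀] with n hn using trunc_of_le hn d c

lemma summable_congr_eventually {c d : ℕ → ℝ} (h : c =ᶠ[atTop] d) {x : ℝ}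
    (hd : Summable fun n => d n * x ^ n) : Summable fun n => c n * x ^ n := by
  refine (summable_congr_atTop ?_).2 hd
  filter_upwards [h] with n hn
  rw [hn]

/-- Changing finitely many coefficients changes a power series by a function with a limit at `1`. -/
lemma exists_tendsto_powerSum_sub {c d : ℕ → ℝ} (h : c =ᶠ[atTop] d)
    (hd : ∀ x, 0 ≤ x → x < 1 → Summable fun n => d n * x ^ n) :
    ∃ L, Tendsto (fun x => powerSum c x - powerSum d x) (𝓝[<] 1) (𝓝 L) := by
  obtain ⟨N, hN⟩ := eventually_atTop.1 h
  have hc : Continuous (fun x : ℝ => ∑ k ∈ Finset.range N, (c k - d k) * x ^ k) := by fun_prop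
  refine ⟨_, ((hc.tendsto 1).mono_left (nhdsWithin_le_nhds (s := Set.Iio 1))).congr' ?_⟩
  filter_upwards [eventually_mem_Ico_left one_pos] with x hx
  rw [← powerSum_sub (summable_congr_eventually h (hd x hx.1 hx.2)) (hd x hx.1 hx.2), powerSum,
    tsum_eq_sum]
  intro n hn
  rw [hN n (by simpa using hn), sub_self, zero_mul]

lemma exists_tendsto_cumSum_sub {c d : ℕ → ℝ} (h : c =ᶠ[atTop] d) :
    ∃ L, Tendsto (fun n => cumSum c n - cumSum d n) atTop (𝓝 L) := by
  obtain ⟨N, hN⟩ := eventually_atTop.1 h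
  refine ⟨cumSum c N - cumSum d N, tendsto_const_nhds.congr' ?_⟩
  filter_upwards [eventually_ge_atTop N] with n hn
  have h1 := cumSum_sub_cumSum c hn
  have h2 := cumSum_sub_cumSum d hn
  have h3 : ∑ k ∈ Finset.Ioc N n, c k = ∑ k ∈ Finset.Ioc N n, d k :=
    Finset.sum_congr rfl fun k hk => hN k (Finset.mem_Ioc.1 hk).1.le
  linarith

/-- Bounded perturbations of numerator and denominator do not change the limit of a quotient whose
denominator tends to `∞`. -/
lemma tendsto_div_of_sub {α : Type*} {F : Filter α} {f g f' g' : α → ℝ} {l L M : ℝ}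
    (hg : Tendsto g F atTop) (h : Tendsto (fun x => f x / g x) F (𝓝 l))
    (hf' : Tendsto (fun x => f' x - f x) F (𝓝 L)) (hg' : Tendsto (fun x => g' x - g x) F (𝓝 M)) :
    Tendsto (fun x => f' x / g' x) F (𝓝 l) := by
  have h1 : Tendsto (fun x => f x / g x + (f' x - f x) / g x) F (𝓝 (l + 0)) :=
    h.add (hf'.div_atTop hg)
  have h2 : Tendsto (fun x => 1 + (g' x - g x) / g x) F (𝓝 (1 + 0)) :=
    tendsto_const_nhds.add (hg'.div_atTop hg)
  have h3 := h1.div h2 (by norm_num)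
  simp only [add_zero, div_one] at h3
  refine h3.congr' ?_
  filter_upwards [hg.eventually_gt_atTop 0] with x hx
  have : g x ≠ 0 := hx.ne'
  simp only [Pi.div_apply]
  rw [← add_div, show 1 + (g' x - g x) / g x = g' x / g x by field_simp; ring,
    div_div_div_cancel_right₀ this]
  congr 1; ring

lemma tendsto_cumSum_atTop_congr {c d : ℕ → ℝ} (h : c =ᶠ[atTop] d)
    (hd : Tendsto (cumSum d) atTop atTop) : Tendsto (cumSum c) atTop atTop := by
  obtain ⟨L, hL⟩ := exists_tendsto_cumSum_sub h
  simpa using hL.add_atTop hd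

lemma tendsto_powerSum_div_congr {a a' v v' : ℕ → ℝ} {l : ℝ} (ha : a' =ᶠ[atTop] a)
    (hv : v' =ᶠ[atTop] v) (hsa : ∀ x, 0 ≤ x → x < 1 → Summable fun n => a n * x ^ n)
    (hsv : ∀ x, 0 ≤ x → x < 1 → Summable fun n => v n * x ^ n)
    (hD : Tendsto (powerSum v) (𝓝[<] 1) atTop)
    (h : Tendsto (fun x => powerSum a x / powerSum v x) (𝓝[<] 1) (𝓝 l)) :
    Tendsto (fun x => powerSum a' x / powerSum v' x) (𝓝[<] 1) (𝓝 l) := by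
  obtain ⟨L, hL⟩ := exists_tendsto_powerSum_sub ha hsa
  obtain ⟨M, hM⟩ := exists_tendsto_powerSum_sub hv hsv
  exact tendsto_div_of_sub hD h hL hM

lemma tendsto_cumSum_div_congr {a a' v v' : ℕ → ℝ} {l : ℝ} (ha : a' =ᶠ[atTop] a)
    (hv : v' =ᶠ[atTop] v) (hu : Tendsto (cumSum v) atTop atTop)
    (h : Tendsto (fun n => cumSum a n / cumSum v n) atTop (𝓝 l)) :
    Tendsto (fun n => cumSum a' n / cumSum v' n) atTop (𝓝 l) := by
  obtain ⟨L, hL⟩ := exists_tendsto_cumSum_sub ha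
  obtain ⟨M, hM⟩ := exists_tendsto_cumSum_sub hv
  exact tendsto_div_of_sub hu h hL hM

lemma cumSum_pos {v : ℕ → ℝ} (hv : ∀ n, 0 < v n) (n : ℕ) : 0 < cumSum v n :=
  Finset.sum_pos (fun k _ => hv k) (by simp)

lemma cumSum_mono {v : ℕ → ℝ} (hv : ∀ n, 0 ≤ v n) : Monotone (cumSum v) :=
  monotone_nat_of_le_succ fun n => by rw [cumSum_succ]; linarith [hv (n + 1)]

lemma summable_of_lt_radius {c : ℕ → ℝ} {x : ℝ} (h0 : 0 ≤ x) (h : ENNReal.ofReal x < radius c) :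
    Summable fun n => c n * x ^ n := by
  have := FormalMultilinearSeries.summable_norm_mul_pow _ (r := x.toNNReal) h
  refine Summable.of_norm ?_
  refine this.congr fun n => ?_
  rw [FormalMultilinearSeries.ofScalars_norm, norm_mul, norm_pow, Real.coe_toNNReal x h0,
    Real.norm_of_nonneg h0]

/-! ### The Abelian theorem (i) -/

/-- The Abelian theorem: Voronoi convergence implies Voronoi power series convergence. -/
theorem powerTendsto_of_meanTendsto {p q u s : ℕ → ℝ} {l R : ℝ} (hR : 0 < R)
    (hv : ∀ n, 0 < diff u n) (hu : Tendsto u atTop atTop)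
    (hr : radius (diff u) = ENNReal.ofReal R)
    (hD : Tendsto (powerSum (diff u)) (𝓝[<] R) atTop) (h : MeanTendsto p q u s l) :
    PowerTendsto p q (diff u) R s l := by
  have hs : ∀ x, 0 ≤ x → x < R → Summable fun n => diff u n * x ^ n := fun x h0 h1 =>
    summable_of_lt_radius h0 (by rw [hr]; exact (ENNReal.ofReal_lt_ofReal_iff hR).2 h1)
  -- For `R > 1` the series `D` would converge at `1`, making `u` convergent. The bound is what
  -- allows division by `1 - x`.
  have hR1 : R ≤ 1 := by
    by_contra! hR1
    have h1 := hs 1 zero_le_one hR1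
    simp only [one_pow, mul_one] at h1
    have h2 := h1.hasSum.tendsto_sum_nat
    rw [← tendsto_add_atTop_iff_nat 1] at h2
    have h3 : Tendsto u atTop (𝓝 (∑' n, diff u n)) := by
      rw [← cumSum_diff u] at hu ⊢
      rw [cumSum_diff u] at ⊢
      refine h2.congr fun n => ?_
      change cumSum (diff u) n = u n
      rw [cumSum_diff]
    exact not_tendsto_nhds_of_tendsto_atTop hu _ h3
  have hpos : ∀ n, 0 < cumSum (diff u) n := cumSum_pos hv
  have hcs : ∀ x, 0 ≤ x → x < R → Summable fun n => cumSum (diff u) n * x ^ n :=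
    fun x h0 h1 => (summable_cumSum h0 (h1.trans_le hR1) (hs x h0 h1)).1
  have heq : ∀ x, 0 ≤ x → x < R → powerSum (diff u) x = (1 - x) * powerSum (cumSum (diff u)) x :=
    fun x h0 h1 => (summable_cumSum h0 (h1.trans_le hR1) (hs x h0 h1)).2
  -- Since `0 < 1 - x ≤ 1`, the series of the `u n` dominates `D`.
  have hct : Tendsto (powerSum (cumSum (diff u))) (𝓝[<] R) atTop := by
    refine tendsto_atTop_mono' _ ?_ hD
    filter_upwards [eventually_mem_Ico_left hR] with x hx
    rw [heq x hx.1 hx.2]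
    have : 0 ≤ powerSum (cumSum (diff u)) x :=
      tsum_nonneg fun n => mul_nonneg (hpos n).le (pow_nonneg hx.1 n)
    nlinarith [hx.1]
  obtain ⟨g1, g2⟩ := tendsto_powerSum_div hR (Eventually.of_forall hpos) hcs hct
    ((meanTendsto_iff p q u s l).1 h)
  have hsa : ∀ x, 0 ≤ x → x < R → Summable fun n => term p q s n * x ^ n :=
    fun x h0 h1 => summable_of_cumSum (g1 x h0 h1)
  refine ⟨hs, hsa, g2.congr' ?_⟩
  filter_upwards [eventually_mem_Ico_left hR] with x hx
  rw [heq x hx.1 hx.2, (summable_cumSum hx.1 (hx.2.trans_le hR1) (hsa x hx.1 hx.2)).2,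
    mul_div_mul_left]
  linarith [hx.2]

/-! ### Local uniformity in regular variation -/

/-- A Baire category argument: if `g n` is right-continuous and `g n θ → 1` for every `θ`, then the
convergence is uniform on some interval, up to a prescribed error. -/
lemma exists_Ioo_forall_abs_sub_le {g : ℕ → ℝ → ℝ}
    (hg : ∀ᶠ n in atTop, ∀ θ, ContinuousWithinAt (g n) (Set.Ici θ) θ)
    (h : ∀ θ, Tendsto (fun n => g n θ) atTop (𝓝 1)) {η : ℝ} (hη : 0 < η) :
    ∃ N : ℕ, ∃ α β : ℝ, α < β ∧ ∀ n ≥ N, ∀ θ ∈ Set.Ioo α β, |g n θ - 1| ≤ η := by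
  obtain ⟨N₁, hN₁⟩ := eventually_atTop.1 hg
  let E : ℕ → Set ℝ := fun N => {θ | ∀ n ≥ N, |g n θ - 1| ≤ η}
  -- The sets `E N` need not be closed, since `g n` is only right-continuous. Baire is applied to
  -- their closures, and the bound is recovered afterwards from the density of `E N`.
  have hE : ⋃ N, closure (E N) = Set.univ := by
    refine Set.eq_univ_of_forall fun θ => ?_
    obtain ⟨N, hN⟩ := eventually_atTop.1 (Metric.tendsto_nhds.1 (h θ) η hη)
    exact Set.mem_iUnion.2 ⟨N, subset_closure fun n hn => (hN n hn).le⟩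
  obtain ⟨N, θ₀, hθ₀⟩ := nonempty_interior_of_iUnion_of_closed (fun N => isClosed_closure) hE
  obtain ⟨r, hr, hball⟩ := Metric.isOpen_iff.1 isOpen_interior θ₀ hθ₀
  refine ⟨max N N₁, θ₀ - r, θ₀ + r, by linarith, fun n hn θ hθ => ?_⟩
  have hsub : Set.Ioo (θ₀ - r) (θ₀ + r) ⊆ closure (E N) := by
    rw [← Real.ball_eq_Ioo]
    exact hball.trans interior_subset
  have hcont := hN₁ n (le_of_max_le_right hn) θ
  have hc : ContinuousWithinAt (fun t => |g n t - 1|) (Set.Ici θ) θ :=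
    (hcont.sub continuousWithinAt_const).abs
  -- By right continuity a violation at `θ` persists on some interval to the right of `θ`, which
  -- meets the dense set `E N`.
  by_contra! hlt
  have hev : ∀ᶠ t in 𝓝[≥] θ, η < |g n t - 1| := hc.eventually (lt_mem_nhds hlt)
  obtain ⟨t, ht, htI⟩ := mem_nhdsGE_iff_exists_Ico_subset.1 hev
  have hlt2 : θ < min t (θ₀ + r) := lt_min ht hθ.2
  have hmem : (θ + min t (θ₀ + r)) / 2 ∈ Set.Ioo θ (min t (θ₀ + r)) :=
    ⟨by linarith, by linarith⟩
  have hcl : (θ + min t (θ₀ + r)) / 2 ∈ closure (E N) :=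
    hsub ⟨hθ.1.trans hmem.1, hmem.2.trans_le (min_le_right _ _)⟩
  obtain ⟨z, hz, hzE⟩ := mem_closure_iff.1 hcl _ isOpen_Ioo hmem
  have h1 := htI ⟨hz.1.le, hz.2.trans_le (min_le_left _ _)⟩
  exact absurd (hzE n (le_of_max_le_left hn)) (not_le.2 h1)

/-- Local uniformity at ratio one of regular variation along the integers, for right-continuous
functions. -/
lemma exists_forall_abs_div_sub_one_le {f : ℝ → ℝ} {ρ : ℝ}
    (hc : ∀ x, 0 < x → ContinuousWithinAt f (Set.Ici x) x) (hp : ∀ᶠ x in atTop, 0 < f x)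
    (h : ∀ c : ℝ, 0 < c → Tendsto (fun n : ℕ => f (c * n) / f n) atTop (𝓝 (c ^ ρ)))
    {ε : ℝ} (hε : 0 < ε) :
    ∃ δ > 0, ∃ X > 0, ∀ x ≥ X, ∀ y, x ≤ y → y ≤ (1 + δ) * x → |f y / f x - 1| ≤ ε := by
  -- In the logarithmic variable regular variation says that `g n` tends to `1` pointwise, as the
  -- Baire argument requires.
  set g : ℕ → ℝ → ℝ := fun n θ => f (Real.exp θ * n) / f n * Real.exp (-(ρ * θ)) with hgdef
  obtain ⟨η, hη, hη1, hη2⟩ : ∃ η > 0, η ≤ ε / 8 ∧ η ≤ 1 / 8 :=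
    ⟨min (ε / 8) (1 / 8), by positivity, min_le_left _ _, min_le_right _ _⟩
  have hg : ∀ᶠ n in atTop, ∀ θ, ContinuousWithinAt (g n) (Set.Ici θ) θ := by
    filter_upwards [eventually_gt_atTop 0] with n hn θ
    have hn' : (0 : ℝ) < n := by exact_mod_cast hn
    have h1 : ContinuousWithinAt (fun t : ℝ => f (Real.exp t * n)) (Set.Ici θ) θ := by
      refine (hc (Real.exp θ * n) (by positivity)).comp (f := fun t : ℝ => Real.exp t * n)
        (by fun_prop) fun t ht => ?_
      have : Real.exp θ ≤ Real.exp t := Real.exp_le_exp.2 ht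
      exact mul_le_mul_of_nonneg_right this hn'.le
    exact (h1.div_const _).mul (by fun_prop)
  have hl : ∀ θ, Tendsto (fun n => g n θ) atTop (𝓝 1) := by
    intro θ
    have h1 := (h (Real.exp θ) (Real.exp_pos θ)).mul_const (Real.exp (-(ρ * θ)))
    rwa [← Real.exp_mul, ← Real.exp_add, show θ * ρ + -(ρ * θ) = 0 by ring, Real.exp_zero] at h1
  obtain ⟨N, α, β, hαβ, hN⟩ := exists_Ioo_forall_abs_sub_le hg hl hη
  have hexp : ∀ᶠ t in 𝓝 (0 : ℝ), |Real.exp (ρ * t) - 1| < η := by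
    have : Tendsto (fun t : ℝ => Real.exp (ρ * t)) (𝓝 0) (𝓝 (Real.exp (ρ * 0))) :=
      Continuous.tendsto (by fun_prop) 0
    rw [mul_zero, Real.exp_zero] at this
    exact Metric.tendsto_nhds.1 this η hη
  obtain ⟨δ₁, hδ₁, hexp⟩ := Metric.eventually_nhds_iff.1 hexp
  set α' := (α + β) / 2 with hα'
  obtain ⟨X₀, hX₀⟩ := eventually_atTop.1 hp
  obtain ⟨N₂, hN₂⟩ := exists_nat_gt (2 / (β - α'))
  have hβ : 0 < β - α' := by rw [hα']; linarith
  obtain ⟨δ, hδ, hδa, hδb⟩ : ∃ δ > 0, δ < δ₁ ∧ δ < (β - α') / 2 := by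
    refine ⟨min δ₁ ((β - α') / 2) / 2, by positivity, ?_, ?_⟩
    · linarith [min_le_left δ₁ ((β - α') / 2)]
    · linarith [min_le_right δ₁ ((β - α') / 2)]
  refine ⟨δ, hδ, max 1 (Real.exp α' * (max N (max N₂ (max 1 ⌈X₀⌉₊)) : ℕ)), by positivity,
    fun x hx y hxy hy => ?_⟩
  have hx0 : 0 < x := lt_of_lt_of_le one_pos ((le_max_left _ _).trans hx)
  have hy0 : 0 < y := hx0.trans_le hxy
  -- Rounding `x / exp α'` down to an integer puts `log (x/n)` in `[α', α' + 1/n]`. As `1/n` and `δ`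
  -- are both below `(β - α')/2`, the numbers `log (x/n)` and `log (y/n)` lie in `(α, β)`, where `g
  -- n` is within `η` of `1`. The quotient `f y / f x` is then `B T / A` with all three factors near
  -- `1`.
  set n := ⌊x / Real.exp α'⌋₊ with hn
  have hnge : max N (max N₂ (max 1 ⌈X₀⌉₊)) ≤ n := by
    refine Nat.le_floor ?_
    rw [le_div_iff₀ (Real.exp_pos _), mul_comm]
    exact (le_max_right _ _).trans hx
  have hnN : N ≤ n := (le_max_left _ _).trans hnge
  have hnN₂ : N₂ ≤ n := ((le_max_left _ _).trans (le_max_right _ _)).trans hnge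
  have hn1 : 1 ≤ n :=
    (((le_max_left _ _).trans (le_max_right _ _)).trans (le_max_right _ _)).trans hnge
  have hnX : X₀ ≤ n := (Nat.le_ceil _).trans (by
    exact_mod_cast
      (((le_max_right _ _).trans (le_max_right _ _)).trans (le_max_right _ _)).trans hnge)
  have hn0 : (0 : ℝ) < n := by exact_mod_cast hn1
  have hfn := hX₀ n hnX
  have hle : Real.exp α' * n ≤ x := by
    have := Nat.floor_le (show 0 ≤ x / Real.exp α' by positivity)
    rwa [← hn, le_div_iff₀ (Real.exp_pos _), mul_comm] at this
  have hlt : x < Real.exp α' * (n + 1) := by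
    have := Nat.lt_floor_add_one (x / Real.exp α')
    rwa [← hn, div_lt_iff₀ (Real.exp_pos _), mul_comm] at this
  have hinv : 1 / (n : ℝ) < (β - α') / 2 := by
    have h1 : 2 / (β - α') < n := hN₂.trans_le (by exact_mod_cast hnN₂)
    rw [div_lt_iff₀ hβ] at h1
    rw [div_lt_iff₀ hn0]
    linarith
  have hlogx1 : α' ≤ Real.log (x / n) := by
    rw [Real.le_log_iff_exp_le (by positivity), le_div_iff₀ hn0]
    exact hle
  have hlogx2 : Real.log (x / n) ≤ α' + 1 / n := by
    have h1 : x / n ≤ Real.exp α' * (1 + 1 / n) := by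
      rw [div_le_iff₀ hn0]
      have : Real.exp α' * (1 + 1 / (n : ℝ)) * n = Real.exp α' * (n + 1) := by field_simp
      rw [this]; exact hlt.le
    have h2 : Real.log (x / n) ≤ Real.log (Real.exp α' * (1 + 1 / n)) :=
      Real.log_le_log (by positivity) h1
    rw [Real.log_mul (by positivity) (by positivity), Real.log_exp] at h2
    have h3 := Real.log_le_sub_one_of_pos (show (0 : ℝ) < 1 + 1 / n by positivity)
    linarith
  set τ := Real.log (y / x) with hτ
  have hτ0 : 0 ≤ τ := Real.log_nonneg (by rwa [le_div_iff₀ hx0, one_mul])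
  have hτ1 : τ ≤ δ := by
    have h1 : y / x ≤ 1 + δ := by rwa [div_le_iff₀ hx0]
    have h2 := Real.log_le_sub_one_of_pos (show 0 < y / x by positivity)
    linarith
  have hlogy : Real.log (y / n) = Real.log (x / n) + τ := by
    rw [hτ, ← Real.log_mul (by positivity) (by positivity)]
    congr 1; field_simp
  have hαα : α < α' := by rw [hα']; linarith
  have gx := hN n hnN (Real.log (x / n)) ⟨by linarith, by linarith⟩
  have gy := hN n hnN (Real.log (y / n)) ⟨by linarith, by linarith⟩
  have e := hexp (show dist τ 0 < δ₁ by rw [Real.dist_eq, sub_zero, abs_of_nonneg hτ0]; linarith)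
  have hgx : f x = g n (Real.log (x / n)) * f n * Real.exp (ρ * Real.log (x / n)) := by
    simp only [hgdef]
    rw [Real.exp_log (by positivity), div_mul_cancel₀ _ hn0.ne', Real.exp_neg]
    field_simp
  have hgy : f y = g n (Real.log (y / n)) * f n * (Real.exp (ρ * Real.log (x / n))
      * Real.exp (ρ * τ)) := by
    rw [← Real.exp_add, ← mul_add, ← hlogy]
    simp only [hgdef]
    rw [Real.exp_log (by positivity), div_mul_cancel₀ _ hn0.ne', Real.exp_neg]
    field_simp
  generalize g n (Real.log (x / n)) = A at *
  generalize g n (Real.log (y / n)) = B at *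
  generalize Real.exp (ρ * τ) = T at *
  rw [abs_le] at gx gy
  rw [abs_lt] at e
  have hA : 0 < A := by linarith
  have hq : f y / f x = B * T / A := by
    rw [hgx, hgy]
    have := Real.exp_pos (ρ * Real.log (x / n))
    field_simp
  rw [hq, abs_le]
  have hBT1 : (1 - η) * (1 - η) ≤ B * T := by
    apply mul_le_mul <;> linarith
  have hBT2 : B * T ≤ (1 + η) * (1 + η) := by
    apply mul_le_mul <;> linarith
  constructor
  · rw [le_sub_iff_add_le, le_div_iff₀ hA]
    refine le_trans ?_ hBT1
    rcases le_total ε 1 with hε1 | hε1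
    · have h1 : (-ε + 1) * A ≤ (-ε + 1) * (1 + η) :=
        mul_le_mul_of_nonneg_left (by linarith) (by linarith)
      have h2 : 0 ≤ ε * η := by positivity
      linarith [sq_nonneg η]
    · have h1 : (-ε + 1) * A ≤ 0 := mul_nonpos_of_nonpos_of_nonneg (by linarith) hA.le
      linarith [mul_self_nonneg (1 - η)]
  · rw [sub_le_iff_le_add, div_le_iff₀ hA]
    refine hBT2.trans ?_
    have h1 : (ε + 1) * (1 - η) ≤ (ε + 1) * A :=
      mul_le_mul_of_nonneg_left (by linarith) (by linarith)
    have h2 : ε * η ≤ ε * (1 / 8) := mul_le_mul_of_nonneg_left hη2 hε.le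
    have h3 : η * η ≤ η * (1 / 8) := mul_le_mul_of_nonneg_left hη2 hη.le
    linarith

lemma continuousWithinAt_floor_comp (v : ℕ → ℝ) {x : ℝ} (hx : 0 < x) :
    ContinuousWithinAt (fun y : ℝ => v ⌊y⌋₊) (Set.Ici x) x := by
  have h : (fun y : ℝ => v ⌊y⌋₊) =ᶠ[𝓝[≥] x] fun _ => v ⌊x⌋₊ := by
    filter_upwards [self_mem_nhdsWithin,
      nhdsWithin_le_nhds (Iio_mem_nhds (Nat.lt_floor_add_one x))] with y hy hy2
    have hxy : x ≤ y := hy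
    have : ⌊y⌋₊ = ⌊x⌋₊ := by
      refine le_antisymm ?_ (Nat.floor_mono hxy)
      have h3 : ⌊y⌋₊ < ⌊x⌋₊ + 1 := by
        rw [Nat.floor_lt (hx.le.trans hxy)]
        exact_mod_cast hy2
      omega
    rw [this]
  exact continuousWithinAt_const.congr_of_eventuallyEq h rfl

/-! ### Sequences with ratios near one; doubling -/

/-- A sequence varies slowly at ratio one: `vₘ / vₙ` is near `1` when `m / n` is near `1`. -/
def RatioNearOne (v : ℕ → ℝ) : Prop :=
  ∀ ε > 0, ∃ δ > 0, ∃ N : ℕ, ∀ n ≥ N, ∀ m : ℕ, n ≤ m → (m : ℝ) ≤ (1 + δ) * n →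
    |v m / v n - 1| ≤ ε

lemma RegVarSeq.ratioNearOne {v : ℕ → ℝ} {ρ : ℝ} (h : RegVarSeq v ρ) : RatioNearOne v := by
  intro ε hε
  obtain ⟨δ, hδ, X, -, hX⟩ := exists_forall_abs_div_sub_one_le (f := fun y : ℝ => v ⌊y⌋₊) (ρ := ρ)
    (fun x hx => continuousWithinAt_floor_comp v hx)
    (tendsto_nat_floor_atTop.eventually h.1) (by simpa using h.2) hε
  refine ⟨δ, hδ, ⌈X⌉₊, fun n hn m hnm hm => ?_⟩
  simpa using hX n ((Nat.le_ceil X).trans (by exact_mod_cast hn)) m (by exact_mod_cast hnm) hm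

lemma RatioNearOne.congr {v w : ℕ → ℝ} (h : RatioNearOne v) (hw : w =ᶠ[atTop] v) :
    RatioNearOne w := by
  obtain ⟨N₁, hN₁⟩ := eventually_atTop.1 hw
  intro ε hε
  obtain ⟨δ, hδ, N, hN⟩ := h ε hε
  refine ⟨δ, hδ, max N N₁, fun n hn m hnm hm => ?_⟩
  have hn1 : N₁ ≤ n := (le_max_right _ _).trans hn
  rw [hN₁ n hn1, hN₁ m (hn1.trans hnm)]
  exact hN n ((le_max_left _ _).trans hn) m hnm hm

/-- The block from `n` to `m` contributes at most `2 (m - n) v n`, whereas the block from `n / (1 +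
δ₀)` to `n` alone gives `u n` at least a fixed multiple of `n * v n`. -/
lemma RatioNearOne.cumSum {v : ℕ → ℝ} (hv : ∀ n, 0 < v n) (h : RatioNearOne v) :
    RatioNearOne (cumSum v) := by
  intro ε hε
  obtain ⟨δ₁, hδ₁, N, hN⟩ := h (1 / 2) (by norm_num)
  obtain ⟨δ₀, hδ₀, hδ₀₁, hδ₀1⟩ : ∃ δ₀ > 0, δ₀ ≤ δ₁ ∧ δ₀ ≤ 1 :=
    ⟨min δ₁ 1, by positivity, min_le_left _ _, min_le_right _ _⟩
  have hN' : ∀ n ≥ N, ∀ m : ℕ, n ≤ m → (m : ℝ) ≤ (1 + δ₀) * n → v m ≤ 2 * v n ∧ v n ≤ 2 * v m := by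
    intro n hn m hnm hm
    have h1 := hN n hn m hnm (hm.trans (by gcongr))
    rw [abs_le] at h1
    have h2 : v m / v n ≤ 2 := by linarith
    have h3 : 1 / 2 ≤ v m / v n := by linarith
    rw [div_le_iff₀ (hv n)] at h2
    rw [le_div_iff₀ (hv n)] at h3
    exact ⟨h2, by linarith⟩
  -- The constant `ε δ₀ / 8` equates `(ε δ₀ n / 8)(2 v n)` with `ε (n δ₀ / 2)(v n / 2)`, the last
  -- product being `ε` times the lower bound for `u n`. Asking for `n ≥ 2 N` keeps `n / (1 + δ₀)`
  -- above `N`.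
  refine ⟨min δ₀ (ε * δ₀ / 8), by positivity, max 1 (2 * N), fun n hn m hnm hm => ?_⟩
  have hn1 : 1 ≤ n := (le_max_left _ _).trans hn
  have hn0 : (0 : ℝ) < n := by exact_mod_cast hn1
  have hn2 : (2 * N : ℝ) ≤ n := by exact_mod_cast (le_max_right _ _).trans hn
  have hm1 : (m : ℝ) ≤ (1 + δ₀) * n := hm.trans (by gcongr; exact min_le_left _ _)
  have hm2 : (m : ℝ) ≤ (1 + ε * δ₀ / 8) * n := hm.trans (by gcongr; exact min_le_right _ _)
  have hnN : N ≤ n := by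
    have : 2 * N ≤ n := (le_max_right _ _).trans hn
    omega
  have hup : Voronoi.cumSum v m - Voronoi.cumSum v n ≤ (m - n) * (2 * v n) := by
    rw [cumSum_sub_cumSum v hnm]
    refine (Finset.sum_le_card_nsmul _ _ (2 * v n) fun k hk => ?_).trans ?_
    · rw [Finset.mem_Ioc] at hk
      exact (hN' n hnN k hk.1.le (le_trans (by exact_mod_cast hk.2) hm1)).1
    · rw [Nat.card_Ioc, nsmul_eq_mul, Nat.cast_sub hnm]
  set L := ⌈(n : ℝ) / (1 + δ₀)⌉₊ with hL
  have hLn : L ≤ n := by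
    refine Nat.ceil_le.2 ?_
    rw [div_le_iff₀ (by positivity)]
    nlinarith
  have hLN : N ≤ L := by
    have : (N : ℝ) ≤ n / (1 + δ₀) := by
      rw [le_div_iff₀ (by positivity)]
      have : (N : ℝ) * (1 + δ₀) ≤ N * 2 := by gcongr; linarith
      linarith
    exact_mod_cast this.trans (Nat.le_ceil _)
  have hlow : (n * δ₀ / 2) * (v n / 2) ≤ Voronoi.cumSum v n := by
    have h1 : ∑ k ∈ Finset.Icc L n, v k ≤ Voronoi.cumSum v n := by
      refine Finset.sum_le_sum_of_subset_of_nonneg (fun k hk => ?_) fun k _ _ => (hv k).le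
      rw [Finset.mem_Icc] at hk
      exact Finset.mem_range.2 (by omega)
    refine le_trans ?_ h1
    refine le_trans ?_ (Finset.card_nsmul_le_sum _ _ (v n / 2) fun k hk => ?_)
    · rw [Nat.card_Icc, nsmul_eq_mul, Nat.cast_sub (by omega)]
      refine mul_le_mul_of_nonneg_right ?_ (half_pos (hv n)).le
      have h2 := Nat.ceil_lt_add_one (show 0 ≤ (n : ℝ) / (1 + δ₀) by positivity)
      rw [← hL] at h2
      have h3 : (n : ℝ) / (1 + δ₀) ≤ n - n * δ₀ / 2 := by
        rw [div_le_iff₀ (by positivity)]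
        nlinarith [mul_nonneg (mul_nonneg hn0.le hδ₀.le) (sub_nonneg.2 hδ₀1)]
      push_cast
      linarith
    · rw [Finset.mem_Icc] at hk
      have h2 : (n : ℝ) ≤ (1 + δ₀) * k := by
        have h3 := (Nat.le_ceil ((n : ℝ) / (1 + δ₀))).trans
          (show (L : ℝ) ≤ k by exact_mod_cast hk.1)
        rw [div_le_iff₀ (by positivity)] at h3
        linarith
      linarith [(hN' k (hLN.trans hk.1) n hk.2 h2).1]
  have hu := cumSum_pos hv n
  have hmono := cumSum_mono (fun k => (hv k).le) hnm
  rw [div_sub_one hu.ne', abs_of_nonneg (div_nonneg (by linarith) hu.le), div_le_iff₀ hu]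
  calc Voronoi.cumSum v m - Voronoi.cumSum v n ≤ (m - n) * (2 * v n) := hup
    _ ≤ (ε * δ₀ / 8 * n) * (2 * v n) :=
        mul_le_mul_of_nonneg_right (by linarith) (by linarith [hv n])
    _ = ε * ((n * δ₀ / 2) * (v n / 2)) := by ring
    _ ≤ ε * Voronoi.cumSum v n := by gcongr

/-- For large `n`, one step of ratio `1 + δ` at most doubles `u`. Rounding is paid for by using the
ratio `1 + δ/2`, and `j` steps reach `3 n ≥ 2 n + 1`. Small `n` go into the constant, by
monotonicity. -/
lemma RatioNearOne.exists_doubling {u : ℕ → ℝ} (hu : ∀ n, 0 < u n) (hm : Monotone u)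
    (h : RatioNearOne u) : ∃ C : ℝ, 0 < C ∧ ∀ n, u (2 * n + 1) ≤ C * u n := by
  obtain ⟨δ, hδ, N, hN⟩ := h 1 one_pos
  obtain ⟨N₁, hN₁⟩ := exists_nat_gt (2 / δ)
  obtain ⟨j, hj⟩ := pow_unbounded_of_one_lt 3 (show 1 < 1 + δ / 2 by linarith)
  have key : ∀ i : ℕ, ∀ n ≥ max N N₁, ∀ m : ℕ, (m : ℝ) ≤ (1 + δ / 2) ^ i * n →
      u m ≤ 2 ^ i * u n := by
    intro i
    induction i with
    | zero =>
      intro n hn m hmn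
      simp only [pow_zero, one_mul, Nat.cast_le] at hmn ⊢
      exact hm hmn
    | succ i ih =>
      intro n hn m hmn
      have hn1 : (N₁ : ℝ) ≤ n := by exact_mod_cast (le_max_right _ _).trans hn
      have h2 : 1 ≤ δ / 2 * n := by
        have h3 : 2 / δ < n := hN₁.trans_le hn1
        rw [div_lt_iff₀ hδ] at h3
        linarith
      have h3 := Nat.lt_floor_add_one ((1 + δ) * (n : ℝ))
      have h4 := Nat.floor_le (show 0 ≤ (1 + δ) * (n : ℝ) by positivity)
      set n' := ⌊(1 + δ) * (n : ℝ)⌋₊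
      have h5 : (1 + δ / 2) * n ≤ n' := by linarith
      have hnn' : n ≤ n' := by
        have : (n : ℝ) ≤ n' := by linarith
        exact_mod_cast this
      have h6 : (m : ℝ) ≤ (1 + δ / 2) ^ i * n' :=
        hmn.trans (by rw [pow_succ, mul_assoc]; gcongr)
      have h7 := (abs_le.1 (hN n ((le_max_left _ _).trans hn) n' hnn' h4)).2
      have h8 : u n' / u n ≤ 2 := by linarith
      rw [div_le_iff₀ (hu n)] at h8
      calc u m ≤ 2 ^ i * u n' := ih n' (hn.le.trans hnn') m h6
        _ ≤ 2 ^ i * (2 * u n) := by gcongr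
        _ = _ := by ring
  set M := max 1 (max N N₁) with hM
  refine ⟨max (2 ^ j) (u (2 * M + 1) / u 0), by positivity, fun n => ?_⟩
  rcases le_total M n with hn | hn
  · have hn1 : 1 ≤ n := (le_max_left _ _).trans hn
    have h3 : ((2 * n + 1 : ℕ) : ℝ) ≤ (1 + δ / 2) ^ j * n := by
      have : (1 : ℝ) ≤ n := by exact_mod_cast hn1
      have h4 : (3 : ℝ) * n ≤ (1 + δ / 2) ^ j * n := by gcongr
      push_cast
      linarith
    exact (key j n ((le_max_right _ _).trans hn) _ h3).trans
      (mul_le_mul_of_nonneg_right (le_max_left _ _) (hu n).le)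
  · calc u (2 * n + 1) ≤ u (2 * M + 1) := hm (by omega)
      _ = u (2 * M + 1) / u 0 * u 0 := by rw [div_mul_cancel₀ _ (hu 0).ne']
      _ ≤ u (2 * M + 1) / u 0 * u n :=
          mul_le_mul_of_nonneg_left (hm (Nat.zero_le n)) (div_nonneg (hu _).le (hu 0).le)
      _ ≤ _ := mul_le_mul_of_nonneg_right (le_max_right _ _) (hu n).le

/-! ### Doubling of the power series and concentration of its mass -/

lemma powerSum_nonneg {v : ℕ → ℝ} (hv : ∀ n, 0 ≤ v n) {x : ℝ} (h0 : 0 ≤ x) : 0 ≤ powerSum v x :=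
  tsum_nonneg fun n => mul_nonneg (hv n) (pow_nonneg h0 n)

/-- If the partial sums have the doubling property, then so has the power series. -/
lemma exists_powerSum_le_mul_sq {v : ℕ → ℝ} (hv : ∀ n, 0 < v n)
    (hs : ∀ x, 0 ≤ x → x < 1 → Summable fun n => v n * x ^ n) (h : RatioNearOne v) :
    ∃ K : ℝ, 0 < K ∧ ∀ y, 0 ≤ y → y < 1 → powerSum v y ≤ K * powerSum v (y ^ 2) := by
  have hu := cumSum_pos hv
  have hm := cumSum_mono fun n => (hv n).le
  obtain ⟨C, hC, hCu⟩ := (h.cumSum hv).exists_doubling hu hm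
  refine ⟨2 * C, by positivity, fun y h0 h1 => ?_⟩
  have hy2 : y ^ 2 < 1 := pow_lt_one₀ h0 h1 two_ne_zero
  obtain ⟨s1, e1⟩ := summable_cumSum h0 h1 (hs y h0 h1)
  obtain ⟨s2, e2⟩ := summable_cumSum (sq_nonneg y) hy2 (hs _ (sq_nonneg y) hy2)
  have se : Summable fun k => cumSum v (2 * k) * y ^ (2 * k) :=
    s1.comp_injective (i := fun k : ℕ => 2 * k) fun a b hab => by simpa using hab
  have so : Summable fun k => cumSum v (2 * k + 1) * y ^ (2 * k + 1) :=
    s1.comp_injective (i := fun k : ℕ => 2 * k + 1) fun a b hab => by simpa using hab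
  -- Splitting into even and odd indices: `u (2k)` and `u (2k+1)` are at most `C * u k`, and `y ^
  -- (2k+1) ≤ y ^ (2k) = (y²) ^ k`.
  have h3 : powerSum (cumSum v) y ≤ 2 * C * powerSum (cumSum v) (y ^ 2) := by
    have hsplit := tsum_even_add_odd (f := fun k => cumSum v k * y ^ k) se so
    have hadd := se.tsum_add so
    rw [powerSum, ← hsplit, ← hadd, powerSum, ← tsum_mul_left]
    have s2' := s2.mul_left (2 * C)
    refine Summable.tsum_le_tsum (fun k => ?_) (se.add so) s2'
    rw [← pow_mul]
    have hp : y ^ (2 * k + 1) ≤ y ^ (2 * k) := by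
      rw [pow_succ]
      exact mul_le_of_le_one_right (pow_nonneg h0 _) h1.le
    have hp0 : 0 ≤ y ^ (2 * k) := pow_nonneg h0 _
    have hp1 : 0 ≤ y ^ (2 * k + 1) := pow_nonneg h0 _
    have hCk := hCu k
    have a0 : cumSum v (2 * k) ≤ C * cumSum v k :=
      (hm (Nat.le_succ (2 * k))).trans (hCu k)
    have a1 : cumSum v (2 * k) * y ^ (2 * k) ≤ C * cumSum v k * y ^ (2 * k) :=
      mul_le_mul_of_nonneg_right a0 hp0
    have a2 : cumSum v (2 * k + 1) * y ^ (2 * k + 1) ≤ C * cumSum v k * y ^ (2 * k) :=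
      mul_le_mul hCk hp hp1 (mul_nonneg hC.le (hu k).le)
    calc _ ≤ C * cumSum v k * y ^ (2 * k) + C * cumSum v k * y ^ (2 * k) := add_le_add a1 a2
      _ = _ := by ring
  have hP : 0 ≤ powerSum (cumSum v) (y ^ 2) := powerSum_nonneg (fun n => (hu n).le) (sq_nonneg y)
  rw [e1, e2]
  -- The passage back from `u` to `v` costs nothing, because `1 - y ≤ 1 - y²`.
  have h4 : (1 - y) * powerSum (cumSum v) y ≤ (1 - y) * (2 * C * powerSum (cumSum v) (y ^ 2)) :=
    mul_le_mul_of_nonneg_left h3 (by linarith)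
  have h5 : (1 - y) * (2 * C * powerSum (cumSum v) (y ^ 2)) ≤
      (1 - y ^ 2) * (2 * C * powerSum (cumSum v) (y ^ 2)) :=
    mul_le_mul_of_nonneg_right (by nlinarith) (by positivity)
  linarith

/-- The point `exp (-1/n)`. -/
noncomputable def expPt (n : ℕ) : ℝ := Real.exp (-(1 / (n : ℝ)))

lemma expPt_pos (n : ℕ) : 0 < expPt n := Real.exp_pos _

lemma expPt_lt_one {n : ℕ} (hn : 1 ≤ n) : expPt n < 1 := by
  have : (0 : ℝ) < n := by exact_mod_cast hn
  rw [expPt, ← Real.exp_zero]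
  refine Real.exp_lt_exp.2 ?_
  simp [this]

lemma expPt_pow (n k : ℕ) : expPt n ^ k = Real.exp (-(k / n)) := by
  rw [expPt, ← Real.exp_nat_mul]; congr 1; ring

lemma tendsto_expPt : Tendsto expPt atTop (𝓝[<] 1) := by
  refine tendsto_nhdsWithin_iff.2 ⟨?_, ?_⟩
  · have h : Tendsto (fun n : ℕ => -(1 / (n : ℝ))) atTop (𝓝 0) := by
      simpa using (tendsto_one_div_atTop_nhds_zero_nat (𝕜 := ℝ)).neg
    have h2 := (Real.continuous_exp.tendsto 0).comp h
    rwa [Real.exp_zero] at h2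
  · filter_upwards [eventually_ge_atTop 1] with n hn using expPt_lt_one hn

lemma powerSum_le_pow_mul {v : ℕ → ℝ} {K : ℝ} (hK : 0 < K)
    (h : ∀ y, 0 ≤ y → y < 1 → powerSum v y ≤ K * powerSum v (y ^ 2)) (j : ℕ) {y : ℝ}
    (h0 : 0 ≤ y) (h1 : y < 1) : powerSum v y ≤ K ^ j * powerSum v (y ^ 2 ^ j) := by
  induction j with
  | zero => simp
  | succ j ih =>
    have := h (y ^ 2 ^ j) (pow_nonneg h0 _) (pow_lt_one₀ h0 h1 (by positivity))
    rw [← pow_mul, ← pow_succ] at this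
    calc powerSum v y ≤ K ^ j * powerSum v (y ^ 2 ^ j) := ih
      _ ≤ K ^ j * (K * powerSum v (y ^ 2 ^ (j + 1))) := by gcongr
      _ = _ := by ring

/-- The bound `exp t ≥ t ^ m / m!` at `t = 2 ^ j` beats `K ^ j` once `2 ^ m > K`. -/
lemma exists_pow_mul_exp_le (K : ℝ) (hK : 0 < K) {η : ℝ} (hη : 0 < η) :
    ∃ j : ℕ, K ^ j * Real.exp (-((2 : ℝ) ^ j - 1)) ≤ η := by
  obtain ⟨m, hm⟩ := pow_unbounded_of_one_lt K (show (1 : ℝ) < 2 by norm_num)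
  have hlim : Tendsto (fun j : ℕ => (K / 2 ^ m) ^ j * (m.factorial * Real.exp 1)) atTop
      (𝓝 (0 * (m.factorial * Real.exp 1))) :=
    (tendsto_pow_atTop_nhds_zero_of_lt_one (by positivity)
      ((div_lt_one (by positivity)).2 hm)).mul_const _
  rw [zero_mul] at hlim
  obtain ⟨j, hj⟩ := (hlim.eventually (gt_mem_nhds hη)).exists
  refine ⟨j, le_trans ?_ hj.le⟩
  have h1 := Real.pow_div_factorial_le_exp ((2 : ℝ) ^ j) (by positivity) m
  rw [div_le_iff₀ (by positivity)] at h1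
  have h2 : Real.exp (-((2 : ℝ) ^ j - 1)) = Real.exp 1 / Real.exp (2 ^ j) := by
    rw [← Real.exp_sub]; congr 1; ring
  rw [h2, div_pow, ← pow_mul, mul_comm m j, pow_mul]
  rw [div_mul_eq_mul_div, mul_div_assoc']
  rw [div_le_div_iff₀ (Real.exp_pos _) (by positivity)]
  have : 0 ≤ K ^ j * Real.exp 1 := by positivity
  nlinarith

/-- The terms with index at most `n` carry all but a fraction `η` of the mass of the power series
at `exp (-A/n)`, for a suitable `A = 2 ^ j`. -/
lemma exists_forall_sub_mul_powerSum_le {v : ℕ → ℝ} {K : ℝ} (hK : 0 < K) (hv : ∀ n, 0 < v n)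
    (hs : ∀ x, 0 ≤ x → x < 1 → Summable fun n => v n * x ^ n)
    (h : ∀ y, 0 ≤ y → y < 1 → powerSum v y ≤ K * powerSum v (y ^ 2)) {η : ℝ} (hη : 0 < η) :
    ∃ j : ℕ, ∀ n ≥ 1, (1 - η) * powerSum v (expPt n ^ 2 ^ j) ≤
      ∑ k ∈ Finset.range (n + 1), v k * (expPt n ^ 2 ^ j) ^ k := by
  obtain ⟨j, hj⟩ := exists_pow_mul_exp_le K hK hη
  refine ⟨j, fun n hn => ?_⟩
  have hn0 : (0 : ℝ) < n := by exact_mod_cast hn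
  set z := expPt n with hz
  have z0 : 0 ≤ z := (expPt_pos n).le
  have z1 : z < 1 := expPt_lt_one hn
  have hz1 : z ^ 2 ^ j < 1 := pow_lt_one₀ z0 z1 (by positivity)
  have s1 := hs _ (pow_nonneg z0 (2 ^ j)) hz1
  have s2 := hs z z0 z1
  have e1 := s1.sum_add_tsum_nat_add (n + 1)
  have e2 := s2.sum_add_tsum_nat_add (n + 1)
  -- Beyond `n`, passing from `z` to `z ^ 2 ^ j` gains the factor `exp (-(2 ^ j - 1))`, while
  -- doubling bounds `D(z)` by only `K ^ j` times `D(z ^ 2 ^ j)`.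
  have hpt : ∀ k : ℕ, v (k + (n + 1)) * (z ^ 2 ^ j) ^ (k + (n + 1)) ≤
      Real.exp (-((2 : ℝ) ^ j - 1)) * (v (k + (n + 1)) * z ^ (k + (n + 1))) := by
    intro k
    have h1 : (z ^ 2 ^ j) ^ (k + (n + 1)) ≤
        Real.exp (-((2 : ℝ) ^ j - 1)) * z ^ (k + (n + 1)) := by
      rw [← pow_mul, hz, expPt_pow, expPt_pow, ← Real.exp_add]
      refine Real.exp_le_exp.2 ?_
      push_cast
      have h2 : (1 : ℝ) ≤ (k + (n + 1)) / n := by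
        rw [le_div_iff₀ hn0]
        have : (0 : ℝ) ≤ k := Nat.cast_nonneg k
        linarith
      have h3 : (1 : ℝ) ≤ 2 ^ j := one_le_pow₀ (by norm_num)
      have h4 := mul_le_mul_of_nonneg_left h2 (sub_nonneg.2 h3)
      have h5 : (2 : ℝ) ^ j * (k + (n + 1)) / n = 2 ^ j * ((k + (n + 1)) / n) := by ring
      rw [h5]
      linarith
    calc _ ≤ v (k + (n + 1)) * (Real.exp (-((2 : ℝ) ^ j - 1)) * z ^ (k + (n + 1))) :=
          mul_le_mul_of_nonneg_left h1 (hv _).le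
      _ = _ := by ring
  have h3 := ((summable_nat_add_iff (n + 1)).2 s1).tsum_le_tsum hpt
    (((summable_nat_add_iff (n + 1)).2 s2).mul_left _)
  rw [tsum_mul_left] at h3
  have h4 : 0 ≤ ∑ k ∈ Finset.range (n + 1), v k * z ^ k :=
    Finset.sum_nonneg fun k _ => mul_nonneg (hv k).le (pow_nonneg z0 k)
  have h5 := powerSum_le_pow_mul hK h j z0 z1
  have hpos := powerSum_nonneg (fun k => (hv k).le) (pow_nonneg z0 (2 ^ j))
  change _ = powerSum v _ at e1
  change _ = powerSum v _ at e2
  have h6 : Real.exp (-((2 : ℝ) ^ j - 1)) * ∑' k, v (k + (n + 1)) * z ^ (k + (n + 1)) ≤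
      η * powerSum v (z ^ 2 ^ j) :=
    calc _ ≤ Real.exp (-((2 : ℝ) ^ j - 1)) * (K ^ j * powerSum v (z ^ 2 ^ j)) :=
          mul_le_mul_of_nonneg_left (by linarith) (Real.exp_pos _).le
      _ = K ^ j * Real.exp (-((2 : ℝ) ^ j - 1)) * powerSum v (z ^ 2 ^ j) := by ring
      _ ≤ _ := mul_le_mul_of_nonneg_right hj hpos
  linarith

lemma sum_mul_pow_le_cumSum {v : ℕ → ℝ} (hv : ∀ n, 0 ≤ v n) {x : ℝ} (h0 : 0 ≤ x) (h1 : x ≤ 1)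
    (n : ℕ) : ∑ k ∈ Finset.range (n + 1), v k * x ^ k ≤ cumSum v n :=
  Finset.sum_le_sum fun k _ => mul_le_of_le_one_right (hv k) (pow_le_one₀ h0 h1)

/-- At least half of the mass at `z ^ 2 ^ j` sits on indices up to `n`, where it is at most `u n`;
doubling carries the bound back to `z = exp (-1/n)`. -/
lemma exists_powerSum_expPt_le {v : ℕ → ℝ} {K : ℝ} (hK : 0 < K) (hv : ∀ n, 0 < v n)
    (hs : ∀ x, 0 ≤ x → x < 1 → Summable fun n => v n * x ^ n)
    (h : ∀ y, 0 ≤ y → y < 1 → powerSum v y ≤ K * powerSum v (y ^ 2)) :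
    ∃ C : ℝ, 0 < C ∧ ∀ n ≥ 1, powerSum v (expPt n) ≤ C * cumSum v n := by
  obtain ⟨j, hj⟩ := exists_forall_sub_mul_powerSum_le hK hv hs h (show (0 : ℝ) < 1 / 2 by norm_num)
  refine ⟨2 * K ^ j, by positivity, fun n hn => ?_⟩
  have z0 := (expPt_pos n).le
  have z1 := expPt_lt_one hn
  have h1 := hj n hn
  have h2 := sum_mul_pow_le_cumSum (fun k => (hv k).le) (pow_nonneg z0 (2 ^ j))
    (pow_le_one₀ z0 z1.le) n
  calc _ ≤ K ^ j * powerSum v (expPt n ^ 2 ^ j) := powerSum_le_pow_mul hK h j z0 z1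
    _ ≤ K ^ j * (2 * cumSum v n) := by
      refine mul_le_mul_of_nonneg_left ?_ (by positivity)
      linarith
    _ = _ := by ring

/-! ### Karamata's method and the theorem behind (ii) -/

/-- The weighted sum `∑ cₖ zᵏ φ(zᵏ)` at `z = exp (-1/n)`. -/
noncomputable def wsum (c : ℕ → ℝ) (φ : ℝ → ℝ) (n : ℕ) : ℝ :=
  ∑' k, c k * expPt n ^ k * φ (expPt n ^ k)

lemma expPt_pow_mem {n : ℕ} (hn : 1 ≤ n) (k : ℕ) : expPt n ^ k ∈ Set.Icc (0 : ℝ) 1 :=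
  ⟨pow_nonneg (expPt_pos n).le k, pow_le_one₀ (expPt_pos n).le (expPt_lt_one hn).le⟩

section
variable {c : ℕ → ℝ} (hs : ∀ x, 0 ≤ x → x < 1 → Summable fun n => c n * x ^ n)
include hs

lemma summable_wsum {φ : ℝ → ℝ} (hφ : ContinuousOn φ (Set.Icc 0 1)) {n : ℕ} (hn : 1 ≤ n) :
    Summable fun k => c k * expPt n ^ k * φ (expPt n ^ k) := by
  obtain ⟨M, hM⟩ := isCompact_Icc.exists_bound_of_continuousOn hφ
  refine Summable.of_norm_bounded
    (((hs _ (expPt_pos n).le (expPt_lt_one hn)).norm).mul_right M) fun k => ?_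
  rw [norm_mul]
  exact mul_le_mul_of_nonneg_left (hM _ (expPt_pow_mem hn k)) (norm_nonneg _)

lemma abs_wsum_sub_le (hc : ∀ n, 0 ≤ c n) {φ ψ : ℝ → ℝ} (hφ : ContinuousOn φ (Set.Icc 0 1))
    (hψ : ContinuousOn ψ (Set.Icc 0 1)) {ε : ℝ} (h : ∀ x ∈ Set.Icc (0 : ℝ) 1, |φ x - ψ x| ≤ ε)
    {n : ℕ} (hn : 1 ≤ n) : |wsum c φ n - wsum c ψ n| ≤ ε * powerSum c (expPt n) := by
  rw [wsum, wsum, ← (summable_wsum hs hφ hn).tsum_sub (summable_wsum hs hψ hn), powerSum,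
    ← tsum_mul_left, ← Real.norm_eq_abs]
  refine tsum_of_norm_bounded
    ((hs _ (expPt_pos n).le (expPt_lt_one hn)).mul_left ε).hasSum fun k => ?_
  rw [← mul_sub, norm_mul, Real.norm_eq_abs, Real.norm_eq_abs,
    abs_of_nonneg (mul_nonneg (hc k) (pow_nonneg (expPt_pos n).le k)), mul_comm]
  exact mul_le_mul_of_nonneg_right (h _ (expPt_pow_mem hn k))
    (mul_nonneg (hc k) (pow_nonneg (expPt_pos n).le k))

/-- In `wsum` the coefficient `c k` has weight `y * φ y` at `y = zᵏ`. Hence a `φ` equal to `1 / y`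
on a range of `y` counts the corresponding `c k` exactly once. -/
lemma cumSum_le_wsum (hc : ∀ n, 0 ≤ c n) {φ : ℝ → ℝ} (hφ : ContinuousOn φ (Set.Icc 0 1))
    (hφ0 : ∀ y, 0 ≤ φ y) {n m : ℕ} (hn : 1 ≤ n)
    (h : ∀ k ≤ m, expPt n ^ k * φ (expPt n ^ k) = 1) : cumSum c m ≤ wsum c φ n := by
  have h1 : cumSum c m = ∑ k ∈ Finset.range (m + 1), c k * expPt n ^ k * φ (expPt n ^ k) := by
    refine Finset.sum_congr rfl fun k hk => ?_
    rw [mul_assoc, h k (by simpa [Nat.lt_succ_iff] using hk), mul_one]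
  rw [h1]
  exact (summable_wsum hs hφ hn).sum_le_tsum _ fun k _ =>
    mul_nonneg (mul_nonneg (hc k) (pow_nonneg (expPt_pos n).le k)) (hφ0 _)

end

lemma wsum_le_cumSum {c : ℕ → ℝ} (hc : ∀ n, 0 ≤ c n) {φ : ℝ → ℝ}
    (hφ1 : ∀ y, 0 ≤ y → y * φ y ≤ 1) {n m : ℕ} (h : ∀ k, m < k → φ (expPt n ^ k) = 0) :
    wsum c φ n ≤ cumSum c m := by
  rw [wsum, tsum_eq_sum (s := Finset.range (m + 1))]
  · refine Finset.sum_le_sum fun k _ => ?_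
    rw [mul_assoc]
    exact mul_le_of_le_one_right (hc k) (hφ1 _ (pow_nonneg (expPt_pos n).le k))
  · intro k hk
    rw [h k (by simpa using hk), mul_zero]

/-- A continuous approximation of the function that is `1 / y` for `y ≥ exp (-1)` and `0` below. -/
noncomputable def cutoff (α γ y : ℝ) : ℝ :=
  (max y (Real.exp (-1)))⁻¹ * max 0 (min 1 ((y - α) / (γ - α)))

lemma continuous_cutoff (α γ : ℝ) : Continuous (cutoff α γ) := by
  unfold cutoff
  refine Continuous.mul (Continuous.inv₀ (by fun_prop) fun y => ?_) (by fun_prop)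
  exact (lt_max_of_lt_right (Real.exp_pos _)).ne'

lemma cutoff_nonneg (α γ y : ℝ) : 0 ≤ cutoff α γ y :=
  mul_nonneg (inv_nonneg.2 (le_max_of_le_right (Real.exp_pos _).le)) (le_max_left _ _)

lemma mul_cutoff_le_one (α γ : ℝ) {y : ℝ} : y * cutoff α γ y ≤ 1 := by
  have hp : 0 < max y (Real.exp (-1)) := lt_max_of_lt_right (Real.exp_pos _)
  have h1 : y * (max y (Real.exp (-1)))⁻¹ ≤ 1 := by
    rw [← div_eq_mul_inv, div_le_one hp]
    exact le_max_left _ _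
  have h2 : max 0 (min 1 ((y - α) / (γ - α))) ≤ 1 := max_le zero_le_one (min_le_left _ _)
  rw [cutoff, ← mul_assoc]
  exact mul_le_one₀ h1 (le_max_left _ _) h2

lemma cutoff_eq_zero {α γ y : ℝ} (h : α < γ) (hy : y ≤ α) : cutoff α γ y = 0 := by
  have h1 : (y - α) / (γ - α) ≤ 0 := div_nonpos_of_nonpos_of_nonneg (by linarith) (by linarith)
  rw [cutoff, max_eq_left ((min_le_right _ _).trans h1), mul_zero]

lemma mul_cutoff_eq_one {α γ y : ℝ} (h : α < γ) (hy : γ ≤ y) (hy' : Real.exp (-1) ≤ y) :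
    y * cutoff α γ y = 1 := by
  have h1 : 1 ≤ (y - α) / (γ - α) := by rw [one_le_div (by linarith)]; linarith
  have h2 : 0 < y := (Real.exp_pos _).trans_le hy'
  rw [cutoff, min_eq_left h1, max_eq_right zero_le_one, max_eq_left hy', mul_one,
    mul_inv_cancel₀ h2.ne']

section
variable {b v : ℕ → ℝ} {c : ℝ} (hv : ∀ n, 0 < v n)
  (hsv : ∀ x, 0 ≤ x → x < 1 → Summable fun n => v n * x ^ n)
  (hsb : ∀ x, 0 ≤ x → x < 1 → Summable fun n => b n * x ^ n)
include hv hsv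

lemma powerSum_pos {x : ℝ} (h0 : 0 ≤ x) (h1 : x < 1) : 0 < powerSum v x := by
  have h := (hsv x h0 h1).sum_le_tsum (Finset.range 1) fun k _ =>
    mul_nonneg (hv k).le (pow_nonneg h0 k)
  simp only [Finset.range_one, Finset.sum_singleton, pow_zero, mul_one] at h
  exact (hv 0).trans_le h

lemma powerSum_mono {x y : ℝ} (h0 : 0 ≤ x) (hxy : x ≤ y) (h1 : y < 1) :
    powerSum v x ≤ powerSum v y :=
  (hsv x h0 (hxy.trans_lt h1)).tsum_le_tsum (fun k => mul_le_mul_of_nonneg_left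
    (pow_le_pow_left₀ h0 hxy k) (hv k).le) (hsv y (h0.trans hxy) h1)

lemma powerSum_sub_isLittleO (h : Tendsto (fun x => powerSum b x / powerSum v x) (𝓝[<] 1) (𝓝 c)) :
    (fun x => powerSum b x - c * powerSum v x) =o[𝓝[<] 1] powerSum v := by
  rw [isLittleO_iff_tendsto']
  · have h1 := h.sub_const c
    rw [sub_self] at h1
    refine h1.congr' ?_
    filter_upwards [eventually_mem_Ico_left one_pos] with x hx
    have := (powerSum_pos hv hsv hx.1 hx.2).ne'
    field_simp
  · filter_upwards [eventually_mem_Ico_left one_pos] with x hx h0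
    exact absurd h0 (powerSum_pos hv hsv hx.1 hx.2).ne'

variable (hr : RatioNearOne v)
include hr

lemma powerSum_expPt_isBigO : (fun n => powerSum v (expPt n)) =O[atTop] cumSum v := by
  obtain ⟨K, hK, hK'⟩ := exists_powerSum_le_mul_sq hv hsv hr
  obtain ⟨C, hC, hC'⟩ := exists_powerSum_expPt_le hK hv hsv hK'
  refine IsBigO.of_bound C ?_
  filter_upwards [eventually_ge_atTop 1] with n hn
  rw [Real.norm_of_nonneg (powerSum_nonneg (fun k => (hv k).le) (expPt_pos n).le),
    Real.norm_of_nonneg (cumSum_pos hv n).le]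
  exact hC' n hn

variable (h : Tendsto (fun x => powerSum b x / powerSum v x) (𝓝[<] 1) (𝓝 c))
include hsb h

/-- A monomial `a * y ^ j` turns `wsum` into `a` times the power series at `z ^ (j+1)`, a point that
still tends to `1` from the left. The error is `o(D(z ^ (j+1)))`, and `D(z ^ (j+1)) ≤ D(z) = O(u
n)`. -/
lemma wsum_sub_isLittleO_polynomial (P : Polynomial ℝ) :
    (fun n => wsum b (fun y => P.eval y) n - c * wsum v (fun y => P.eval y) n)
      =o[atTop] cumSum v := by
  induction P using Polynomial.induction_on' with
  | add P Q hP hQ =>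
    refine (hP.add hQ).congr' ?_ EventuallyEq.rfl
    filter_upwards [eventually_ge_atTop 1] with n hn
    have key : ∀ d : ℕ → ℝ, (∀ x, 0 ≤ x → x < 1 → Summable fun n => d n * x ^ n) →
        wsum d (fun y => (P + Q).eval y) n =
          wsum d (fun y => P.eval y) n + wsum d (fun y => Q.eval y) n := by
      intro d hd
      rw [wsum, wsum, wsum, ← (summable_wsum hd P.continuous.continuousOn hn).tsum_add
        (summable_wsum hd Q.continuous.continuousOn hn)]
      simp only [Polynomial.eval_add, mul_add]
    rw [key b hsb, key v hsv]
    ring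
  | monomial j a =>
    have key : ∀ (d : ℕ → ℝ) (n : ℕ), wsum d (fun y => (Polynomial.monomial j a).eval y) n =
        a * powerSum d (expPt n ^ (j + 1)) := by
      intro d n
      rw [wsum, powerSum, ← tsum_mul_left]
      refine tsum_congr fun k => ?_
      rw [Polynomial.eval_monomial, ← pow_mul, ← pow_mul]
      ring
    have ht : Tendsto (fun n => expPt n ^ (j + 1)) atTop (𝓝[<] 1) := by
      refine tendsto_nhdsWithin_iff.2 ⟨?_, ?_⟩
      · simpa using (tendsto_nhdsWithin_iff.1 tendsto_expPt).1.pow (j + 1)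
      · filter_upwards [eventually_ge_atTop 1] with n hn
        exact pow_lt_one₀ (expPt_pos n).le (expPt_lt_one hn) (by omega)
    have h1 := (powerSum_sub_isLittleO hv hsv h).comp_tendsto ht
    have h2 : (fun n => powerSum v (expPt n ^ (j + 1))) =O[atTop]
        fun n => powerSum v (expPt n) := by
      refine IsBigO.of_bound 1 ?_
      filter_upwards [eventually_ge_atTop 1] with n hn
      have h0 := (expPt_pos n).le
      rw [Real.norm_of_nonneg (powerSum_nonneg (fun k => (hv k).le) (pow_nonneg h0 _)),
        Real.norm_of_nonneg (powerSum_nonneg (fun k => (hv k).le) h0), one_mul]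
      exact powerSum_mono hv hsv (pow_nonneg h0 _)
        (pow_le_of_le_one h0 (expPt_lt_one hn).le (by omega)) (expPt_lt_one hn)
    have h3 := ((h1.trans_isBigO h2).trans_isBigO (powerSum_expPt_isBigO hv hsv hr)).const_mul_left a
    refine h3.congr_left fun n => ?_
    rw [key, key]
    simp only [Function.comp_apply]
    ring

/-- Weierstrass approximation. Nonnegativity of `b` is essential: replacing `φ` by a polynomial
within `η` costs at most `η` times the power series of `b`, which is `O(D(z)) = O(u n)`. -/
lemma wsum_sub_isLittleO (hb : ∀ n, 0 ≤ b n) {φ : ℝ → ℝ} (hφ : ContinuousOn φ (Set.Icc 0 1)) :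
    (fun n => wsum b φ n - c * wsum v φ n) =o[atTop] cumSum v := by
  obtain ⟨C, hC, hDC⟩ := (powerSum_expPt_isBigO hv hsv hr).exists_pos
  have hbv : ∀ᶠ n in atTop, powerSum b (expPt n) ≤ (|c| + 1) * powerSum v (expPt n) := by
    have h1 := (h.comp tendsto_expPt).eventually
      (ge_mem_nhds (show c < |c| + 1 by linarith [le_abs_self c]))
    filter_upwards [h1, eventually_ge_atTop 1] with n h2 hn
    rwa [Function.comp_apply,
      div_le_iff₀ (powerSum_pos hv hsv (expPt_pos n).le (expPt_lt_one hn))] at h2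
  refine isLittleO_iff.2 fun ε hε => ?_
  -- The approximation costs `η (|c| + 1) C u n` for `b` and `η |c| C u n` for `v`, together `(ε/2)
  -- u n`.
  set η := ε / (2 * ((2 * |c| + 1) * C)) with hη
  have hη0 : 0 < η := by positivity
  obtain ⟨P, hP⟩ := exists_polynomial_near_of_continuousOn 0 1 φ hφ η hη0
  have hP' : ∀ x ∈ Set.Icc (0 : ℝ) 1, |φ x - P.eval x| ≤ η := fun x hx => by
    rw [abs_sub_comm]; exact (hP x hx).le
  filter_upwards [isLittleO_iff.1 (wsum_sub_isLittleO_polynomial hv hsv hsb hr h P) (half_pos hε),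
    hbv, hDC.bound, eventually_ge_atTop 1] with n h1 h2 h3 hn
  have e1 := abs_wsum_sub_le hsb hb hφ P.continuous.continuousOn hP' hn
  have e2 := abs_wsum_sub_le hsv (fun k => (hv k).le) hφ P.continuous.continuousOn hP' hn
  have hu := cumSum_pos hv n
  rw [Real.norm_of_nonneg (powerSum_nonneg (fun k => (hv k).le) (expPt_pos n).le),
    Real.norm_of_nonneg hu.le] at h3
  rw [Real.norm_of_nonneg hu.le, Real.norm_eq_abs] at h1 ⊢
  generalize powerSum v (expPt n) = D at *
  generalize powerSum b (expPt n) = B at *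
  generalize cumSum v n = U at *
  have e3 : |wsum b φ n - c * wsum v φ n| ≤ |wsum b φ n - wsum b (fun y => P.eval y) n|
      + |wsum b (fun y => P.eval y) n - c * wsum v (fun y => P.eval y) n|
      + |c| * |wsum v φ n - wsum v (fun y => P.eval y) n| := by
    have : wsum b φ n - c * wsum v φ n = (wsum b φ n - wsum b (fun y => P.eval y) n)
      + (wsum b (fun y => P.eval y) n - c * wsum v (fun y => P.eval y) n)
      + (-(c * (wsum v φ n - wsum v (fun y => P.eval y) n))) := by ring
    rw [this, ← abs_mul, ← abs_neg (c * (wsum v φ n - wsum v (fun y => P.eval y) n))]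
    exact abs_add_three _ _ _
  have e4 : η * B ≤ η * ((|c| + 1) * (C * U)) := by
    refine mul_le_mul_of_nonneg_left (h2.trans ?_) hη0.le
    exact mul_le_mul_of_nonneg_left h3 (by positivity)
  have e5 : |c| * (η * D) ≤ |c| * (η * (C * U)) := by gcongr
  have e6 : |c| * |wsum v φ n - wsum v (fun y => P.eval y) n| ≤ |c| * (η * D) := by gcongr
  have e7 : η * ((|c| + 1) * (C * U)) + |c| * (η * (C * U)) = ε / 2 * U := by
    rw [hη]; field_simp; ring
  linarith

/-- Karamata's Tauberian theorem for nonnegative coefficients, relative to a positive sequence that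
varies slowly at ratio one. -/
theorem tendsto_cumSum_div_of_nonneg (hb : ∀ n, 0 ≤ b n) :
    Tendsto (fun n => cumSum b n / cumSum v n) atTop (𝓝 c) := by
  have hc : 0 ≤ c := by
    refine ge_of_tendsto h ?_
    filter_upwards [eventually_mem_Ico_left one_pos] with x hx
    exact div_nonneg (powerSum_nonneg hb hx.1) (powerSum_pos hv hsv hx.1 hx.2).le
  have hru := hr.cumSum hv
  rw [Metric.tendsto_nhds]
  intro η hη
  obtain ⟨ε, hε, hεη⟩ : ∃ ε > 0, (c + 1) * ε < η :=
    ⟨η / (2 * (c + 1)), by positivity, by field_simp; linarith⟩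
  obtain ⟨δ, hδ, N, hN⟩ := hru ε hε
  -- The cutoff equals `1 / y` for `k ≤ n` and vanishes for `k ≥ (1 + δ) n`, so `wsum b` is at least
  -- the partial sum of `b` at `n`, and `wsum v` is at most that of `v` at `⌊(1 + δ) n⌋`, which is
  -- close to `u n`.
  have upper : ∀ᶠ n in atTop, cumSum b n ≤ (c * (1 + ε) + ε) * cumSum v n := by
    have hlt : Real.exp (-(1 + δ)) < Real.exp (-1) := Real.exp_lt_exp.2 (by linarith)
    have hco := (continuous_cutoff (Real.exp (-(1 + δ))) (Real.exp (-1))).continuousOn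
      (s := Set.Icc 0 1)
    filter_upwards [isLittleO_iff.1 (wsum_sub_isLittleO hv hsv hsb hr h hb hco) hε,
      eventually_ge_atTop N, eventually_ge_atTop 1] with n h1 hn hn1
    have hn0 : (0 : ℝ) < n := by exact_mod_cast hn1
    have e1 : cumSum b n ≤ wsum b (cutoff (Real.exp (-(1 + δ))) (Real.exp (-1))) n := by
      refine cumSum_le_wsum hsb hb hco (fun y => cutoff_nonneg _ _ y) hn1 fun k hk => ?_
      have : Real.exp (-1) ≤ expPt n ^ k := by
        rw [expPt_pow]
        refine Real.exp_le_exp.2 (neg_le_neg ?_)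
        rw [div_le_one hn0]
        exact_mod_cast hk
      exact mul_cutoff_eq_one hlt this this
    have e2 : wsum v (cutoff (Real.exp (-(1 + δ))) (Real.exp (-1))) n ≤
        cumSum v ⌊(1 + δ) * (n : ℝ)⌋₊ := by
      refine wsum_le_cumSum (fun k => (hv k).le) (fun y _ => mul_cutoff_le_one _ _)
        fun k hk => cutoff_eq_zero hlt ?_
      rw [expPt_pow]
      refine Real.exp_le_exp.2 (neg_le_neg ?_)
      rw [le_div_iff₀ hn0]
      exact (Nat.lt_of_floor_lt hk).le
    have e3 := (abs_le.1 (hN n hn ⌊(1 + δ) * (n : ℝ)⌋₊ (Nat.le_floor (by nlinarith))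
      (Nat.floor_le (by positivity)))).2
    have hu := cumSum_pos hv n
    have e4 : cumSum v ⌊(1 + δ) * (n : ℝ)⌋₊ ≤ (1 + ε) * cumSum v n :=
      (div_le_iff₀ hu).1 (by linarith)
    rw [Real.norm_of_nonneg hu.le, Real.norm_eq_abs] at h1
    have e5 := (abs_le.1 h1).2
    have e6 := mul_le_mul_of_nonneg_left (e2.trans e4) hc
    linarith
  -- Now the cutoff vanishes for `k > n` and equals `1 / y` for `k ≤ n / (1 + δ/2)`, which reverses
  -- both comparisons.
  have lower : ∀ᶠ n in atTop, (c - c * ε - ε) * cumSum v n ≤ cumSum b n := by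
    have hlt : Real.exp (-1) < Real.exp (-(1 / (1 + δ / 2))) := by
      refine Real.exp_lt_exp.2 (neg_lt_neg ?_)
      rw [div_lt_one (by positivity)]
      linarith
    have hco := (continuous_cutoff (Real.exp (-1)) (Real.exp (-(1 / (1 + δ / 2))))).continuousOn
      (s := Set.Icc 0 1)
    have hfl : Tendsto (fun n : ℕ => ⌊(n : ℝ) / (1 + δ / 2)⌋₊) atTop atTop :=
      tendsto_nat_floor_atTop.comp
        (tendsto_natCast_atTop_atTop.atTop_div_const (by positivity))
    filter_upwards [isLittleO_iff.1 (wsum_sub_isLittleO hv hsv hsb hr h hb hco) hε,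
      hfl.eventually_ge_atTop N, hfl.eventually_ge_atTop ⌈(1 + δ / 2) / (δ / 2)⌉₊,
      eventually_ge_atTop 1] with n h1 hn hn2 hn1
    have hn0 : (0 : ℝ) < n := by exact_mod_cast hn1
    have hfle := Nat.floor_le (show 0 ≤ (n : ℝ) / (1 + δ / 2) by positivity)
    have hflt := Nat.lt_floor_add_one ((n : ℝ) / (1 + δ / 2))
    set m := ⌊(n : ℝ) / (1 + δ / 2)⌋₊
    have e1 : wsum b (cutoff (Real.exp (-1)) (Real.exp (-(1 / (1 + δ / 2))))) n ≤ cumSum b n := by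
      refine wsum_le_cumSum hb (fun y _ => mul_cutoff_le_one _ _)
        fun k hk => cutoff_eq_zero hlt ?_
      rw [expPt_pow]
      refine Real.exp_le_exp.2 (neg_le_neg ?_)
      rw [one_le_div hn0]
      exact_mod_cast hk.le
    have e2 : cumSum v m ≤ wsum v (cutoff (Real.exp (-1)) (Real.exp (-(1 / (1 + δ / 2))))) n := by
      refine cumSum_le_wsum hsv (fun k => (hv k).le) hco (fun y => cutoff_nonneg _ _ y) hn1
        fun k hk => ?_
      have : Real.exp (-(1 / (1 + δ / 2))) ≤ expPt n ^ k := by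
        rw [expPt_pow]
        refine Real.exp_le_exp.2 (neg_le_neg ?_)
        have hk' : (k : ℝ) ≤ n / (1 + δ / 2) := le_trans (by exact_mod_cast hk) hfle
        rw [div_le_div_iff₀ hn0 (by positivity), one_mul]
        rwa [le_div_iff₀ (by positivity)] at hk'
      exact mul_cutoff_eq_one hlt this (hlt.le.trans this)
    have hmn : m ≤ n := by
      have : (m : ℝ) ≤ n := hfle.trans (div_le_self hn0.le (by linarith))
      exact_mod_cast this
    -- Half of `δ` is kept in reserve for rounding: `n < (1 + δ/2)(m + 1) ≤ (1 + δ) m` once `m` is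
    -- large.
    have hnm : (n : ℝ) ≤ (1 + δ) * m := by
      rw [div_lt_iff₀ (by positivity)] at hflt
      have h2 : (1 + δ / 2) / (δ / 2) ≤ m := (Nat.le_ceil _).trans (by exact_mod_cast hn2)
      rw [div_le_iff₀ (by positivity)] at h2
      nlinarith
    have e3 := (abs_le.1 (hN m hn n hmn hnm)).2
    have hu := cumSum_pos hv n
    have hum := cumSum_pos hv m
    have hmono := cumSum_mono (fun k => (hv k).le) hmn
    have e4 : cumSum v n ≤ (1 + ε) * cumSum v m := (div_le_iff₀ hum).1 (by linarith)
    have e4' : cumSum v n - ε * cumSum v n ≤ cumSum v m := by nlinarith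
    rw [Real.norm_of_nonneg hu.le, Real.norm_eq_abs] at h1
    have e5 := (abs_le.1 h1).1
    have e6 := mul_le_mul_of_nonneg_left (e4'.trans e2) hc
    linarith
  filter_upwards [upper, lower] with n h1 h2
  have hu := cumSum_pos hv n
  rw [Real.dist_eq, abs_lt]
  constructor
  · have := (le_div_iff₀ hu).2 h2
    linarith
  · have := (div_le_iff₀ hu).2 h1
    linarith

end

lemma trunc_one_pos {v : ℕ → ℝ} {N : ℕ} (hN : ∀ n ≥ N, 0 < v n) (n : ℕ) : 0 < trunc N 1 v n := by
  unfold trunc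
  split_ifs with h
  · exact one_pos
  · exact hN n (not_lt.1 h)

/-- Karamata's Tauberian theorem under a one-sided condition. -/
theorem tendsto_cumSum_div {a v : ℕ → ℝ} {l C : ℝ} (hv : ∀ᶠ n in atTop, 0 < v n)
    (hr : RatioNearOne v) (hu : Tendsto (cumSum v) atTop atTop)
    (hsv : ∀ x, 0 ≤ x → x < 1 → Summable fun n => v n * x ^ n)
    (hsa : ∀ x, 0 ≤ x → x < 1 → Summable fun n => a n * x ^ n)
    (ha : ∀ᶠ n in atTop, -(C * v n) ≤ a n)
    (h : Tendsto (fun x => powerSum a x / powerSum v x) (𝓝[<] 1) (𝓝 l)) :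
    Tendsto (fun n => cumSum a n / cumSum v n) atTop (𝓝 l) := by
  obtain ⟨N, hN⟩ := eventually_atTop.1 (hv.and ha)
  have hN1 : ∀ n ≥ N, 0 < v n := fun n hn => (hN n hn).1
  set v' := trunc N 1 v with hv'
  set a' := trunc N 0 a with ha'
  have hvv : v' =ᶠ[atTop] v := trunc_eventuallyEq _ _ _
  have haa : a' =ᶠ[atTop] a := trunc_eventuallyEq _ _ _
  have hp : ∀ n, 0 < v' n := trunc_one_pos hN1
  have hsv' : ∀ x, 0 ≤ x → x < 1 → Summable fun n => v' n * x ^ n :=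
    fun x h0 h1 => summable_congr_eventually hvv (hsv x h0 h1)
  have hsa' : ∀ x, 0 ≤ x → x < 1 → Summable fun n => a' n * x ^ n :=
    fun x h0 h1 => summable_congr_eventually haa (hsa x h0 h1)
  have h' := tendsto_powerSum_div_congr haa hvv hsa hsv (tendsto_powerSum_atTop hv hsv hu) h
  -- With `a' = 0` and `v' = 1` on the initial segment, `a' + |C| v'` is nonnegative at every index.
  -- Adding `|C| v'` only shifts both limits by `|C|`.
  have hb : ∀ n, 0 ≤ a' n + |C| * v' n := by
    intro n
    by_cases hn : n < N
    · simp [ha', hv', trunc, hn]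
    · have hn' : N ≤ n := not_lt.1 hn
      rw [ha', hv', trunc_of_le hn', trunc_of_le hn']
      have h1 := (hN n hn').2
      have h2 := mul_le_mul_of_nonneg_right (le_abs_self C) (hN n hn').1.le
      linarith
  have hsb : ∀ x, 0 ≤ x → x < 1 → Summable fun n => (a' n + |C| * v' n) * x ^ n := by
    intro x h0 h1
    simpa only [add_mul] using (hsa' x h0 h1).add (summable_const_mul |C| (hsv' x h0 h1))
  have hlim : Tendsto (fun x => powerSum (fun n => a' n + |C| * v' n) x / powerSum v' x) (𝓝[<] 1)
      (𝓝 (l + |C|)) := by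
    refine (h'.add_const |C|).congr' ?_
    filter_upwards [eventually_mem_Ico_left one_pos] with x hx
    rw [powerSum_add (hsa' x hx.1 hx.2) (summable_const_mul |C| (hsv' x hx.1 hx.2)),
      powerSum_const_mul, add_div, mul_div_cancel_right₀ _ (powerSum_pos hp hsv' hx.1 hx.2).ne']
  have h1 := tendsto_cumSum_div_of_nonneg hp hsv' hsb (hr.congr hvv) hlim hb
  have h2 : Tendsto (fun n => cumSum a' n / cumSum v' n) atTop (𝓝 l) := by
    have h3 := h1.sub_const |C|
    rw [add_sub_cancel_right] at h3
    refine h3.congr fun n => ?_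
    have h4 : cumSum (fun n => a' n + |C| * v' n) n = cumSum a' n + |C| * cumSum v' n := by
      simp only [cumSum, Finset.sum_add_distrib, Finset.mul_sum]
    rw [h4, add_div, mul_div_cancel_right₀ _ (cumSum_pos hp n).ne', add_sub_cancel_right]
  exact tendsto_cumSum_div_congr haa.symm hvv.symm (tendsto_cumSum_atTop_congr hvv hu) h2

/-! ### Slow decrease in the scale `log u` and Vijayaraghavan's boundedness -/

lemma continuousOn_powerSum {c : ℕ → ℝ} (hs : ∀ x, 0 ≤ x → x < 1 → Summable fun n => c n * x ^ n)
    {b : ℝ} (hb : b < 1) : ContinuousOn (powerSum c) (Set.Icc 0 b) := by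
  rcases lt_or_ge b 0 with h | h
  · simp [Set.Icc_eq_empty_of_lt h]
  unfold powerSum
  refine continuousOn_tsum (fun n => by fun_prop) (hs b h hb).norm fun n x hx => ?_
  rw [norm_mul, norm_mul, norm_pow, norm_pow, Real.norm_of_nonneg hx.1, Real.norm_of_nonneg h]
  exact mul_le_mul_of_nonneg_left (pow_le_pow_left₀ hx.1 hx.2 n) (norm_nonneg _)

lemma exists_forall_neg_mul_le {f g : ℕ → ℝ} (hg : ∀ n, 0 < g n) {C : ℝ}
    (h : ∀ᶠ n in atTop, -(C * g n) ≤ f n) : ∃ C' : ℝ, 0 ≤ C' ∧ ∀ n, -(C' * g n) ≤ f n := by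
  obtain ⟨N, hN⟩ := eventually_atTop.1 h
  have hnn : 0 ≤ ∑ k ∈ Finset.range N, |f k| / g k :=
    Finset.sum_nonneg fun k _ => div_nonneg (abs_nonneg _) (hg k).le
  refine ⟨|C| + ∑ k ∈ Finset.range N, |f k| / g k, by positivity, fun n => ?_⟩
  rcases le_or_gt N n with hn | hn
  · have h1 := hN n hn
    have h2 : C * g n ≤ (|C| + ∑ k ∈ Finset.range N, |f k| / g k) * g n :=
      mul_le_mul_of_nonneg_right (by linarith [le_abs_self C]) (hg n).le
    linarith
  · have h1 : |f n| / g n ≤ ∑ k ∈ Finset.range N, |f k| / g k :=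
      Finset.single_le_sum (f := fun k => |f k| / g k)
        (fun k _ => div_nonneg (abs_nonneg _) (hg k).le) (Finset.mem_range.2 hn)
    have h2 : |f n| ≤ (|C| + ∑ k ∈ Finset.range N, |f k| / g k) * g n := by
      rw [← div_le_iff₀ (hg n)]
      linarith [abs_nonneg C]
    linarith [neg_abs_le (f n)]

/-- The discrete form of `∫ du / √u = 2 √u`: each term is at most `2 (√u (k+1) - √u k)`, and the sum
telescopes. -/
lemma sum_div_sqrt_cumSum_le {v : ℕ → ℝ} (hv : ∀ n, 0 < v n) (n : ℕ) :
    ∑ k ∈ Finset.range (n + 1), v k / √(cumSum v k) ≤ 2 * √(cumSum v n) := by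
  induction n with
  | zero =>
    simp only [zero_add, Finset.range_one, Finset.sum_singleton, cumSum_zero, Real.div_sqrt]
    linarith [Real.sqrt_nonneg (v 0)]
  | succ n ih =>
    rw [Finset.sum_range_succ]
    have h1 := cumSum_pos hv n
    have h2 := cumSum_pos hv (n + 1)
    have h3 : v (n + 1) / √(cumSum v (n + 1)) ≤ 2 * (√(cumSum v (n + 1)) - √(cumSum v n)) := by
      rw [div_le_iff₀ (Real.sqrt_pos.2 h2)]
      have e1 := Real.mul_self_sqrt h1.le
      have e2 := Real.mul_self_sqrt h2.le
      have e3 := cumSum_succ v n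
      nlinarith [sq_nonneg (√(cumSum v (n + 1)) - √(cumSum v n))]
    linarith

lemma log_le_two_mul_sqrt {y : ℝ} (hy : 0 < y) : Real.log y ≤ 2 * √y := by
  have h1 := Real.log_le_sub_one_of_pos (Real.sqrt_pos.2 hy)
  rw [Real.log_sqrt hy.le] at h1
  linarith

/-- For `k ≤ n` the weight `exp (-k/n)` is at least `exp (-1)`. -/
lemma cumSum_le_exp_one_mul_powerSum {v : ℕ → ℝ} (hv : ∀ n, 0 < v n)
    (hsv : ∀ x, 0 ≤ x → x < 1 → Summable fun n => v n * x ^ n) {n : ℕ} (hn : 1 ≤ n) :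
    cumSum v n ≤ Real.exp 1 * powerSum v (expPt n) := by
  have hn0 : (0 : ℝ) < n := by exact_mod_cast hn
  have z0 := (expPt_pos n).le
  have h1 : Real.exp (-1) * cumSum v n ≤ powerSum v (expPt n) := by
    refine le_trans ?_ ((hsv _ z0 (expPt_lt_one hn)).sum_le_tsum (Finset.range (n + 1))
      fun k _ => mul_nonneg (hv k).le (pow_nonneg z0 k))
    rw [cumSum, Finset.mul_sum]
    refine Finset.sum_le_sum fun k hk => ?_
    rw [mul_comm]
    refine mul_le_mul_of_nonneg_left ?_ (hv k).le
    rw [expPt_pow]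
    refine Real.exp_le_exp.2 (neg_le_neg ?_)
    rw [div_le_one hn0]
    exact_mod_cast (by simpa [Nat.lt_succ_iff] using hk : k ≤ n)
  have h2 := mul_le_mul_of_nonneg_left h1 (Real.exp_pos 1).le
  rwa [← mul_assoc, ← Real.exp_add, add_neg_cancel, Real.exp_zero, one_mul] at h2

section
variable {v r : ℕ → ℝ} {C : ℝ} (hv : ∀ n, 0 < v n)
include hv

lemma log_cumSum_mono : Monotone fun n => Real.log (cumSum v n) := fun _ _ h =>
  Real.log_le_log (cumSum_pos hv _) (cumSum_mono (fun k => (hv k).le) h)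

lemma log_sub_log_le_div (n m : ℕ) :
    Real.log (cumSum v m) - Real.log (cumSum v n) ≤ cumSum v m / cumSum v n := by
  rw [← Real.log_div (cumSum_pos hv m).ne' (cumSum_pos hv n).ne']
  have := Real.log_le_sub_one_of_pos (div_pos (cumSum_pos hv m) (cumSum_pos hv n))
  linarith

/-- From `1 - 1/t ≤ log t`, the ratio `v (m+1) / u (m+1)` is at most the increment of `log u`, so
the stepwise condition telescopes. -/
lemma sub_mul_log_le (hC : 0 ≤ C)
    (hstep : ∀ n, -(C * (v (n + 1) / cumSum v (n + 1))) ≤ r (n + 1) - r n) {n m : ℕ} (h : n ≤ m) :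
    r n - C * (Real.log (cumSum v m) - Real.log (cumSum v n)) ≤ r m := by
  induction m, h using Nat.le_induction with
  | base => simp
  | succ m _ ih =>
    have h1 := cumSum_pos hv m
    have h2 := cumSum_pos hv (m + 1)
    have h3 : v (m + 1) / cumSum v (m + 1) ≤
        Real.log (cumSum v (m + 1)) - Real.log (cumSum v m) := by
      rw [← Real.log_div h2.ne' h1.ne']
      refine le_trans (le_of_eq ?_) (Real.one_sub_inv_le_log_of_pos (div_pos h2 h1))
      rw [inv_div, cumSum_succ]
      rw [cumSum_succ] at h2
      field_simp
      ring
    have h4 := mul_le_mul_of_nonneg_left h3 hC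
    linarith [hstep m]

variable (hsv : ∀ x, 0 ≤ x → x < 1 → Summable fun n => v n * x ^ n)
include hsv

/-- Since `yʲ ≥ yᵏ` for `j ≤ k`, one has `u k * yᵏ ≤ D(y)`; the other factor `yᵏ` is left to sum `v
k`. With doubling, this controls tails in which the error grows like `u k / u n`. -/
lemma tsum_cumSum_mul_le {y : ℝ} (h0 : 0 ≤ y) (h1 : y < 1) :
    (Summable fun k => cumSum v k * v k * (y ^ 2) ^ k) ∧
      ∑' k, cumSum v k * v k * (y ^ 2) ^ k ≤ powerSum v y ^ 2 := by
  have hs := hsv y h0 h1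
  have hu := cumSum_pos hv
  have hpt : ∀ k, cumSum v k * v k * (y ^ 2) ^ k ≤ powerSum v y * (v k * y ^ k) := by
    intro k
    have h2 : cumSum v k * y ^ k ≤ powerSum v y := by
      refine le_trans ?_ (hs.sum_le_tsum (Finset.range (k + 1)) fun j _ =>
        mul_nonneg (hv j).le (pow_nonneg h0 j))
      rw [cumSum, Finset.sum_mul]
      refine Finset.sum_le_sum fun j hj => mul_le_mul_of_nonneg_left ?_ (hv j).le
      exact pow_le_pow_of_le_one h0 h1.le (by simpa [Nat.lt_succ_iff] using hj)
    calc cumSum v k * v k * (y ^ 2) ^ k = (cumSum v k * y ^ k) * (v k * y ^ k) := by ring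
      _ ≤ _ := mul_le_mul_of_nonneg_right h2 (mul_nonneg (hv k).le (pow_nonneg h0 k))
  have hs2 : Summable fun k => powerSum v y * (v k * y ^ k) := hs.mul_left _
  have hs1 : Summable fun k => cumSum v k * v k * (y ^ 2) ^ k :=
    Summable.of_nonneg_of_le (fun k => mul_nonneg (mul_nonneg (hu k).le (hv k).le)
      (pow_nonneg (sq_nonneg y) k)) hpt hs2
  refine ⟨hs1, (hs1.tsum_le_tsum hpt hs2).trans (le_of_eq ?_)⟩
  rw [tsum_mul_left, sq]
  rfl

variable {K : ℝ} (hdb : ∀ y, 0 ≤ y → y < 1 → powerSum v y ≤ K * powerSum v (y ^ 2))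
include hdb

lemma tsum_cumSum_mul_le_sq {x : ℝ} (h0 : 0 ≤ x) (h1 : x < 1) :
    (Summable fun k => cumSum v k * v k * x ^ k) ∧
      ∑' k, cumSum v k * v k * x ^ k ≤ (K * powerSum v x) ^ 2 := by
  have hy0 := Real.sqrt_nonneg x
  have hy1 : √x < 1 := by rw [Real.sqrt_lt' one_pos]; simpa using h1
  obtain ⟨a1, a2⟩ := tsum_cumSum_mul_le hv hsv hy0 hy1
  rw [Real.sq_sqrt h0] at a1 a2
  refine ⟨a1, a2.trans ?_⟩
  have h3 := hdb _ hy0 hy1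
  rw [Real.sq_sqrt h0] at h3
  exact pow_le_pow_left₀ (powerSum_nonneg (fun n => (hv n).le) hy0) h3 2

variable (hK : 0 < K) (hu : Tendsto (cumSum v) atTop atTop)
  (hC : 0 ≤ C) (hstep : ∀ n, -(C * (v (n + 1) / cumSum v (n + 1))) ≤ r (n + 1) - r n)
  (hsr : ∀ x, 0 ≤ x → x < 1 → Summable fun n => r n * v n * x ^ n)
  {M x₀ : ℝ} (hM : 0 ≤ M) (hx₀ : 0 ≤ x₀) (hx₀1 : x₀ < 1)
  (hbd : ∀ x, x₀ ≤ x → x < 1 → |powerSum (fun n => r n * v n) x| ≤ M * powerSum v x)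
include hK hu hC hstep hsr hM hx₀ hx₀1 hbd

/-- Terms that dominate all earlier negative terms are bounded. -/
lemma exists_forall_le_of_dominant :
    ∃ K₁ : ℝ, 0 ≤ K₁ ∧ ∀ n, 0 ≤ r n → (∀ k ≤ n, -r k ≤ r n) → r n ≤ K₁ := by
  obtain ⟨N, hN⟩ := eventually_atTop.1 (hu.eventually_ge_atTop (powerSum v x₀))
  have hnn : 0 ≤ ∑ k ∈ Finset.range N, |r k| := Finset.sum_nonneg fun k _ => abs_nonneg _
  refine ⟨∑ k ∈ Finset.range N, |r k| + (2 * M + 8 * C * K ^ 2), by positivity,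
    fun n hn0 hdom => ?_⟩
  rcases lt_or_ge n N with hn | hn
  · have h1 := Finset.single_le_sum (f := fun k => |r k|) (fun k _ => abs_nonneg _)
      (Finset.mem_range.2 hn)
    have h2 : 0 ≤ 2 * M + 8 * C * K ^ 2 := by positivity
    linarith [le_abs_self (r n)]
  have hun := cumSum_pos hv n
  -- The head up to `n` can lower the sum by at most `2 r n u n`, so a total mass of `4 u n` leaves
  -- `2 r n u n` to be compared with `N(x)`.
  obtain ⟨x, hxx, hx1, hDx⟩ : ∃ x, x₀ ≤ x ∧ x < 1 ∧ powerSum v x = 4 * cumSum v n := by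
    have ht := tendsto_powerSum_atTop (Eventually.of_forall hv) hsv hu
    obtain ⟨b, hb, hb0, hb1⟩ := ((ht.eventually_ge_atTop (4 * cumSum v n)).and
      (Ioo_mem_nhdsLT hx₀1)).exists
    obtain ⟨x, hx, hxe⟩ := intermediate_value_Icc hb0.le
      ((continuousOn_powerSum hsv hb1).mono (Set.Icc_subset_Icc_left hx₀))
      (show 4 * cumSum v n ∈ Set.Icc (powerSum v x₀) (powerSum v b) from
        ⟨by linarith [hN n hn], hb⟩)
    exact ⟨x, hx.1, hx.2.trans_lt hb1, hxe⟩
  have hx0 : 0 ≤ x := hx₀.trans hxx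
  obtain ⟨sQ, hQ⟩ := tsum_cumSum_mul_le_sq hv hsv hdb hx0 hx1
  have s1 := hsr x hx0 hx1
  have s2 := (hsv x hx0 hx1).mul_left (r n)
  have s3 := sQ.mul_left (C / cumSum v n)
  -- For `k ≤ n` dominance gives `r k - r n ≥ -2 r n`. For `k > n` slow decrease gives `r k - r n ≥
  -- -C u k / u n`, so the terms with the correction are nonnegative and can be dropped.
  have hge : ∑ k ∈ Finset.range (n + 1), -(2 * r n * v k) ≤
      ∑' k, (r k * v k * x ^ k - r n * (v k * x ^ k)
        + C / cumSum v n * (cumSum v k * v k * x ^ k)) := by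
    refine le_trans (Finset.sum_le_sum fun k hk => ?_)
      (((s1.sub s2).add s3).sum_le_tsum (Finset.range (n + 1)) fun k hk => ?_)
    · have hk' : k ≤ n := by simpa [Nat.lt_succ_iff] using hk
      have h1 := hdom k hk'
      have h2 : 0 ≤ v k * x ^ k := mul_nonneg (hv k).le (pow_nonneg hx0 k)
      have h3 : 0 ≤ C / cumSum v n * (cumSum v k * v k * x ^ k) := by
        have := (cumSum_pos hv k).le
        rw [mul_assoc (cumSum v k)]
        positivity
      have h4 : v k * x ^ k ≤ v k :=
        mul_le_of_le_one_right (hv k).le (pow_le_one₀ hx0 hx1.le)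
      nlinarith [mul_le_mul_of_nonneg_left h4 hn0]
    · have hk' : n ≤ k := by
        have : n + 1 ≤ k := by simpa using hk
        omega
      have h1 := sub_mul_log_le hv hC hstep hk'
      have h2 := mul_le_mul_of_nonneg_left (log_sub_log_le_div hv n k) hC
      have h3 : 0 ≤ v k * x ^ k := mul_nonneg (hv k).le (pow_nonneg hx0 k)
      have h4 : r k * v k * x ^ k - r n * (v k * x ^ k)
          + C / cumSum v n * (cumSum v k * v k * x ^ k) =
          (r k - r n + C * (cumSum v k / cumSum v n)) * (v k * x ^ k) := by ring
      rw [h4]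
      exact mul_nonneg (by linarith) h3
  rw [(s1.sub s2).tsum_add s3, s1.tsum_sub s2, tsum_mul_left, tsum_mul_left] at hge
  have e1 : ∑ k ∈ Finset.range (n + 1), -(2 * r n * v k) = -(2 * r n * cumSum v n) := by
    rw [Finset.sum_neg_distrib, ← Finset.mul_sum]; rfl
  rw [e1] at hge
  change -(2 * r n * cumSum v n) ≤ powerSum (fun k => r k * v k) x - r n * powerSum v x + _ at hge
  have e2 : C / cumSum v n * ∑' k, cumSum v k * v k * x ^ k ≤
      C / cumSum v n * (K * powerSum v x) ^ 2 :=
    mul_le_mul_of_nonneg_left hQ (by positivity)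
  have e3 : C / cumSum v n * (K * powerSum v x) ^ 2 = 16 * C * K ^ 2 * cumSum v n := by
    rw [hDx]; field_simp; ring
  have e4 := (abs_le.1 (hbd x hxx hx1)).2
  rw [hDx] at hge e4
  have e5 : r n * cumSum v n ≤ (2 * M + 8 * C * K ^ 2) * cumSum v n := by
    rw [hDx] at e2 e3; linarith
  have := le_of_mul_le_mul_right e5 hun
  linarith

/-- Vijayaraghavan's boundedness theorem: slow decrease and boundedness of the power series means
give boundedness from below. -/
lemma exists_forall_neg_le : ∃ B : ℝ, ∀ n, -B ≤ r n := by
  obtain ⟨K₁, hK₁, hdom⟩ :=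
    exists_forall_le_of_dominant hv hsv hdb hK hu hC hstep hsr hM hx₀ hx₀1 hbd
  -- A head with more than half of the mass is needed: with the share `3/4`, the coefficient of `-r
  -- n` below is `2 * (3/4) - 1 = 1/2`.
  obtain ⟨j, hj⟩ := exists_forall_sub_mul_powerSum_le hK hv hsv hdb
    (show (0 : ℝ) < 1 / 4 by norm_num)
  have hx : Tendsto (fun n => expPt n ^ 2 ^ j) atTop (𝓝 1) := by
    simpa using (tendsto_nhdsWithin_iff.1 tendsto_expPt).1.pow (2 ^ j)
  obtain ⟨N, hN⟩ := eventually_atTop.1 ((hx.eventually (lt_mem_nhds hx₀1)).and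
    (eventually_ge_atTop 1))
  -- At a very negative running minimum `r n`, the head pulls `N(x)` down by about `-r n` times its
  -- mass, and the tail cannot compensate; this contradicts `|N| ≤ M D` unless `-r n` is bounded.
  have claim : ∀ n ≥ N, K₁ < -r n → (∀ k ≤ n, r n ≤ r k) →
      -r n ≤ 2 * (M + 2 * C * K ^ 2 + 4 * C * (Real.exp 1 * K ^ j)) := by
    intro n hn hR hmin
    obtain ⟨hxx, hn1⟩ := hN n hn
    have hun := cumSum_pos hv n
    have z0 := (expPt_pos n).le
    have z1 := expPt_lt_one hn1
    have hjn := hj n hn1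
    have hDz := powerSum_le_pow_mul hK hdb j z0 z1
    set x := expPt n ^ 2 ^ j
    have hx0 : 0 ≤ x := pow_nonneg z0 _
    have hx1 : x < 1 := pow_lt_one₀ z0 z1 (by positivity)
    have hD := powerSum_pos hv hsv hx0 hx1
    have hDu : powerSum v x ≤ 2 * cumSum v n := by
      have := sum_mul_pow_le_cumSum (fun k => (hv k).le) hx0 hx1.le n
      linarith
    have huD : cumSum v n ≤ Real.exp 1 * K ^ j * powerSum v x := by
      refine (cumSum_le_exp_one_mul_powerSum hv hsv hn1).trans ?_
      rw [mul_assoc]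
      exact mul_le_mul_of_nonneg_left hDz (Real.exp_pos 1).le
    obtain ⟨sQ, hQ⟩ := tsum_cumSum_mul_le_sq hv hsv hdb hx0 hx1
    have s1 := hsr x hx0 hx1
    have s2 := (hsv x hx0 hx1).mul_left (-r n)
    have s3 := sQ.mul_left (C / cumSum v n)
    -- Slow decrease from `k` to `n` keeps `r k` near `r n`. The logarithm is weakened to a square
    -- root so that the sum over the head is explicit.
    have hlow : ∀ k ≤ n, r k ≤ r n + C * (2 * √(cumSum v n / cumSum v k)) := by
      intro k hk
      have h1 := sub_mul_log_le hv hC hstep hk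
      have huk := cumSum_pos hv k
      have h2 := log_le_two_mul_sqrt (div_pos hun huk)
      rw [Real.log_div hun.ne' huk.ne'] at h2
      have h3 := mul_le_mul_of_nonneg_left h2 hC
      linarith
    -- If `r k > K₁`, then `r k` is not dominant, so `r k < -r i` for some `i ≤ k`. Either `i ≤ n`
    -- and minimality bounds `-r i` by `-r n`, or `i > n` and slow decrease from `n` to `i` does so
    -- up to a logarithm.
    have hhigh : ∀ k, n < k → r k ≤ -r n + C * (cumSum v k / cumSum v n) := by
      intro k hk
      have h1 := mul_le_mul_of_nonneg_left (log_sub_log_le_div hv n k) hC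
      have h2 : 0 ≤ C * (Real.log (cumSum v k) - Real.log (cumSum v n)) :=
        mul_nonneg hC (sub_nonneg.2 (log_cumSum_mono hv hk.le))
      by_cases hc : r k ≤ K₁
      · linarith
      · push Not at hc
        obtain ⟨i, hi, hri⟩ : ∃ i ≤ k, r k < -r i := by
          by_contra! hcon
          exact absurd (hdom k (by linarith) hcon) (not_le.2 hc)
        rcases le_or_gt i n with hin | hin
        · linarith [hmin i hin]
        · have h3 := sub_mul_log_le hv hC hstep hin.le
          have h4 := mul_le_mul_of_nonneg_left (sub_le_sub_right (log_cumSum_mono hv hi)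
            (Real.log (cumSum v n))) hC
          linarith
    have hge : ∑ k ∈ Finset.range (n + 1), (2 * (-r n) * (v k * x ^ k)
        - 2 * C * √(cumSum v n) * (v k / √(cumSum v k))) ≤
        ∑' k, (-r n * (v k * x ^ k) + C / cumSum v n * (cumSum v k * v k * x ^ k)
          - r k * v k * x ^ k) := by
      refine le_trans (Finset.sum_le_sum fun k hk => ?_)
        (((s2.add s3).sub s1).sum_le_tsum (Finset.range (n + 1)) fun k hk => ?_)
      · have hk' : k ≤ n := by simpa [Nat.lt_succ_iff] using hk
        have huk := cumSum_pos hv k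
        have h1 := hlow k hk'
        rw [Real.sqrt_div hun.le] at h1
        have h2 : 0 ≤ v k * x ^ k := mul_nonneg (hv k).le (pow_nonneg hx0 k)
        have h3 : 0 ≤ C / cumSum v n * (cumSum v k * v k * x ^ k) := by
          rw [mul_assoc (cumSum v k)]
          positivity
        have h4 : v k * x ^ k ≤ v k :=
          mul_le_of_le_one_right (hv k).le (pow_le_one₀ hx0 hx1.le)
        have h5 := mul_le_mul_of_nonneg_right h1 h2
        have h6 : 2 * C * √(cumSum v n) / √(cumSum v k) * (v k * x ^ k) ≤
            2 * C * √(cumSum v n) / √(cumSum v k) * v k :=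
          mul_le_mul_of_nonneg_left h4 (by positivity)
        have h7 : 2 * C * √(cumSum v n) / √(cumSum v k) * v k =
            2 * C * √(cumSum v n) * (v k / √(cumSum v k)) := by ring
        have h8 : (r n + C * (2 * (√(cumSum v n) / √(cumSum v k)))) * (v k * x ^ k) =
            r n * (v k * x ^ k) + 2 * C * √(cumSum v n) / √(cumSum v k) * (v k * x ^ k) := by ring
        rw [h8] at h5
        have h9 : r k * v k * x ^ k = r k * (v k * x ^ k) := by ring
        rw [h9]
        linarith
      · have hk' : n < k := by
          have : n + 1 ≤ k := by simpa using hk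
          omega
        have h3 : 0 ≤ v k * x ^ k := mul_nonneg (hv k).le (pow_nonneg hx0 k)
        have h4 : -r n * (v k * x ^ k) + C / cumSum v n * (cumSum v k * v k * x ^ k)
            - r k * v k * x ^ k =
            (-r n + C * (cumSum v k / cumSum v n) - r k) * (v k * x ^ k) := by ring
        rw [h4]
        exact mul_nonneg (sub_nonneg.2 (hhigh k hk')) h3
    rw [(s2.add s3).tsum_sub s1, s2.tsum_add s3, tsum_mul_left, tsum_mul_left,
      Finset.sum_sub_distrib, ← Finset.mul_sum, ← Finset.mul_sum] at hge
    change _ ≤ -r n * powerSum v x + _ - powerSum (fun k => r k * v k) x at hge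
    have e1 := sum_div_sqrt_cumSum_le hv n
    have e2 : 2 * C * √(cumSum v n) * ∑ k ∈ Finset.range (n + 1), v k / √(cumSum v k) ≤
        4 * C * cumSum v n := by
      calc _ ≤ 2 * C * √(cumSum v n) * (2 * √(cumSum v n)) :=
            mul_le_mul_of_nonneg_left e1 (by positivity)
        _ = 4 * C * (√(cumSum v n) * √(cumSum v n)) := by ring
        _ = _ := by rw [Real.mul_self_sqrt hun.le]
    have e3 : C / cumSum v n * ∑' k, cumSum v k * v k * x ^ k ≤ 2 * C * K ^ 2 * powerSum v x := by
      calc _ ≤ C / cumSum v n * (K * powerSum v x) ^ 2 :=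
            mul_le_mul_of_nonneg_left hQ (by positivity)
        _ = C * K ^ 2 * powerSum v x / cumSum v n * powerSum v x := by ring
        _ ≤ C * K ^ 2 * powerSum v x / cumSum v n * (2 * cumSum v n) :=
            mul_le_mul_of_nonneg_left hDu (by positivity)
        _ = _ := by field_simp
    have e4 := (abs_le.1 (hbd x hxx.le hx1)).1
    have e5 := mul_le_mul_of_nonneg_left huD (show 0 ≤ 4 * C by positivity)
    have e6 := mul_le_mul_of_nonneg_left hjn (show 0 ≤ 2 * (-r n) by linarith)
    have e7 : -r n * powerSum v x ≤
        2 * (M + 2 * C * K ^ 2 + 4 * C * (Real.exp 1 * K ^ j)) * powerSum v x := by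
      linarith
    exact le_of_mul_le_mul_right e7 hD
  set B := 2 * (M + 2 * C * K ^ 2 + 4 * C * (Real.exp 1 * K ^ j)) with hB
  -- The second entry forces the index of a minimum below `-B` to be at least `N`, and `-r n` there
  -- to exceed `K₁`, as the claim requires.
  refine ⟨max B (K₁ + ∑ k ∈ Finset.range N, |r k|), fun m => ?_⟩
  by_contra! hm
  obtain ⟨n, hnm, hmin⟩ := Finset.exists_min_image (Finset.range (m + 1)) r ⟨0, by simp⟩
  have h1 : r n ≤ r m := hmin m (by simp)
  have h2 := le_max_left B (K₁ + ∑ k ∈ Finset.range N, |r k|)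
  have h3 := le_max_right B (K₁ + ∑ k ∈ Finset.range N, |r k|)
  have hnn : 0 ≤ ∑ k ∈ Finset.range N, |r k| := Finset.sum_nonneg fun k _ => abs_nonneg _
  have hn : N ≤ n := by
    by_contra! hlt
    have h4 := Finset.single_le_sum (f := fun k => |r k|) (fun k _ => abs_nonneg _)
      (Finset.mem_range.2 hlt)
    linarith [neg_abs_le (r n)]
  have h4 := claim n hn (by linarith) fun k hk => hmin k (by simp at hnm ⊢; omega)
  linarith

end

/-! ### From weighted means to the sequence -/

section
variable {v r : ℕ → ℝ} {C l : ℝ} (hv : ∀ n, 0 < v n) (hu : Tendsto (cumSum v) atTop atTop)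
  (hr : RatioNearOne (cumSum v))
include hv hu hr

omit hu in
lemma eventually_cumSum_succ_le {δ : ℝ} (hδ : 0 < δ) :
    ∀ᶠ n in atTop, cumSum v (n + 1) ≤ (1 + δ) * cumSum v n := by
  obtain ⟨η, hη, N, hN⟩ := hr δ hδ
  filter_upwards [eventually_ge_atTop N, eventually_ge_atTop ⌈1 / η⌉₊] with n hn hn2
  have h1 : 1 / η ≤ n := (Nat.le_ceil _).trans (by exact_mod_cast hn2)
  rw [div_le_iff₀ hη] at h1
  have h2 := (abs_le.1 (hN n hn (n + 1) (Nat.le_succ n) (by push_cast; linarith))).2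
  exact (div_le_iff₀ (cumSum_pos hv n)).1 (by linarith)

/-- The first `m` at which `u m` reaches `(1 + δ) u n` overshoots by at most one more factor `1 +
δ`, since consecutive ratios of `u` are eventually at most `1 + δ`. -/
lemma eventually_exists_gt {δ : ℝ} (hδ : 0 < δ) : ∀ᶠ n in atTop, ∃ m, n ≤ m ∧
    (1 + δ) * cumSum v n ≤ cumSum v m ∧ cumSum v m ≤ (1 + δ) ^ 2 * cumSum v n := by
  obtain ⟨N, hN⟩ := eventually_atTop.1 (eventually_cumSum_succ_le hv hr hδ)
  filter_upwards [eventually_ge_atTop N] with n hn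
  have hun := cumSum_pos hv n
  have hex : ∃ m, (1 + δ) * cumSum v n ≤ cumSum v m := (hu.eventually_ge_atTop _).exists
  classical
  have hm := Nat.find_spec hex
  have hmin := fun k => Nat.find_min (m := k) hex
  set m := Nat.find hex
  have hnm : n < m := by
    by_contra! hle
    have := cumSum_mono (fun k => (hv k).le) hle
    nlinarith
  obtain ⟨m', hm'⟩ : ∃ m', m = m' + 1 := ⟨m - 1, by omega⟩
  have h1 := hmin m' (by omega)
  push Not at h1
  have h2 := hN m' (by omega)
  rw [← hm'] at h2
  refine ⟨m, hnm.le, hm, ?_⟩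
  nlinarith

lemma eventually_exists_lt {δ : ℝ} (hδ : 0 < δ) (N₀ : ℕ) : ∀ᶠ n in atTop, ∃ m, N₀ ≤ m ∧ m ≤ n ∧
    (1 + δ) * cumSum v m ≤ cumSum v n ∧ cumSum v n ≤ (1 + δ) ^ 2 * cumSum v m := by
  obtain ⟨N, hN⟩ := eventually_atTop.1 (eventually_cumSum_succ_le hv hr hδ)
  filter_upwards [hu.eventually_ge_atTop ((1 + δ) * cumSum v (max N N₀)),
    eventually_ge_atTop (max N N₀)] with n hn hnN
  classical
  have hm := Nat.findGreatest_spec (P := fun m => (1 + δ) * cumSum v m ≤ cumSum v n) hnN hn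
  have hle := Nat.le_findGreatest (P := fun m => (1 + δ) * cumSum v m ≤ cumSum v n) hnN hn
  have hmn := Nat.findGreatest_le (P := fun m => (1 + δ) * cumSum v m ≤ cumSum v n) n
  have hgr := fun k => Nat.findGreatest_is_greatest
    (P := fun m => (1 + δ) * cumSum v m ≤ cumSum v n) (n := n) (k := k)
  set m := Nat.findGreatest (fun m => (1 + δ) * cumSum v m ≤ cumSum v n) n
  refine ⟨m, (le_max_right _ _).trans hle, hmn, hm, ?_⟩
  have hum := cumSum_pos hv m
  have hlt : m < n := by
    refine lt_of_le_of_ne hmn fun h => ?_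
    rw [h] at hm
    have := cumSum_pos hv n
    nlinarith
  have h1 := hgr (m + 1) (by omega) (by omega)
  push Not at h1
  have h2 := hN m ((le_max_left _ _).trans hle)
  nlinarith

/-- Slow decrease is a Tauberian condition for weighted means. -/
lemma tendsto_of_tendsto_weighted_mean (hC : 0 ≤ C)
    (hslow : ∀ n m, n ≤ m →
      r n - C * (Real.log (cumSum v m) - Real.log (cumSum v n)) ≤ r m)
    (h : Tendsto (fun n => cumSum (fun k => r k * v k) n / cumSum v n) atTop (𝓝 l)) :
    Tendsto r atTop (𝓝 l) := by
  have hpos := cumSum_pos hv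
  rw [Metric.tendsto_nhds]
  intro ε hε
  obtain ⟨δ, hδ, hδ1, hδC⟩ : ∃ δ > 0, δ ≤ 1 ∧ C * (2 * δ) < ε / 2 := by
    refine ⟨min 1 (ε / (8 * (C + 1))), by positivity, min_le_left _ _, ?_⟩
    have h1 : min 1 (ε / (8 * (C + 1))) ≤ ε / (8 * (C + 1)) := min_le_right _ _
    have h2 : C * (2 * min 1 (ε / (8 * (C + 1)))) ≤ C * (2 * (ε / (8 * (C + 1)))) := by gcongr
    have h3 : C * (2 * (ε / (8 * (C + 1)))) < ε / 2 := by
      have : C * (2 * (ε / (8 * (C + 1)))) = ε / 4 * (C / (C + 1)) := by field_simp; ring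
      rw [this]
      have h4 : C / (C + 1) ≤ 1 := by rw [div_le_one (by positivity)]; linarith
      nlinarith
    exact h2.trans_lt h3
  -- On either block the two partial sums of `v` add up to at most five times the smaller one,
  -- because `(1 + δ)² ≤ 4`. The value `ε δ / 10` makes `5 η = (ε/2) δ`.
  set η := ε * δ / 10 with hη
  have hη0 : 0 < η := by positivity
  obtain ⟨N, hN⟩ := eventually_atTop.1 (Metric.tendsto_nhds.1 h η hη0)
  have hσ : ∀ n ≥ N, |cumSum (fun k => r k * v k) n - l * cumSum v n| ≤ η * cumSum v n := by
    intro n hn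
    have h1 := (hN n hn).le
    rw [Real.dist_eq, div_sub' (hpos n).ne', abs_div, abs_of_pos (hpos n),
      div_le_iff₀ (hpos n)] at h1
    rwa [mul_comm l]
  have hblock : ∀ n m, n ≤ m → cumSum (fun k => r k * v k) m - l * cumSum v m
      - (cumSum (fun k => r k * v k) n - l * cumSum v n) =
      ∑ k ∈ Finset.Ioc n m, (r k - l) * v k := by
    intro n m hnm
    have h1 := cumSum_sub_cumSum (fun k => r k * v k) hnm
    have h2 := cumSum_sub_cumSum v hnm
    simp only [sub_mul, Finset.sum_sub_distrib, ← Finset.mul_sum]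
    rw [← h1, ← h2]
    ring
  have hlog : ∀ n m, cumSum v m ≤ (1 + δ) ^ 2 * cumSum v n →
      C * (Real.log (cumSum v m) - Real.log (cumSum v n)) ≤ C * (2 * δ) := by
    intro n m hm
    refine mul_le_mul_of_nonneg_left ?_ hC
    have h1 := Real.log_le_log (hpos m) hm
    rw [Real.log_mul (by positivity) (hpos n).ne', Real.log_pow] at h1
    have h2 := Real.log_le_sub_one_of_pos (show 0 < 1 + δ by linarith)
    push_cast at h1
    linarith
  filter_upwards [eventually_exists_gt hv hu hr hδ, eventually_exists_lt hv hu hr hδ N,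
    eventually_ge_atTop N] with n ⟨m, hnm, hm1, hm2⟩ ⟨i, hNi, hin, hi1, hi2⟩ hn
  have hsq : (1 + δ) ^ 2 ≤ 4 := by nlinarith
  rw [Real.dist_eq, abs_lt]
  constructor
  -- If `r n ≤ l - ε`, slow decrease forces `r k ≤ l - ε/2` on the whole block ending at `n`. That
  -- is too large a deviation for means within `η` of `l` at both ends. The second half is
  -- symmetric, with the block that starts at `n`.
  · by_contra! hcon
    have h1 := hblock i n hin
    have h2 : ∑ k ∈ Finset.Ioc i n, (r k - l) * v k ≤ ∑ k ∈ Finset.Ioc i n, (-(ε / 2)) * v k := by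
      refine Finset.sum_le_sum fun k hk => mul_le_mul_of_nonneg_right ?_ (hv k).le
      rw [Finset.mem_Ioc] at hk
      have h3 := hslow k n hk.2
      have h4 := hlog i n hi2
      have h5 := mul_le_mul_of_nonneg_left (sub_le_sub_left (log_cumSum_mono hv hk.1.le)
        (Real.log (cumSum v n))) hC
      linarith
    rw [← Finset.mul_sum, ← cumSum_sub_cumSum v hin] at h2
    have h6 := (abs_le.1 (hσ n hn)).1
    have h7 := (abs_le.1 (hσ i hNi)).2
    have h8 : ε / 2 * (cumSum v n - cumSum v i) ≤ η * (cumSum v n + cumSum v i) := by linarith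
    have h9 : cumSum v n ≤ 4 * cumSum v i :=
      hi2.trans (mul_le_mul_of_nonneg_right hsq (hpos i).le)
    have h10 : ε / 2 * (δ * cumSum v i) ≤ ε / 2 * (cumSum v n - cumSum v i) :=
      mul_le_mul_of_nonneg_left (by linarith) (by positivity)
    have h11 : η * (cumSum v n + cumSum v i) ≤ η * (5 * cumSum v i) :=
      mul_le_mul_of_nonneg_left (by linarith) hη0.le
    have h12 : η * (5 * cumSum v i) = ε / 2 * (δ * cumSum v i) := by rw [hη]; ring
    -- all inequalities are equalities, so `cumSum v n = 4 * cumSum v i`, which is excluded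
    have h13 : cumSum v n = 4 * cumSum v i := by
      have : η * (cumSum v n + cumSum v i) = η * (5 * cumSum v i) := by linarith
      have := mul_left_cancel₀ hη0.ne' this
      linarith
    have h14 : ε / 2 * (δ * cumSum v i) = ε / 2 * (cumSum v n - cumSum v i) := by linarith
    have h15 := mul_left_cancel₀ (half_pos hε).ne' h14
    have := hpos i
    nlinarith
  · by_contra! hcon
    have h1 := hblock n m hnm
    have h2 : ∑ k ∈ Finset.Ioc n m, (ε / 2) * v k ≤ ∑ k ∈ Finset.Ioc n m, (r k - l) * v k := by
      refine Finset.sum_le_sum fun k hk => mul_le_mul_of_nonneg_right ?_ (hv k).le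
      rw [Finset.mem_Ioc] at hk
      have h3 := hslow n k hk.1.le
      have h4 := hlog n m hm2
      have h5 := mul_le_mul_of_nonneg_left (sub_le_sub_right (log_cumSum_mono hv hk.2)
        (Real.log (cumSum v n))) hC
      linarith
    rw [← Finset.mul_sum, ← cumSum_sub_cumSum v hnm] at h2
    have h6 := (abs_le.1 (hσ m (hn.trans hnm))).2
    have h7 := (abs_le.1 (hσ n hn)).1
    have h8 : ε / 2 * (cumSum v m - cumSum v n) ≤ η * (cumSum v m + cumSum v n) := by linarith
    have h9 : cumSum v m ≤ 4 * cumSum v n :=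
      hm2.trans (mul_le_mul_of_nonneg_right hsq (hpos n).le)
    have h10 : ε / 2 * (δ * cumSum v n) ≤ ε / 2 * (cumSum v m - cumSum v n) :=
      mul_le_mul_of_nonneg_left (by linarith) (by positivity)
    have h11 : η * (cumSum v m + cumSum v n) ≤ η * (5 * cumSum v n) :=
      mul_le_mul_of_nonneg_left (by linarith) hη0.le
    have h12 : η * (5 * cumSum v n) = ε / 2 * (δ * cumSum v n) := by rw [hη]; ring
    have h13 : cumSum v m = 4 * cumSum v n := by
      have : η * (cumSum v m + cumSum v n) = η * (5 * cumSum v n) := by linarith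
      have := mul_left_cancel₀ hη0.ne' this
      linarith
    have h14 : ε / 2 * (δ * cumSum v n) = ε / 2 * (cumSum v m - cumSum v n) := by linarith
    have h15 := mul_left_cancel₀ (half_pos hε).ne' h14
    have := hpos n
    nlinarith

end

/-! ### The one-sided difference theorem (iv) -/

/-- One-sided difference Tauberian theorem for a positive sequence of weights. -/
lemma tendsto_of_tendsto_powerSum_div {v r : ℕ → ℝ} {C l : ℝ} (hv : ∀ n, 0 < v n)
    (hr : RatioNearOne v) (hu : Tendsto (cumSum v) atTop atTop)
    (hsv : ∀ x, 0 ≤ x → x < 1 → Summable fun n => v n * x ^ n)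
    (hsr : ∀ x, 0 ≤ x → x < 1 → Summable fun n => r n * v n * x ^ n) (hC : 0 ≤ C)
    (hstep : ∀ n, -(C * (v (n + 1) / cumSum v (n + 1))) ≤ r (n + 1) - r n)
    (h : Tendsto (fun x => powerSum (fun n => r n * v n) x / powerSum v x) (𝓝[<] 1) (𝓝 l)) :
    Tendsto r atTop (𝓝 l) := by
  obtain ⟨K, hK, hdb⟩ := exists_powerSum_le_mul_sq hv hsv hr
  obtain ⟨x₀, hx₀, hx₀1, hbd⟩ : ∃ x₀, 0 ≤ x₀ ∧ x₀ < 1 ∧ ∀ x, x₀ ≤ x → x < 1 →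
      |powerSum (fun n => r n * v n) x| ≤ (|l| + 1) * powerSum v x := by
    have h1 := (h.abs.eventually (ge_mem_nhds (show |l| < |l| + 1 by linarith))).and
      (eventually_mem_Ico_left one_pos)
    obtain ⟨y, hy, hsub⟩ := mem_nhdsLT_iff_exists_Ico_subset.1 h1
    have hy' : y < 1 := hy
    refine ⟨max y 0, le_max_right _ _, max_lt hy' one_pos, fun x hx hx1 => ?_⟩
    obtain ⟨h2, h3⟩ := hsub ⟨(le_max_left _ _).trans hx, hx1⟩
    have hp := powerSum_pos hv hsv h3.1 h3.2
    change |powerSum (fun n => r n * v n) x / powerSum v x| ≤ _ at h2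
    rwa [abs_div, abs_of_pos hp, div_le_iff₀ hp] at h2
  obtain ⟨B, hB⟩ := exists_forall_neg_le hv hsv hdb hK hu hC hstep hsr
    (show 0 ≤ |l| + 1 by positivity) hx₀ hx₀1 hbd
  -- `r n ≥ -B` means `r n * v n ≥ -B * v n`, the one-sided condition of Karamata's theorem.
  have hmean := tendsto_cumSum_div (C := B) (Eventually.of_forall hv) hr hu hsv hsr
    (Eventually.of_forall fun n => by
      have := mul_le_mul_of_nonneg_right (hB n) (hv n).le
      linarith) h
  exact tendsto_of_tendsto_weighted_mean hv hu (hr.cumSum hv) hC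
    (fun n m hnm => sub_mul_log_le hv hC hstep hnm) hmean

/-- One-sided difference Tauberian theorem for power series means. -/
theorem tendsto_div_of_isBigOL {a v : ℕ → ℝ} {l : ℝ} (hv : ∀ᶠ n in atTop, 0 < v n)
    (hr : RatioNearOne v) (hu : Tendsto (cumSum v) atTop atTop)
    (hsv : ∀ x, 0 ≤ x → x < 1 → Summable fun n => v n * x ^ n)
    (hsa : ∀ x, 0 ≤ x → x < 1 → Summable fun n => a n * x ^ n)
    (hstep : IsBigOL (fun n => a (n + 1) / v (n + 1) - a n / v n)
      fun n => v (n + 1) / cumSum v (n + 1))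
    (h : Tendsto (fun x => powerSum a x / powerSum v x) (𝓝[<] 1) (𝓝 l)) :
    Tendsto (fun n => a n / v n) atTop (𝓝 l) := by
  obtain ⟨N, hN⟩ := eventually_atTop.1 hv
  obtain ⟨C, hC⟩ := hstep
  set v' := trunc N 1 v with hv'
  set a' := trunc N 0 a with ha'
  have hvv : v' =ᶠ[atTop] v := trunc_eventuallyEq _ _ _
  have haa : a' =ᶠ[atTop] a := trunc_eventuallyEq _ _ _
  have hp : ∀ n, 0 < v' n := trunc_one_pos hN
  have hsv' : ∀ x, 0 ≤ x → x < 1 → Summable fun n => v' n * x ^ n :=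
    fun x h0 h1 => summable_congr_eventually hvv (hsv x h0 h1)
  have hsa' : ∀ x, 0 ≤ x → x < 1 → Summable fun n => a' n * x ^ n :=
    fun x h0 h1 => summable_congr_eventually haa (hsa x h0 h1)
  have hu' := tendsto_cumSum_atTop_congr hvv hu
  have h' := tendsto_powerSum_div_congr haa hvv hsa hsv (tendsto_powerSum_atTop hv hsv hu) h
  have hrv : (fun n => a' n / v' n * v' n) = a' := by
    funext n; rw [div_mul_cancel₀ _ (hp n).ne']
  -- Truncation changes `u` by a bounded amount, so the comparison sequence `v / u` is at most
  -- doubled by the return to the original.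
  have hcmp : ∀ᶠ n in atTop, cumSum v' n ≤ 2 * cumSum v n := by
    obtain ⟨L, hL⟩ := exists_tendsto_cumSum_sub hvv
    filter_upwards [hL.eventually (ge_mem_nhds (lt_add_one L)), hu.eventually_ge_atTop (L + 1)]
      with n h1 h2
    linarith
  have hev : ∀ᶠ n in atTop, -(2 * |C| * (v' (n + 1) / cumSum v' (n + 1))) ≤
      a' (n + 1) / v' (n + 1) - a' n / v' n := by
    filter_upwards [hC, eventually_ge_atTop N, (tendsto_add_atTop_nat 1).eventually hcmp,
      (tendsto_add_atTop_nat 1).eventually (hu.eventually_gt_atTop 0)] with n h1 hn h2 h3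
    have hn' : N ≤ n + 1 := hn.trans (Nat.le_succ n)
    have e1 := hN (n + 1) hn'
    have e2 := cumSum_pos hp (n + 1)
    rw [ha', hv', trunc_of_le hn, trunc_of_le hn, trunc_of_le hn', trunc_of_le hn', ← hv']
    refine le_trans (neg_le_neg ?_) h1
    have e3 : v (n + 1) / cumSum v (n + 1) ≤ 2 * (v (n + 1) / cumSum v' (n + 1)) := by
      rw [mul_div_assoc', div_le_div_iff₀ h3 e2]
      nlinarith
    calc C * (v (n + 1) / cumSum v (n + 1)) ≤ |C| * (v (n + 1) / cumSum v (n + 1)) :=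
          mul_le_mul_of_nonneg_right (le_abs_self C) (by positivity)
      _ ≤ |C| * (2 * (v (n + 1) / cumSum v' (n + 1))) :=
          mul_le_mul_of_nonneg_left e3 (abs_nonneg C)
      _ = _ := by ring
  obtain ⟨C', hC'0, hC'⟩ := exists_forall_neg_mul_le
    (fun n => div_pos (hp (n + 1)) (cumSum_pos hp (n + 1))) hev
  refine (tendsto_of_tendsto_powerSum_div (r := fun n => a' n / v' n) hp (hr.congr hvv) hu' hsv' ?_
    hC'0 hC' (by rwa [hrv])).congr' ?_
  · intro x h0 h1
    simpa only [div_mul_cancel₀ _ (hp _).ne'] using hsa' x h0 h1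
  · filter_upwards [haa, hvv] with n h1 h2
    rw [h1, h2]

/-! ### Tauber's theorem (v) -/

lemma one_div_two_mul_le_one_sub_expPt {n : ℕ} (hn : 1 ≤ n) : 1 / (2 * (n : ℝ)) ≤ 1 - expPt n := by
  have hn0 : (1 : ℝ) ≤ n := by exact_mod_cast hn
  have h1 := Real.add_one_le_exp (1 / (n : ℝ))
  have h2 : expPt n ≤ (1 / (n : ℝ) + 1)⁻¹ := by
    rw [expPt, Real.exp_neg]
    exact inv_anti₀ (by positivity) h1
  have h3 : (1 / (n : ℝ) + 1)⁻¹ ≤ 1 - 1 / (2 * (n : ℝ)) := by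
    rw [inv_le_iff_one_le_mul₀ (by positivity)]
    field_simp
    nlinarith
  linarith

section
variable {v r : ℕ → ℝ} {ε K : ℝ} {N : ℕ} (hv : ∀ n, 0 < v n) (hε : 0 ≤ ε)
  (hstep : ∀ n ≥ N, |r (n + 1) - r n| ≤ ε * (v (n + 1) / cumSum v (n + 1)))
include hv hε hstep

/-- Replacing `r n` by `r (n+1)` costs `u n * |r (n+1) - r n| ≤ ε v (n+1)`, and these costs add up
to at most `ε u n`. -/
lemma sum_mul_abs_sub_le {n : ℕ} (hn : N ≤ n) :
    ∑ k ∈ Finset.range (n + 1), v k * |r n - r k| ≤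
      ∑ k ∈ Finset.range (N + 1), v k * |r N - r k| + ε * cumSum v n := by
  induction n, hn using Nat.le_induction with
  | base => linarith [mul_nonneg hε (cumSum_pos hv N).le]
  | succ n hn ih =>
    rw [Finset.sum_range_succ, sub_self, abs_zero, mul_zero, add_zero]
    have h1 : ∑ k ∈ Finset.range (n + 1), v k * |r (n + 1) - r k| ≤
        ∑ k ∈ Finset.range (n + 1), (v k * |r (n + 1) - r n| + v k * |r n - r k|) := by
      refine Finset.sum_le_sum fun k _ => ?_
      rw [← mul_add]
      exact mul_le_mul_of_nonneg_left (abs_sub_le _ _ _) (hv k).le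
    rw [Finset.sum_add_distrib, ← Finset.sum_mul] at h1
    have h2 : cumSum v n * |r (n + 1) - r n| ≤ ε * v (n + 1) := by
      have hu := cumSum_pos hv (n + 1)
      calc cumSum v n * |r (n + 1) - r n|
          ≤ cumSum v (n + 1) * (ε * (v (n + 1) / cumSum v (n + 1))) :=
            mul_le_mul (cumSum_mono (fun k => (hv k).le) (Nat.le_succ n)) (hstep n hn)
              (abs_nonneg _) hu.le
        _ = _ := by field_simp
    rw [cumSum_succ]
    change _ ≤ cumSum v n * _ + _ at h1
    linarith

lemma abs_sub_le_of_le (hK : ∀ n ≥ N, v n ≤ K / n) {n : ℕ} (hn : N ≤ n) (hn1 : 1 ≤ n) (j : ℕ) :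
    |r n - r (n + j)| ≤ ε * K / (cumSum v n * n) * j := by
  have hn0 : (0 : ℝ) < n := by exact_mod_cast hn1
  induction j with
  | zero => simp
  | succ j ih =>
    have hu := cumSum_pos hv n
    have h1 := hstep (n + j) (hn.trans (Nat.le_add_right n j))
    have h2 : v (n + j + 1) / cumSum v (n + j + 1) ≤ K / (cumSum v n * n) := by
      have h3 := hK (n + j + 1) (by omega)
      have hK0 : 0 < K / ((n + j + 1 : ℕ) : ℝ) := (hv _).trans_le h3
      have hK1 : 0 < K := by
        by_contra! hle
        exact absurd hK0 (not_lt.2 (div_nonpos_of_nonpos_of_nonneg hle (Nat.cast_nonneg _)))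
      have h4 : K / ((n + j + 1 : ℕ) : ℝ) ≤ K / n := by
        refine div_le_div_of_nonneg_left hK1.le hn0 ?_
        exact_mod_cast (by omega : n ≤ n + j + 1)
      calc v (n + j + 1) / cumSum v (n + j + 1) ≤ (K / n) / cumSum v n := by
            refine div_le_div₀ (by positivity) (h3.trans h4) hu ?_
            exact cumSum_mono (fun k => (hv k).le) (by omega)
        _ = _ := by rw [div_div, mul_comm]
    have h5 := mul_le_mul_of_nonneg_left h2 hε
    have h6 := abs_sub_le (r n) (r (n + j)) (r (n + j + 1))
    rw [abs_sub_comm (r (n + j))] at h6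
    rw [← add_assoc]
    push_cast
    have h7 : ε * (K / (cumSum v n * n)) = ε * K / (cumSum v n * n) := by ring
    rw [h7] at h5
    linarith

/-- Split at `n`. The head is the preceding sum. In the tail, `v k ≤ K/n` and the drift of `r` is
linear in `k - n`; as `1 / (1 - x) ≤ 2 n`, the sum of `(k + 1) xᵏ` is at most `(2n)² + 2n ≤ 6 n²`.
-/
lemma abs_mul_powerSum_sub_le (hsv : ∀ x, 0 ≤ x → x < 1 → Summable fun n => v n * x ^ n)
    (hsr : ∀ x, 0 ≤ x → x < 1 → Summable fun n => r n * v n * x ^ n)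
    (hK : ∀ n ≥ N, v n ≤ K / n) (hK0 : 0 ≤ K) {n : ℕ} (hn : N ≤ n) (hn1 : 1 ≤ n) :
    |r n * powerSum v (expPt n) - powerSum (fun k => r k * v k) (expPt n)| ≤
      ∑ k ∈ Finset.range (N + 1), v k * |r N - r k| + ε * cumSum v n
        + 6 * (ε * K ^ 2 / cumSum v n) := by
  have hn0 : (0 : ℝ) < n := by exact_mod_cast hn1
  have hu := cumSum_pos hv n
  have x0 := (expPt_pos n).le
  have x1 := expPt_lt_one hn1
  have hx := one_div_two_mul_le_one_sub_expPt hn1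
  set x := expPt n
  have s1 := (hsv x x0 x1).mul_left (r n)
  have s2 := hsr x x0 x1
  have e1 : r n * powerSum v x - powerSum (fun k => r k * v k) x =
      ∑' k, (r n * (v k * x ^ k) - r k * v k * x ^ k) := by
    rw [s1.tsum_sub s2, tsum_mul_left]; rfl
  rw [e1, ← (s1.sub s2).sum_add_tsum_nat_add (n + 1)]
  refine (abs_add_le _ _).trans (add_le_add ?_ ?_)
  · refine le_trans ?_ (sum_mul_abs_sub_le hv hε hstep hn)
    refine (Finset.abs_sum_le_sum_abs _ _).trans (Finset.sum_le_sum fun k _ => ?_)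
    have : r n * (v k * x ^ k) - r k * v k * x ^ k = v k * (r n - r k) * x ^ k := by ring
    rw [this, abs_mul, abs_mul, abs_of_pos (hv k), abs_of_nonneg (pow_nonneg x0 k)]
    exact mul_le_of_le_one_right (mul_nonneg (hv k).le (abs_nonneg _)) (pow_le_one₀ x0 x1.le)
  · have hxn : ‖x‖ < 1 := by rwa [Real.norm_of_nonneg x0]
    have g := ((hasSum_coe_mul_geometric_of_norm_lt_one hxn).add
      (hasSum_geometric_of_lt_one x0 x1)).mul_left (ε * K ^ 2 / (cumSum v n * n ^ 2))
    rw [← Real.norm_eq_abs]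
    refine (tsum_of_norm_bounded g fun k => ?_).trans ?_
    · have e2 : r n * (v (k + (n + 1)) * x ^ (k + (n + 1)))
          - r (k + (n + 1)) * v (k + (n + 1)) * x ^ (k + (n + 1)) =
          v (k + (n + 1)) * (r n - r (n + (k + 1))) * x ^ (k + (n + 1)) := by
        rw [show n + (k + 1) = k + (n + 1) by ring]; ring
      rw [e2, Real.norm_eq_abs, abs_mul, abs_mul, abs_of_pos (hv _),
        abs_of_nonneg (pow_nonneg x0 _)]
      have h1 := abs_sub_le_of_le hv hε hstep hK hn hn1 (k + 1)
      have h2 : v (k + (n + 1)) ≤ K / n := (hK _ (by omega)).trans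
        (div_le_div_of_nonneg_left hK0 hn0 (by exact_mod_cast (by omega : n ≤ k + (n + 1))))
      have h3 : x ^ (k + (n + 1)) ≤ x ^ k := pow_le_pow_of_le_one x0 x1.le (by omega)
      calc _ ≤ (K / n) * (ε * K / (cumSum v n * n) * ((k + 1 : ℕ) : ℝ)) * x ^ k := by
            refine mul_le_mul (mul_le_mul h2 h1 (abs_nonneg _) (by positivity)) h3
              (pow_nonneg x0 _) (by positivity)
        _ = _ := by push_cast; field_simp
    · have h1x : 0 < 1 - x := by linarith
      have h4 : 1 / (1 - x) ≤ 2 * n := by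
        rw [div_le_iff₀ h1x]
        rw [div_le_iff₀ (by positivity)] at hx
        linarith
      have h5 : x / (1 - x) ^ 2 ≤ (2 * n) ^ 2 := by
        calc x / (1 - x) ^ 2 ≤ 1 / (1 - x) ^ 2 := by gcongr
          _ = (1 / (1 - x)) ^ 2 := by rw [div_pow, one_pow]
          _ ≤ _ := pow_le_pow_left₀ (by positivity) h4 2
      rw [← one_div]
      calc _ ≤ ε * K ^ 2 / (cumSum v n * n ^ 2) * (6 * n ^ 2) := by
            refine mul_le_mul_of_nonneg_left ?_ (by positivity)
            have : (1 : ℝ) ≤ n := by exact_mod_cast hn1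
            nlinarith
        _ = _ := by field_simp

end

/-- Tauber's theorem for power series means with weights `vₙ = O(1 / n)`. -/
theorem tendsto_div_of_isLittleO {a v : ℕ → ℝ} {l : ℝ} (hv : ∀ n, 0 < v n)
    (hvO : v =O[atTop] fun n : ℕ => 1 / (n : ℝ)) (hu : Tendsto (cumSum v) atTop atTop)
    (hsv : ∀ x, 0 ≤ x → x < 1 → Summable fun n => v n * x ^ n)
    (hsa : ∀ x, 0 ≤ x → x < 1 → Summable fun n => a n * x ^ n)
    (hstep : (fun n => a (n + 1) / v (n + 1) - a n / v n)
      =o[atTop] fun n => v (n + 1) / cumSum v (n + 1))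
    (h : Tendsto (fun x => powerSum a x / powerSum v x) (𝓝[<] 1) (𝓝 l)) :
    Tendsto (fun n => a n / v n) atTop (𝓝 l) := by
  obtain ⟨K, hK0, hK⟩ := hvO.exists_pos
  set r : ℕ → ℝ := fun n => a n / v n with hr
  have hra : (fun k => r k * v k) = a := by
    funext k; simp only [hr]; rw [div_mul_cancel₀ _ (hv k).ne']
  have hsr : ∀ x, 0 ≤ x → x < 1 → Summable fun n => r n * v n * x ^ n := by
    intro x h0 h1
    simpa only [hr, div_mul_cancel₀ _ (hv _).ne'] using hsa x h0 h1
  have hlim := h.comp tendsto_expPt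
  suffices hd : Tendsto (fun n => r n - powerSum a (expPt n) / powerSum v (expPt n)) atTop
      (𝓝 0) by
    have := hd.add hlim
    simpa using this
  rw [Metric.tendsto_nhds]
  intro η hη
  -- The three errors add up to at most `ε (2 + 6 K²) u n`, and `u n ≤ e D`; with this `ε` the
  -- result is `(η/2) D`.
  set ε := η / (Real.exp 1 * (4 + 12 * K ^ 2)) with hε
  have hε0 : 0 < ε := by positivity
  obtain ⟨N, hN⟩ := eventually_atTop.1 ((isLittleO_iff.1 hstep hε0).and hK.bound)
  have hst : ∀ n ≥ N, |r (n + 1) - r n| ≤ ε * (v (n + 1) / cumSum v (n + 1)) := by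
    intro n hn
    have := (hN n hn).1
    rwa [Real.norm_eq_abs, Real.norm_of_nonneg
      (div_pos (hv (n + 1)) (cumSum_pos hv (n + 1))).le] at this
  have hvK : ∀ n ≥ N, v n ≤ K / n := by
    intro n hn
    have := (hN n hn).2
    rwa [Real.norm_of_nonneg (hv n).le, Real.norm_of_nonneg (by positivity), mul_one_div] at this
  set T := ∑ k ∈ Finset.range (N + 1), v k * |r N - r k|
  filter_upwards [eventually_ge_atTop N, eventually_ge_atTop 1, hu.eventually_ge_atTop 1,
    hu.eventually_ge_atTop (T / ε)] with n hn hn1 hu1 huT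
  have hn0 : (0 : ℝ) < n := by exact_mod_cast hn1
  have key := abs_mul_powerSum_sub_le hv hε0.le hst hsv hsr hvK hK0.le hn hn1
  rw [hra] at key
  have z0 := (expPt_pos n).le
  have hD := powerSum_pos hv hsv z0 (expPt_lt_one hn1)
  have hu0 := cumSum_pos hv n
  have huD := cumSum_le_exp_one_mul_powerSum hv hsv hn1
  have e1 : T ≤ ε * cumSum v n := by
    rw [div_le_iff₀ hε0] at huT; linarith
  have e2 : ε * K ^ 2 / cumSum v n ≤ ε * K ^ 2 * cumSum v n := by
    rw [div_le_iff₀ hu0, mul_assoc]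
    exact le_mul_of_one_le_right (by positivity) (one_le_mul_of_one_le_of_one_le hu1 hu1)
  have e3 : ε * (2 + 6 * K ^ 2) * cumSum v n ≤ η / 2 * powerSum v (expPt n) := by
    calc _ ≤ ε * (2 + 6 * K ^ 2) * (Real.exp 1 * powerSum v (expPt n)) :=
          mul_le_mul_of_nonneg_left huD (by positivity)
      _ = _ := by rw [hε]; field_simp; ring
  rw [Real.dist_eq, sub_zero, sub_div' hD.ne', abs_div, abs_of_pos hD, div_lt_iff₀ hD]
  have : 0 < η * powerSum v (expPt n) := by positivity
  linarith

/-! ### Regularly varying functions and Potter's bounds -/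

/-- Regular variation of index `ρ` together with local uniformity at ratio one. -/
structure RegVar (h : ℝ → ℝ) (ρ : ℝ) : Prop where
  pos : ∀ᶠ x in atTop, 0 < h x
  tendsto : ∀ c, 0 < c → Tendsto (fun x => h (c * x) / h x) atTop (𝓝 (c ^ ρ))
  near_one : ∀ ε > 0, ∃ δ > 0, ∃ X > 0, ∀ x ≥ X, ∀ y, x ≤ y → y ≤ (1 + δ) * x → |h y / h x - 1| ≤ ε

/-- Doubling the base point repeatedly does not increase `φ`; the constant `C` is spent only once,
in the last dyadic block, and so does not compound. -/
lemma le_mul_of_le_two_mul {φ : ℝ → ℝ} {X C : ℝ} (hX : 0 < X) (hC : 0 ≤ C)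
    (h2 : ∀ x ≥ X, φ (2 * x) ≤ φ x) (hloc : ∀ x ≥ X, ∀ y, x ≤ y → y ≤ 2 * x → φ y ≤ C * φ x)
    {x y : ℝ} (hx : X ≤ x) (hy : x ≤ y) : φ y ≤ C * φ x := by
  have key : ∀ i : ℕ, ∀ x ≥ X, ∀ y, x ≤ y → y ≤ 2 ^ i * x → φ y ≤ C * φ x := by
    intro i
    induction i with
    | zero =>
      intro x hx y hxy hy
      exact hloc x hx y hxy (by rw [pow_zero, one_mul] at hy; linarith)
    | succ i ih =>
      intro x hx y hxy hy
      rcases le_total y (2 * x) with h | h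
      · exact hloc x hx y hxy h
      · refine (ih (2 * x) (by linarith) y h (by rw [pow_succ] at hy; linarith)).trans ?_
        exact mul_le_mul_of_nonneg_left (h2 x hx) hC
  obtain ⟨i, hi⟩ := pow_unbounded_of_one_lt (y / x) (show (1 : ℝ) < 2 by norm_num)
  exact key i x hx y hy ((div_le_iff₀ (hX.trans_le hx)).1 hi.le)

lemma rpow_le_two_rpow_abs {t : ℝ} (h1 : 1 / 2 ≤ t) (h2 : t ≤ 2) (σ : ℝ) : t ^ σ ≤ 2 ^ |σ| := by
  have ht : 0 < t := by linarith
  rcases le_total 0 σ with h | h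
  · rw [abs_of_nonneg h]
    exact Real.rpow_le_rpow ht.le h2 h
  · rw [abs_of_nonpos h]
    calc t ^ σ ≤ (1 / 2) ^ σ := Real.rpow_le_rpow_of_nonpos (by norm_num) h1 h
      _ = 2 ^ (-σ) := by rw [one_div, Real.inv_rpow (by norm_num), Real.rpow_neg (by norm_num)]

/-- The upper Potter bound. -/
lemma exists_le_mul_rpow {h : ℝ → ℝ} {ρ σ X C : ℝ} (hX : 0 < X) (hC : 0 < C)
    (hpos : ∀ x ≥ X, 0 < h x) (hloc : ∀ x ≥ X, ∀ y, x ≤ y → y ≤ 2 * x → h y ≤ C * h x)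
    (h2 : Tendsto (fun x => h (2 * x) / h x) atTop (𝓝 (2 ^ ρ))) (hσ : ρ < σ) :
    ∃ C' > 0, ∃ X' ≥ X, ∀ x ≥ X', ∀ y, x ≤ y → h y ≤ C' * (y / x) ^ σ * h x := by
  have hlt : (2 : ℝ) ^ ρ < 2 ^ σ := Real.rpow_lt_rpow_of_exponent_lt (by norm_num) hσ
  obtain ⟨X₁, hX₁⟩ := eventually_atTop.1 (h2.eventually (gt_mem_nhds hlt))
  refine ⟨C * 2 ^ |(-σ)|, by positivity, max X X₁, le_max_left _ _, fun x hx y hy => ?_⟩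
  have hxX := (le_max_left _ _).trans hx
  have hx0 : 0 < x := hX.trans_le hxX
  have hy0 : 0 < y := hx0.trans_le hy
  -- For `φ x = h x * x ^ (-σ)` the ratio `φ (2x) / φ x` tends to `2 ^ (ρ - σ) < 1`.
  have key := le_mul_of_le_two_mul (φ := fun x => h x * x ^ (-σ)) (X := max X X₁)
    (C := C * 2 ^ |(-σ)|) (lt_max_of_lt_left hX) (by positivity) ?_ ?_ hx hy
  · rw [Real.rpow_neg hx0.le, Real.rpow_neg hy0.le] at key
    rw [Real.div_rpow hy0.le hx0.le]
    have hp := Real.rpow_pos_of_pos hy0 σ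
    rw [← div_eq_mul_inv, div_le_iff₀ hp] at key
    refine key.trans (le_of_eq ?_)
    ring
  · intro z hz
    have hzX := (le_max_left _ _).trans hz
    have hz0 : 0 < z := hX.trans_le hzX
    have h1 := (hX₁ z ((le_max_right _ _).trans hz)).le
    rw [div_le_iff₀ (hpos z hzX)] at h1
    rw [Real.mul_rpow (by norm_num) hz0.le, Real.rpow_neg (by norm_num : (0 : ℝ) ≤ 2)]
    have hzp := Real.rpow_pos_of_pos hz0 (-σ)
    have h2p := Real.rpow_pos_of_pos (show (0 : ℝ) < 2 by norm_num) σ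
    calc h (2 * z) * ((2 ^ σ)⁻¹ * z ^ (-σ)) ≤ 2 ^ σ * h z * ((2 ^ σ)⁻¹ * z ^ (-σ)) :=
          mul_le_mul_of_nonneg_right h1 (by positivity)
      _ = _ := by field_simp
  · intro z hz w hzw hw
    have hzX := (le_max_left _ _).trans hz
    have hz0 : 0 < z := hX.trans_le hzX
    have hw0 : 0 < w := hz0.trans_le hzw
    have h1 := hloc z hzX w hzw hw
    have h3 : w ^ (-σ) ≤ 2 ^ |(-σ)| * z ^ (-σ) := by
      have h4 := rpow_le_two_rpow_abs (t := w / z)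
        (by rw [le_div_iff₀ hz0]; linarith) (by rwa [div_le_iff₀ hz0]) (-σ)
      rwa [Real.div_rpow hw0.le hz0.le, div_le_iff₀ (Real.rpow_pos_of_pos hz0 _)] at h4
    calc h w * w ^ (-σ) ≤ (C * h z) * (2 ^ |(-σ)| * z ^ (-σ)) :=
          mul_le_mul h1 h3 (Real.rpow_nonneg hw0.le _) (mul_nonneg hC.le (hpos z hzX).le)
      _ = _ := by ring

namespace RegVar
variable {h : ℝ → ℝ} {ρ : ℝ} (H : RegVar h ρ)
include H

/-- A chain of steps of ratio `1 + δ`, each changing `h` by a factor of at most `2` either way,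
covers `[x, 2x]`. -/
lemma exists_local_bound : ∃ X > 0, ∃ C > 0, (∀ x ≥ X, 0 < h x) ∧
    ∀ x ≥ X, ∀ y, x ≤ y → y ≤ 2 * x → h y ≤ C * h x ∧ h x ≤ C * h y := by
  obtain ⟨δ, hδ, X₁, hX₁, hloc⟩ := H.near_one (1 / 2) (by norm_num)
  obtain ⟨X₀, hX₀⟩ := eventually_atTop.1 H.pos
  have hpos : ∀ x ≥ max X₁ X₀, 0 < h x := fun x hx => hX₀ x ((le_max_right _ _).trans hx)
  have key : ∀ i : ℕ, ∀ x ≥ max X₁ X₀, ∀ y, x ≤ y → y ≤ (1 + δ) ^ i * x →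
      h y ≤ 2 ^ i * h x ∧ h x ≤ 2 ^ i * h y := by
    intro i
    induction i with
    | zero =>
      intro x hx y hxy hy
      have : x = y := by rw [pow_zero, one_mul] at hy; linarith
      simp [this]
    | succ i ih =>
      intro x hx y hxy hy
      have base : ∀ z, x ≤ z → z ≤ (1 + δ) * x → h z ≤ 2 * h x ∧ h x ≤ 2 * h z := by
        intro z hxz hz
        have h1 := abs_le.1 (hloc x ((le_max_left _ _).trans hx) z hxz hz)
        have hp := hpos x hx
        have h2 : h z / h x ≤ 2 := by linarith
        have h3 : 1 / 2 ≤ h z / h x := by linarith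
        rw [div_le_iff₀ hp] at h2
        rw [le_div_iff₀ hp] at h3
        exact ⟨h2, by linarith⟩
      have hx0 : 0 < x := hX₁.trans_le ((le_max_left _ _).trans hx)
      have h2i : (1 : ℝ) ≤ 2 ^ i := one_le_pow₀ (by norm_num)
      rcases le_total y ((1 + δ) * x) with hc | hc
      · obtain ⟨b1, b2⟩ := base y hxy hc
        have p1 := hpos x hx
        have p2 := hpos y (hx.trans hxy)
        rw [pow_succ]
        constructor <;> nlinarith
      · have hxx : x ≤ (1 + δ) * x := by nlinarith
        obtain ⟨b1, b2⟩ := base _ hxx le_rfl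
        obtain ⟨c1, c2⟩ := ih ((1 + δ) * x) (hx.trans hxx) y hc (by
          rw [pow_succ, mul_assoc] at hy; exact hy)
        rw [pow_succ]
        constructor <;> nlinarith
  obtain ⟨j, hj⟩ := pow_unbounded_of_one_lt 2 (show 1 < 1 + δ by linarith)
  refine ⟨max X₁ X₀, lt_max_of_lt_left hX₁, 2 ^ j, by positivity, hpos, fun x hx y hxy hy => ?_⟩
  have hx0 : 0 < x := hX₁.trans_le ((le_max_left _ _).trans hx)
  exact key j x hx y hxy (hy.trans (by gcongr))

/-- Potter's bounds. -/
lemma exists_potter {η : ℝ} (hη : 0 < η) : ∃ C > 0, ∃ X > 0, (∀ x ≥ X, 0 < h x) ∧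
    ∀ x ≥ X, ∀ y, x ≤ y →
      h y ≤ C * (y / x) ^ (ρ + η) * h x ∧ h x ≤ C * (x / y) ^ (ρ - η) * h y := by
  obtain ⟨X, hX, C, hC, hpos, hloc⟩ := H.exists_local_bound
  obtain ⟨C₁, hC₁, X₁, hX₁, hup⟩ := exists_le_mul_rpow hX hC hpos
    (fun x hx y hxy hy => (hloc x hx y hxy hy).1) (H.tendsto 2 two_pos)
    (show ρ < ρ + η by linarith)
  -- The lower bound is the upper bound for `1 / h`, which has index `-ρ`.
  obtain ⟨C₂, hC₂, X₂, hX₂, hlow⟩ := exists_le_mul_rpow (h := fun x => (h x)⁻¹) (ρ := -ρ)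
    (σ := -(ρ - η)) hX hC (fun x hx => inv_pos.2 (hpos x hx))
    (fun x hx y hxy hy => by
      have p1 := hpos x hx
      have p2 := hpos y (hx.trans hxy)
      have := (hloc x hx y hxy hy).2
      rw [← div_eq_mul_inv, le_div_iff₀ p1, inv_mul_le_iff₀ p2]
      linarith)
    (by
      have := (H.tendsto 2 two_pos).inv₀ (Real.rpow_pos_of_pos two_pos ρ).ne'
      rw [Real.rpow_neg two_pos.le]
      refine this.congr fun x => ?_
      rw [inv_div_inv, inv_div])
    (by linarith)
  refine ⟨max C₁ C₂, lt_max_of_lt_left hC₁, max X₁ X₂, lt_max_of_lt_left (hX.trans_le hX₁),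
    fun x hx => hpos x (hX₁.le.trans ((le_max_left _ _).trans hx)), fun x hx y hxy => ?_⟩
  have hx1 := (le_max_left _ _).trans hx
  have hx2 := (le_max_right _ _).trans hx
  have hx0 : 0 < x := (hX.trans_le hX₁).trans_le hx1
  have hy0 : 0 < y := hx0.trans_le hxy
  have p1 := hpos x (hX₁.le.trans hx1)
  have p2 := hpos y (hX₁.le.trans (hx1.trans hxy))
  constructor
  · refine (hup x hx1 y hxy).trans ?_
    have := Real.rpow_pos_of_pos (div_pos hy0 hx0) (ρ + η)
    gcongr
    exact le_max_left _ _
  · have h1 := hlow x hx2 y hxy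
    have h2 : (y / x) ^ (-(ρ - η)) = (x / y) ^ (ρ - η) := by
      rw [Real.rpow_neg (by positivity), ← Real.inv_rpow (by positivity), inv_div]
    rw [h2, ← div_eq_mul_inv, inv_le_iff_one_le_mul₀ p2, div_mul_eq_mul_div, one_le_div p1] at h1
    refine h1.trans ?_
    have := Real.rpow_pos_of_pos (div_pos hx0 hy0) (ρ - η)
    gcongr
    exact le_max_right _ _

end RegVar

/-! ### Karamata's Abelian theorem for regularly varying weights -/

/-- A series as the integral of a step function. -/
lemma hasSum_integral_floor {G : ℕ → ℝ} (hG : IntegrableOn (fun x : ℝ => G ⌊x⌋₊) (Set.Ioi 0)) :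
    HasSum G (∫ x in Set.Ioi (0 : ℝ), G ⌊x⌋₊) := by
  have hU : ⋃ k : ℕ, Set.Ico (k : ℝ) (k + 1) = Set.Ici 0 := by
    ext x
    simp only [Set.mem_iUnion, Set.mem_Ico, Set.mem_Ici]
    constructor
    · rintro ⟨k, hk, -⟩
      exact (Nat.cast_nonneg k).trans hk
    · intro hx
      exact ⟨⌊x⌋₊, Nat.floor_le hx, Nat.lt_floor_add_one x⟩
  have hfl : ∀ k : ℕ, ∀ x ∈ Set.Ico (k : ℝ) (k + 1), ⌊x⌋₊ = k := fun k x hx =>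
    (Nat.floor_eq_iff ((Nat.cast_nonneg k).trans hx.1)).2 hx
  have hdis : Pairwise (Function.onFun Disjoint fun k : ℕ => Set.Ico (k : ℝ) (k + 1)) := by
    intro i j hij
    refine Set.disjoint_left.2 fun x hx hx' => hij ?_
    rw [← hfl i x hx, hfl j x hx']
  have h := hasSum_integral_iUnion (μ := volume) (f := fun x : ℝ => G ⌊x⌋₊)
    (fun k : ℕ => measurableSet_Ico) hdis (by rw [hU]; exact (integrableOn_Ici_iff_integrableOn_Ioi).2 hG)
  rw [hU, integral_Ici_eq_integral_Ioi] at h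
  have hk : ∀ k : ℕ, ∫ x in Set.Ico (k : ℝ) (k + 1), G ⌊x⌋₊ = G k := by
    intro k
    rw [setIntegral_congr_fun measurableSet_Ico (g := fun _ => G k)
      (fun x hx => by simp only [hfl k x hx])]
    simp
  simpa only [hk] using h

lemma exp_neg_one_div_pow (X : ℝ) (k : ℕ) : Real.exp (-(1 / X)) ^ k = Real.exp (-(k / X)) := by
  rw [← Real.exp_nat_mul]; congr 1; ring

lemma integrableOn_rpow_mul_exp {σ : ℝ} (hσ : -1 < σ) :
    IntegrableOn (fun y : ℝ => y ^ σ * Real.exp (-y)) (Set.Ioi 0) := by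
  have := Real.GammaIntegral_convergent (show 0 < σ + 1 by linarith)
  simpa [mul_comm] using this

lemma div_rpow_le {X y : ℝ} (hX : 0 < X) (hy : 0 < y) (hk : 1 ≤ ⌊X * y⌋₊) (σ : ℝ) :
    ((⌊X * y⌋₊ : ℝ) / X) ^ σ ≤ 2 ^ |σ| * y ^ σ := by
  have h1 := Nat.floor_le (show 0 ≤ X * y by positivity)
  have h2 := Nat.lt_floor_add_one (X * y)
  have h3 : (1 : ℝ) ≤ ⌊X * y⌋₊ := by exact_mod_cast hk
  have h4 : (⌊X * y⌋₊ : ℝ) / X = (⌊X * y⌋₊ : ℝ) / (X * y) * y := by field_simp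
  rw [h4, Real.mul_rpow (by positivity) hy.le]
  refine mul_le_mul_of_nonneg_right ?_ (Real.rpow_nonneg hy.le _)
  refine rpow_le_two_rpow_abs ?_ ?_ σ
  · rw [le_div_iff₀ (by positivity)]; linarith
  · rw [div_le_iff₀ (by positivity)]; linarith

namespace RegVar
variable {h : ℝ → ℝ} {ρ : ℝ} (H : RegVar h ρ)
include H

lemma tendsto_floor_div_self : Tendsto (fun x : ℝ => h ⌊x⌋₊ / h x) atTop (𝓝 1) := by
  have key : Tendsto (fun x : ℝ => h x / h ⌊x⌋₊) atTop (𝓝 1) := by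
    rw [Metric.tendsto_nhds]
    intro ε hε
    obtain ⟨δ, hδ, X, hX, hloc⟩ := H.near_one (ε / 2) (half_pos hε)
    have hfl : Tendsto (fun x : ℝ => (⌊x⌋₊ : ℝ)) atTop atTop :=
      tendsto_natCast_atTop_atTop.comp tendsto_nat_floor_atTop
    filter_upwards [hfl.eventually_ge_atTop X, hfl.eventually_ge_atTop (1 / δ),
      eventually_ge_atTop 0] with x h1 h2 h0
    rw [div_le_iff₀ hδ] at h2
    have h3 := hloc _ h1 x (Nat.floor_le h0) (by linarith [Nat.lt_floor_add_one x])
    rw [Real.dist_eq]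
    linarith
  have := key.inv₀ one_ne_zero
  simpa only [inv_div, inv_one] using this

/-- Potter's lower bound with loss `(ρ + 1)/2` makes `x * h x` at least a multiple of `x ^ ((ρ +
1)/2)`. -/
lemma tendsto_mul_self (hρ : -1 < ρ) : Tendsto (fun x => x * h x) atTop atTop := by
  obtain ⟨C, hC, X, hX, hpos, hpot⟩ := H.exists_potter (show 0 < (ρ + 1) / 2 by linarith)
  have hlim : Tendsto (fun y : ℝ => (h X / (C * X ^ (ρ - (ρ + 1) / 2))) * y ^ ((ρ + 1) / 2))
      atTop atTop :=
    (tendsto_rpow_atTop (by linarith)).const_mul_atTop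
      (div_pos (hpos X le_rfl) (mul_pos hC (Real.rpow_pos_of_pos hX _)))
  refine tendsto_atTop_mono' _ ?_ hlim
  filter_upwards [eventually_ge_atTop X] with y hy
  have hy0 : 0 < y := hX.trans_le hy
  have h1 := (hpot X le_rfl y hy).2
  rw [Real.div_rpow hX.le hy0.le] at h1
  have p1 := Real.rpow_pos_of_pos hX (ρ - (ρ + 1) / 2)
  have p2 := Real.rpow_pos_of_pos hy0 (ρ - (ρ + 1) / 2)
  have p3 : y = y ^ ((ρ + 1) / 2) * y ^ (1 - (ρ + 1) / 2) := by
    rw [← Real.rpow_add hy0]; simp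
  have p4 : y ^ (ρ - (ρ + 1) / 2) * y ^ (1 - (ρ + 1) / 2) = 1 := by
    rw [← Real.rpow_add hy0, show ρ - (ρ + 1) / 2 + (1 - (ρ + 1) / 2) = 0 by ring, Real.rpow_zero]
  have p5 := Real.rpow_pos_of_pos hy0 ((ρ + 1) / 2)
  have p6 := Real.rpow_pos_of_pos hy0 (1 - (ρ + 1) / 2)
  rw [div_mul_eq_mul_div, div_le_iff₀ (by positivity)]
  have h2 := mul_le_mul_of_nonneg_right h1 (mul_pos p5 p6).le
  rw [← p3] at h2
  have h3 : C * (X ^ (ρ - (ρ + 1) / 2) / y ^ (ρ - (ρ + 1) / 2)) * h y * y * y ^ (ρ - (ρ + 1) / 2) =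
      y * h y * (C * X ^ (ρ - (ρ + 1) / 2)) := by field_simp
  have h4 := mul_le_mul_of_nonneg_right h2 p2.le
  rw [h3] at h4
  refine le_trans (le_of_eq ?_) h4
  calc h X * y ^ ((ρ + 1) / 2) =
      h X * y ^ ((ρ + 1) / 2) * (y ^ (ρ - (ρ + 1) / 2) * y ^ (1 - (ρ + 1) / 2)) := by
        rw [p4, mul_one]
    _ = h X * (y ^ ((ρ + 1) / 2) * y ^ (1 - (ρ + 1) / 2)) * y ^ (ρ - (ρ + 1) / 2) := by ring
    _ = _ := by rw [← p3]

/-- Karamata's Abelian theorem, for the sequence `h k` with finitely many terms removed. -/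
lemma exists_tendsto_powerSum_trunc (hρ : -1 < ρ) : ∃ N : ℕ,
    (∀ᶠ X : ℝ in atTop, Summable fun k => trunc N 0 (fun k => h k) k * Real.exp (-(1 / X)) ^ k) ∧
    Tendsto (fun X : ℝ => powerSum (trunc N 0 fun k => h k) (Real.exp (-(1 / X))) / (X * h X))
      atTop (𝓝 (Real.Gamma (1 + ρ))) := by
  -- Half the gap to `-1`: then `ρ - η > -1`, and `y ^ (ρ - η) exp (-y)` is still integrable at `0`.
  set η := (ρ + 1) / 2 with hη
  have hη0 : 0 < η := by rw [hη]; linarith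
  obtain ⟨C, hC, X₁, hX₁, hpos, hpot⟩ := H.exists_potter hη0
  set N := ⌈max 1 X₁⌉₊ with hN
  set w := trunc N 0 fun k => h k with hw
  -- After the substitution `x = X y`, the series is `X * h X` times the integral of the step
  -- function `F X`. The majorant `B` carries both Potter exponents, for `⌊X y⌋` above and below
  -- `X`; the factor `exp 1` covers rounding, as `⌊X y⌋ / X ≥ y - 1` for `X ≥ 1`.
  set F : ℝ → ℝ → ℝ := fun X y => w ⌊X * y⌋₊ / h X * Real.exp (-(⌊X * y⌋₊ / X)) with hF
  set B : ℝ → ℝ := fun y => C * (2 ^ |ρ + η| * y ^ (ρ + η) + 2 ^ |ρ - η| * y ^ (ρ - η))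
    * (Real.exp 1 * Real.exp (-y)) with hB
  have hBint : Integrable B (volume.restrict (Set.Ioi 0)) := by
    have h1 := integrableOn_rpow_mul_exp (show -1 < ρ + η by linarith)
    have h2 := integrableOn_rpow_mul_exp (show -1 < ρ - η by rw [hη]; linarith)
    refine ((h1.const_mul (C * 2 ^ |ρ + η| * Real.exp 1)).add
      (h2.const_mul (C * 2 ^ |ρ - η| * Real.exp 1))).congr (Eventually.of_forall fun y => ?_)
    simp only [hB, Pi.add_apply]
    ring
  have hmeas : ∀ X, AEStronglyMeasurable (F X) (volume.restrict (Set.Ioi 0)) := by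
    intro X
    have h1 : Measurable fun y : ℝ => ⌊X * y⌋₊ := Nat.measurable_floor.comp (measurable_const_mul X)
    have h2 : Measurable fun k : ℕ => w k / h X * Real.exp (-(k / X)) := measurable_from_top
    exact (h2.comp h1).aestronglyMeasurable
  have hbound : ∀ X ≥ max 1 X₁, ∀ᵐ y ∂(volume.restrict (Set.Ioi (0 : ℝ))), ‖F X y‖ ≤ B y := by
    intro X hX
    refine (ae_restrict_iff' measurableSet_Ioi).2 (Eventually.of_forall fun y hy => ?_)
    have hy0 : 0 < y := hy
    have hX0 : 0 < X := lt_of_lt_of_le one_pos ((le_max_left _ _).trans hX)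
    have hX1 : 1 ≤ X := (le_max_left _ _).trans hX
    have hXX : X₁ ≤ X := (le_max_right _ _).trans hX
    have hB0 : 0 ≤ B y := by
      have := Real.rpow_nonneg hy0.le (ρ + η)
      have := Real.rpow_nonneg hy0.le (ρ - η)
      simp only [hB]
      positivity
    by_cases hk : ⌊X * y⌋₊ < N
    · simp only [hF, hw, trunc, hk, if_true, zero_div, zero_mul, norm_zero]
      exact hB0
    · push Not at hk
      have hkN : max 1 X₁ ≤ (⌊X * y⌋₊ : ℝ) := (Nat.le_ceil _).trans (by exact_mod_cast hk)
      have hk1 : 1 ≤ ⌊X * y⌋₊ := by exact_mod_cast (le_max_left _ _).trans hkN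
      have hkX : X₁ ≤ (⌊X * y⌋₊ : ℝ) := (le_max_right _ _).trans hkN
      have hpX := hpos X hXX
      have hpk := hpos _ hkX
      have e1 := div_rpow_le hX0 hy0 hk1 (ρ + η)
      have e2 := div_rpow_le hX0 hy0 hk1 (ρ - η)
      have n1 : 0 ≤ ((⌊X * y⌋₊ : ℝ) / X) ^ (ρ + η) := by positivity
      have n2 : 0 ≤ ((⌊X * y⌋₊ : ℝ) / X) ^ (ρ - η) := by positivity
      have hle : h ⌊X * y⌋₊ / h X ≤
          C * (2 ^ |ρ + η| * y ^ (ρ + η) + 2 ^ |ρ - η| * y ^ (ρ - η)) := by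
        have h3 : h ⌊X * y⌋₊ ≤ C * (((⌊X * y⌋₊ : ℝ) / X) ^ (ρ + η)
            + ((⌊X * y⌋₊ : ℝ) / X) ^ (ρ - η)) * h X := by
          rcases le_total X (⌊X * y⌋₊ : ℝ) with hc | hc
          · refine (hpot X hXX _ hc).1.trans ?_
            gcongr
            linarith
          · refine (hpot _ hkX X hc).2.trans ?_
            gcongr
            linarith
        rw [div_le_iff₀ hpX]
        refine h3.trans ?_
        gcongr
      have hexp : Real.exp (-(⌊X * y⌋₊ / X)) ≤ Real.exp 1 * Real.exp (-y) := by
        rw [← Real.exp_add]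
        refine Real.exp_le_exp.2 ?_
        have h4 := Nat.lt_floor_add_one (X * y)
        have h5 : y - 1 ≤ ⌊X * y⌋₊ / X := by
          rw [le_div_iff₀ hX0]; nlinarith
        linarith
      simp only [hF, hw, trunc_of_le hk]
      rw [Real.norm_of_nonneg (mul_nonneg (div_nonneg hpk.le hpX.le) (Real.exp_pos _).le)]
      exact mul_le_mul hle hexp (Real.exp_pos _).le ((div_nonneg hpk.le hpX.le).trans hle)
  have hpt : ∀ y, 0 < y → Tendsto (fun X => F X y) atTop (𝓝 (y ^ ρ * Real.exp (-y))) := by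
    intro y hy
    have hXy : Tendsto (fun X : ℝ => X * y) atTop atTop := tendsto_id.atTop_mul_const hy
    have t1 : Tendsto (fun X : ℝ => h ⌊X * y⌋₊ / h (X * y)) atTop (𝓝 1) :=
      H.tendsto_floor_div_self.comp hXy
    have t2 : Tendsto (fun X : ℝ => h (X * y) / h X) atTop (𝓝 (y ^ ρ)) := by
      simpa only [mul_comm y] using H.tendsto y hy
    have t3 : Tendsto (fun X : ℝ => (⌊X * y⌋₊ : ℝ) / X) atTop (𝓝 y) := by
      simpa only [mul_comm y] using tendsto_nat_floor_mul_div_atTop hy.le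
    have t4 : Tendsto (fun X : ℝ => Real.exp (-(⌊X * y⌋₊ / X))) atTop (𝓝 (Real.exp (-y))) :=
      (Real.continuous_exp.tendsto _).comp t3.neg
    have t5 := (t1.mul t2).mul t4
    rw [one_mul] at t5
    refine t5.congr' ?_
    filter_upwards [(tendsto_nat_floor_atTop.comp hXy).eventually_ge_atTop N,
      hXy.eventually H.pos] with X hX hpX
    have hX' : N ≤ ⌊X * y⌋₊ := hX
    simp only [hF, hw, trunc_of_le hX']
    congr 1
    field_simp
  have hDCT := tendsto_integral_filter_of_dominated_convergence (μ := volume.restrict (Set.Ioi 0))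
    (l := atTop) (F := F) (f := fun y => y ^ ρ * Real.exp (-y)) B (Eventually.of_forall hmeas)
    ((eventually_ge_atTop (max 1 X₁)).mono hbound) hBint
    ((ae_restrict_iff' measurableSet_Ioi).2 (Eventually.of_forall fun y hy => hpt y hy))
  have hGamma : ∫ y in Set.Ioi (0 : ℝ), y ^ ρ * Real.exp (-y) = Real.Gamma (1 + ρ) := by
    rw [Real.Gamma_eq_integral (by linarith)]
    refine setIntegral_congr_fun measurableSet_Ioi fun y _ => ?_
    rw [mul_comm, add_sub_cancel_left]
  rw [hGamma] at hDCT
  have hsum : ∀ X ≥ max 1 X₁, HasSum (fun k => w k * Real.exp (-(1 / X)) ^ k)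
      (X * h X * ∫ y in Set.Ioi (0 : ℝ), F X y) := by
    intro X hX
    have hX0 : 0 < X := lt_of_lt_of_le one_pos ((le_max_left _ _).trans hX)
    have hpX := hpos X ((le_max_right _ _).trans hX)
    set G : ℕ → ℝ := fun k => w k * Real.exp (-(1 / X)) ^ k with hG
    have hGF : ∀ y, F X y = (h X)⁻¹ * G ⌊X * y⌋₊ := by
      intro y
      simp only [hF, hG, exp_neg_one_div_pow]
      ring
    have hFi : IntegrableOn (F X) (Set.Ioi 0) := Integrable.mono' hBint (hmeas X) (hbound X hX)
    have hGi : IntegrableOn (fun y : ℝ => G ⌊X * y⌋₊) (Set.Ioi 0) := by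
      refine (hFi.const_mul (h X)).congr (Eventually.of_forall fun y => ?_)
      simp only
      rw [hGF, mul_inv_cancel_left₀ hpX.ne']
    have hGi' : IntegrableOn (fun x : ℝ => G ⌊x⌋₊) (Set.Ioi 0) := by
      have := (integrableOn_Ioi_comp_mul_left_iff (fun x : ℝ => G ⌊x⌋₊) 0 hX0).1 hGi
      rwa [mul_zero] at this
    have hval : X * h X * ∫ y in Set.Ioi (0 : ℝ), F X y = ∫ x in Set.Ioi (0 : ℝ), G ⌊x⌋₊ := by
      simp only [hGF]
      rw [integral_const_mul, integral_comp_mul_left_Ioi (fun x : ℝ => G ⌊x⌋₊) 0 hX0, mul_zero,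
        smul_eq_mul]
      field_simp
    rw [hval]
    exact hasSum_integral_floor hGi'
  refine ⟨N, (eventually_ge_atTop (max 1 X₁)).mono fun X hX => (hsum X hX).summable, ?_⟩
  refine hDCT.congr' ?_
  filter_upwards [eventually_ge_atTop (max 1 X₁)] with X hX
  have hX0 : 0 < X := lt_of_lt_of_le one_pos ((le_max_left _ _).trans hX)
  have hpX := hpos X ((le_max_right _ _).trans hX)
  rw [powerSum, (hsum X hX).tsum_eq, mul_div_cancel_left₀ _ (by positivity)]

end RegVar

lemma tendsto_exp_neg_one_div : Tendsto (fun X : ℝ => Real.exp (-(1 / X))) atTop (𝓝[<] 1) := by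
  refine tendsto_nhdsWithin_iff.2 ⟨?_, ?_⟩
  · have h : Tendsto (fun X : ℝ => -(1 / X)) atTop (𝓝 0) := by
      simpa using (tendsto_inv_atTop_zero (𝕜 := ℝ)).neg
    have h2 := (Real.continuous_exp.tendsto 0).comp h
    rwa [Real.exp_zero] at h2
  · filter_upwards [eventually_gt_atTop 0] with X hX
    have : 0 < 1 / X := by positivity
    have h1 : Real.exp (-(1 / X)) < Real.exp 0 := Real.exp_lt_exp.2 (by linarith)
    rwa [Real.exp_zero] at h1

lemma tendsto_neg_one_div_log : Tendsto (fun x : ℝ => -1 / Real.log x) (𝓝[<] 1) atTop := by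
  have h1 : Tendsto (fun x : ℝ => -Real.log x) (𝓝[<] 1) (𝓝[>] 0) := by
    refine tendsto_nhdsWithin_iff.2 ⟨?_, ?_⟩
    · have := (Real.continuousAt_log one_ne_zero).neg.tendsto
      simp only [Pi.neg_apply, Real.log_one, neg_zero] at this
      exact this.mono_left nhdsWithin_le_nhds
    · filter_upwards [Ioo_mem_nhdsLT (show (0 : ℝ) < 1 by norm_num)] with x hx
      have := Real.log_neg hx.1 hx.2
      change 0 < -Real.log x
      linarith
  refine (tendsto_inv_nhdsGT_zero.comp h1).congr fun x => ?_
  simp only [Function.comp_apply]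
  rw [neg_div, ← div_neg, one_div]

lemma exp_neg_one_div_neg_one_div_log {x : ℝ} (h0 : 0 < x) :
    Real.exp (-(1 / (-1 / Real.log x))) = x := by
  rw [one_div_div, div_neg, div_one, neg_neg, Real.exp_log h0]

/-- Limits at `1` from the left, in the variable `exp (-1/X)`. -/
lemma tendsto_nhdsLT_one_iff {α : Type*} {f : ℝ → α} {F : Filter α} :
    Tendsto f (𝓝[<] 1) F ↔ Tendsto (fun X : ℝ => f (Real.exp (-(1 / X)))) atTop F := by
  refine ⟨fun h => h.comp tendsto_exp_neg_one_div, fun h => ?_⟩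
  refine (h.comp tendsto_neg_one_div_log).congr' ?_
  filter_upwards [Ioo_mem_nhdsLT (show (0 : ℝ) < 1 by norm_num)] with x hx
  simp only [Function.comp_apply]
  rw [exp_neg_one_div_neg_one_div_log hx.1]

lemma eventually_nhdsLT_one {P : ℝ → Prop} (h : ∀ᶠ X : ℝ in atTop, P (Real.exp (-(1 / X)))) :
    ∀ᶠ x in 𝓝[<] 1, P x := by
  filter_upwards [tendsto_neg_one_div_log.eventually h,
    Ioo_mem_nhdsLT (show (0 : ℝ) < 1 by norm_num)] with x h1 hx
  rwa [exp_neg_one_div_neg_one_div_log hx.1] at h1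

lemma summable_of_eventually_exp {c : ℕ → ℝ}
    (h : ∀ᶠ X : ℝ in atTop, Summable fun k => c k * Real.exp (-(1 / X)) ^ k) {x : ℝ} (h0 : 0 ≤ x)
    (h1 : x < 1) : Summable fun k => c k * x ^ k := by
  have hlt : ∀ᶠ X : ℝ in atTop, x < Real.exp (-(1 / X)) :=
    (tendsto_nhdsWithin_iff.1 tendsto_exp_neg_one_div).1.eventually (lt_mem_nhds h1)
  obtain ⟨X, hX, hxX⟩ := (h.and hlt).exists
  refine Summable.of_norm_bounded hX.norm fun k => ?_
  rw [norm_mul, norm_mul, norm_pow, norm_pow, Real.norm_of_nonneg h0,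
    Real.norm_of_nonneg (Real.exp_pos _).le]
  exact mul_le_mul_of_nonneg_left (pow_le_pow_left₀ h0 hxX.le k) (norm_nonneg _)

/-- Karamata's Abelian theorem: `∑ h(k) e^{-k/X} ∼ Γ(1 + ρ) X h(X)` for `h` regularly varying of
index `ρ > -1`. -/
lemma RegVar.tendsto_powerSum {h : ℝ → ℝ} {ρ : ℝ} (H : RegVar h ρ) (hρ : -1 < ρ) :
    (∀ x, 0 ≤ x → x < 1 → Summable fun k : ℕ => h k * x ^ k) ∧
    Tendsto (fun X : ℝ => powerSum (fun k => h k) (Real.exp (-(1 / X))) / (X * h X)) atTop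
      (𝓝 (Real.Gamma (1 + ρ))) := by
  obtain ⟨N, hN1, hN2⟩ := H.exists_tendsto_powerSum_trunc hρ
  have heq := (trunc_eventuallyEq N 0 (fun k : ℕ => h k)).symm
  have hs' : ∀ x, 0 ≤ x → x < 1 → Summable fun k => trunc N 0 (fun k : ℕ => h k) k * x ^ k :=
    fun x h0 h1 => summable_of_eventually_exp hN1 h0 h1
  refine ⟨fun x h0 h1 => summable_congr_eventually heq (hs' x h0 h1), ?_⟩
  obtain ⟨L, hL⟩ := exists_tendsto_powerSum_sub heq hs'
  refine tendsto_div_of_sub (H.tendsto_mul_self hρ) hN2 (tendsto_nhdsLT_one_iff.1 hL) (M := 0) ?_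
  simp

/-- Comparison with the harmonic series. -/
lemma tendsto_cumSum_atTop_of_mul {g : ℕ → ℝ} (h : Tendsto (fun n : ℕ => n * g n) atTop atTop) :
    Tendsto (cumSum g) atTop atTop := by
  have hev : ∀ᶠ n in atTop, 0 ≤ g n - 1 / ((n : ℝ) + 1) := by
    filter_upwards [h.eventually_ge_atTop 1, eventually_gt_atTop 0] with n hn hn0
    have hn0' : (0 : ℝ) < n := by exact_mod_cast hn0
    have h1 : 1 / ((n : ℝ) + 1) ≤ 1 / n := one_div_le_one_div_of_le hn0' (by linarith)
    have h2 : 1 / (n : ℝ) ≤ g n := by rw [div_le_iff₀ hn0']; linarith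
    linarith
  obtain ⟨N, hN⟩ := eventually_atTop.1 hev
  have hharm : Tendsto (cumSum fun n => 1 / ((n : ℝ) + 1)) atTop atTop :=
    Real.tendsto_sum_range_one_div_nat_succ_atTop.comp (tendsto_add_atTop_nat 1)
  refine tendsto_atTop_mono' _ ?_ (tendsto_atTop_add_const_right _
    (cumSum (fun n => g n - 1 / ((n : ℝ) + 1)) N) hharm)
  filter_upwards [eventually_ge_atTop N] with n hn
  have h1 : cumSum g n = cumSum (fun n => 1 / ((n : ℝ) + 1)) n
      + cumSum (fun n => g n - 1 / ((n : ℝ) + 1)) n := by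
    simp only [cumSum, ← Finset.sum_add_distrib]
    exact Finset.sum_congr rfl fun k _ => by ring
  have h2 := cumSum_sub_cumSum (fun n => g n - 1 / ((n : ℝ) + 1)) hn
  have h3 : 0 ≤ ∑ k ∈ Finset.Ioc N n, (g k - 1 / ((k : ℝ) + 1)) :=
    Finset.sum_nonneg fun k hk => hN k (Finset.mem_Ioc.1 hk).1.le
  linarith

lemma RegVar.ratioNearOne {h : ℝ → ℝ} {ρ : ℝ} (H : RegVar h ρ) :
    RatioNearOne fun n : ℕ => h n := by
  intro ε hε
  obtain ⟨δ, hδ, X, -, hX⟩ := H.near_one ε hε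
  exact ⟨δ, hδ, ⌈X⌉₊, fun n hn m hnm hm =>
    hX n ((Nat.le_ceil X).trans (by exact_mod_cast hn)) m (by exact_mod_cast hnm) hm⟩

/-! ### Removing the averaging under slow decrease -/

/-- A slowly decreasing sequence whose means relative to weights `g` converge is itself asymptotic
to a multiple of `g`. -/
lemma tendsto_div_of_slowDecrease {g U : ℕ → ℝ} {c C : ℝ} (hg : ∀ n, 0 < g n)
    (hr : RatioNearOne g) (hC : 0 < C) (hG : ∀ᶠ n : ℕ in atTop, cumSum g n ≤ C * (n * g n))
    (hc : 0 ≤ c) (hmean : Tendsto (fun n => cumSum U n / cumSum g n) atTop (𝓝 c))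
    (hslow : ∀ ε > 0, ∃ δ > 0, ∀ᶠ n : ℕ in atTop, ∀ m : ℕ, n ≤ m → (m : ℝ) ≤ (1 + δ) * n →
      U n - ε * g n ≤ U m) :
    Tendsto (fun n => U n / g n) atTop (𝓝 c) := by
  have hpos := cumSum_pos hg
  rw [Metric.tendsto_nhds]
  intro κ hκ
  obtain ⟨ε, hε, hε1, hεκ⟩ : ∃ ε > 0, ε ≤ 1 / 2 ∧ (c + 3) * ε < κ := by
    refine ⟨min (1 / 2) (κ / (2 * (c + 3))), by positivity, min_le_left _ _, ?_⟩
    calc (c + 3) * min (1 / 2) (κ / (2 * (c + 3))) ≤ (c + 3) * (κ / (2 * (c + 3))) := by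
          gcongr; exact min_le_right _ _
      _ = κ / 2 := by field_simp
      _ < κ := half_lt_self hκ
  obtain ⟨δ₁, hδ₁, hs⟩ := hslow ε hε
  obtain ⟨δ₂, hδ₂, N₂, hN₂⟩ := hr ε hε
  obtain ⟨N₁, hN₁⟩ := eventually_atTop.1 hs
  obtain ⟨δ, hδ, hδδ₁, hδδ₂, hδ1⟩ : ∃ δ > 0, δ ≤ δ₁ ∧ δ ≤ δ₂ ∧ δ ≤ 1 :=
    ⟨min δ₁ (min δ₂ 1), by positivity, min_le_left _ _, (min_le_right _ _).trans (min_le_left _ _),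
      (min_le_right _ _).trans (min_le_right _ _)⟩
  have hsl : ∀ n ≥ N₁, ∀ m : ℕ, n ≤ m → (m : ℝ) ≤ (1 + δ) * n → U n - ε * g n ≤ U m :=
    fun n hn m hnm hm => hN₁ n hn m hnm (hm.trans (by gcongr))
  have hrt : ∀ n ≥ N₂, ∀ m : ℕ, n ≤ m → (m : ℝ) ≤ (1 + δ) * n →
      g m ≤ (1 + ε) * g n ∧ (1 - ε) * g n ≤ g m := by
    intro n hn m hnm hm
    have h1 := abs_le.1 (hN₂ n hn m hnm (hm.trans (by gcongr)))
    exact ⟨(div_le_iff₀ (hg n)).1 (by linarith), (le_div_iff₀ (hg n)).1 (by linarith)⟩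
  -- The two partial sums of `g` at the ends of a block add up to at most `5 C n g n`, and `5 C η =
  -- ε δ / 2` matches the block length, at least `δ n / 2` after rounding. The lower block is only
  -- known to have length `δ n / 4`, but there the sums are at most `2 C n g n`.
  set η := ε * δ / (10 * C) with hη
  have hη0 : 0 < η := by positivity
  obtain ⟨N₃, hN₃⟩ := eventually_atTop.1 (Metric.tendsto_nhds.1 hmean η hη0)
  have hσ : ∀ n ≥ N₃, |cumSum U n - c * cumSum g n| ≤ η * cumSum g n := by
    intro n hn
    have h1 := (hN₃ n hn).le
    rw [Real.dist_eq, div_sub' (hpos n).ne', abs_div, abs_of_pos (hpos n),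
      div_le_iff₀ (hpos n)] at h1
    rwa [mul_comm c]
  obtain ⟨N₄, hN₄⟩ := eventually_atTop.1 hG
  set N := max (max N₁ N₂) (max N₃ N₄) with hNdef
  have hNN : ∀ n ≥ N, N₁ ≤ n ∧ N₂ ≤ n ∧ N₃ ≤ n ∧ N₄ ≤ n := fun n hn =>
    ⟨((le_max_left _ _).trans (le_max_left _ _)).trans hn,
      ((le_max_right _ _).trans (le_max_left _ _)).trans hn,
      ((le_max_left _ _).trans (le_max_right _ _)).trans hn,
      ((le_max_right _ _).trans (le_max_right _ _)).trans hn⟩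
  filter_upwards [eventually_ge_atTop (2 * N), eventually_ge_atTop ⌈4 / δ⌉₊,
    eventually_ge_atTop 1] with n hn2 hnδ hn1
  have hn0 : (0 : ℝ) < n := by exact_mod_cast hn1
  have hnN : N ≤ n := by omega
  obtain ⟨a1, a2, a3, a4⟩ := hNN n hnN
  have hδn : 4 ≤ δ * n := by
    have : 4 / δ ≤ n := (Nat.le_ceil _).trans (by exact_mod_cast hnδ)
    rw [div_le_iff₀ hδ] at this
    linarith
  have hgn := hg n
  have hGn := hN₄ n a4
  -- On the block to the right of `n`, slow decrease keeps `U` above `U n - ε g n`, while the block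
  -- sum of `U` is close to `c` times that of `g`. The lower bound uses the block to the left of
  -- `n`.
  have upper : U n ≤ (c + (c + 2) * ε) * g n := by
    set m := ⌊(1 + δ) * (n : ℝ)⌋₊ with hm
    have hm1 : (m : ℝ) ≤ (1 + δ) * n := Nat.floor_le (by positivity)
    have hm2 : (1 + δ) * (n : ℝ) < m + 1 := Nat.lt_floor_add_one _
    have hnm : n ≤ m := Nat.le_floor (by nlinarith)
    have hmn : δ * n / 2 ≤ (m : ℝ) - n := by linarith
    obtain ⟨b1, b2, b3, b4⟩ := hNN m (hnN.trans hnm)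
    have hcard : ((Finset.Ioc n m).card : ℝ) = m - n := by
      rw [Nat.card_Ioc, Nat.cast_sub hnm]
    have e1 : (m - n) * (U n - ε * g n) ≤ cumSum U m - cumSum U n := by
      rw [cumSum_sub_cumSum U hnm, ← hcard, ← nsmul_eq_mul]
      refine Finset.card_nsmul_le_sum _ _ _ fun k hk => ?_
      rw [Finset.mem_Ioc] at hk
      exact hsl n a1 k hk.1.le (le_trans (by exact_mod_cast hk.2) hm1)
    have e2 : cumSum g m - cumSum g n ≤ (m - n) * ((1 + ε) * g n) := by
      rw [cumSum_sub_cumSum g hnm, ← hcard, ← nsmul_eq_mul]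
      refine Finset.sum_le_card_nsmul _ _ _ fun k hk => ?_
      rw [Finset.mem_Ioc] at hk
      exact (hrt n a2 k hk.1.le (le_trans (by exact_mod_cast hk.2) hm1)).1
    have e3 := (abs_le.1 (hσ m b3)).2
    have e4 := (abs_le.1 (hσ n a3)).1
    have e5 : cumSum g m + cumSum g n ≤ 5 * C * n * g n := by
      have h1 := hN₄ m b4
      have h2 := (hrt n a2 m hnm hm1).1
      have h3 : (m : ℝ) ≤ 2 * n := hm1.trans (by gcongr; linarith)
      have h4 : (m : ℝ) * g m ≤ (2 * n) * ((3 / 2) * g n) :=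
        mul_le_mul h3 (h2.trans (by gcongr; linarith)) (hg m).le (by positivity)
      have h5 := mul_le_mul_of_nonneg_left h4 hC.le
      have h6 : 0 < C * (n * g n) := by positivity
      linarith
    have e6 : η * (cumSum g m + cumSum g n) ≤ ε * g n * (m - n) := by
      calc η * (cumSum g m + cumSum g n) ≤ η * (5 * C * n * g n) := by gcongr
        _ = ε * g n * (δ * n / 2) := by rw [hη]; field_simp; ring
        _ ≤ _ := by gcongr
    have e7 := mul_le_mul_of_nonneg_left e2 hc
    have hmn0 : 0 < (m : ℝ) - n := by linarith
    have e8 : (m - n) * U n ≤ (m - n) * ((c + (c + 2) * ε) * g n) := by linarith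
    exact le_of_mul_le_mul_left e8 hmn0
  have lower : (c - (c + 3) * ε) * g n ≤ U n := by
    set i := ⌈(n : ℝ) / (1 + δ)⌉₊ with hi
    have hi1 : (n : ℝ) / (1 + δ) ≤ i := Nat.le_ceil _
    have hi2 : (i : ℝ) < n / (1 + δ) + 1 := Nat.ceil_lt_add_one (by positivity)
    have hin : i ≤ n := by
      refine Nat.ceil_le.2 ?_
      rw [div_le_iff₀ (by positivity)]
      nlinarith
    have hni : ∀ k : ℕ, i ≤ k → (n : ℝ) ≤ (1 + δ) * k := by
      intro k hk
      have h1 : (n : ℝ) / (1 + δ) ≤ k := hi1.trans (by exact_mod_cast hk)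
      rw [div_le_iff₀ (by positivity)] at h1
      linarith
    have hiN : N ≤ i := by
      have h1 := hni i le_rfl
      have h2 : (2 * N : ℝ) ≤ n := by exact_mod_cast hn2
      have h3 : (1 + δ) * (i : ℝ) ≤ 2 * i := by gcongr; linarith
      have h4 : (N : ℝ) ≤ i := by linarith
      exact_mod_cast h4
    have hmn : δ * n / 4 ≤ (n : ℝ) - i := by
      have h1 : (n : ℝ) / (1 + δ) ≤ n - n * δ / 2 := by
        rw [div_le_iff₀ (by positivity)]
        nlinarith [mul_nonneg (mul_nonneg hn0.le hδ.le) (sub_nonneg.2 hδ1)]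
      linarith
    obtain ⟨b1, b2, b3, b4⟩ := hNN i hiN
    have hcard : ((Finset.Ioc i n).card : ℝ) = n - i := by
      rw [Nat.card_Ioc, Nat.cast_sub hin]
    have hgk : ∀ k, i ≤ k → k ≤ n → g k ≤ 2 * g n ∧ (1 - ε) * g n ≤ g k := by
      intro k hk hkn
      obtain ⟨h1, h2⟩ := hrt k (b2.trans hk) n hkn (hni k hk)
      have hk0 := hg k
      constructor
      · nlinarith
      · have h3 : (1 - ε) * g n ≤ (1 - ε) * ((1 + ε) * g k) :=
          mul_le_mul_of_nonneg_left h1 (by linarith)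
        nlinarith [mul_nonneg (sq_nonneg ε) hk0.le]
    have e1 : cumSum U n - cumSum U i ≤ (n - i) * (U n + ε * (2 * g n)) := by
      rw [cumSum_sub_cumSum U hin, ← hcard, ← nsmul_eq_mul]
      refine Finset.sum_le_card_nsmul _ _ _ fun k hk => ?_
      rw [Finset.mem_Ioc] at hk
      have h1 := hsl k (b1.trans hk.1.le) n hk.2 (hni k hk.1.le)
      have h2 := mul_le_mul_of_nonneg_left (hgk k hk.1.le hk.2).1 hε.le
      linarith
    have e2 : (n - i) * ((1 - ε) * g n) ≤ cumSum g n - cumSum g i := by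
      rw [cumSum_sub_cumSum g hin, ← hcard, ← nsmul_eq_mul]
      refine Finset.card_nsmul_le_sum _ _ _ fun k hk => ?_
      rw [Finset.mem_Ioc] at hk
      exact (hgk k hk.1.le hk.2).2
    have e3 := (abs_le.1 (hσ n a3)).1
    have e4 := (abs_le.1 (hσ i b3)).2
    have e5 : cumSum g n + cumSum g i ≤ 2 * C * n * g n := by
      have h1 := cumSum_mono (fun k => (hg k).le) hin
      linarith
    have e6 : η * (cumSum g n + cumSum g i) ≤ ε * g n * (n - i) := by
      calc η * (cumSum g n + cumSum g i) ≤ η * (2 * C * n * g n) := by gcongr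
        _ = ε * g n * (δ * n / 5) := by rw [hη]; field_simp; ring
        _ ≤ ε * g n * (δ * n / 4) := by
            refine mul_le_mul_of_nonneg_left ?_ (by positivity)
            linarith
        _ ≤ _ := by gcongr
    have e7 := mul_le_mul_of_nonneg_left e2 hc
    have hmn0 : 0 < (n : ℝ) - i := by linarith
    have e8 : (n - i) * ((c - (c + 3) * ε) * g n) ≤ (n - i) * U n := by linarith
    exact le_of_mul_le_mul_left e8 hmn0
  rw [Real.dist_eq, abs_lt]
  constructor
  · have := (le_div_iff₀ hgn).2 lower
    linarith
  · have := (div_le_iff₀ hgn).2 upper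
    linarith

/-! ### The denominator of (iii) as a regularly varying function -/

section
variable {v : ℕ → ℝ} {ρ : ℝ} {ℓ : ℝ → ℝ}
  (hsv : ∀ x, 0 ≤ x → x < 1 → Summable fun n => v n * x ^ n)
  (hℓ : SlowlyVarying ℓ)
  (hD : Tendsto (fun x : ℝ => powerSum v x * (-Real.log x) ^ ρ / ℓ (-1 / Real.log x))
    (𝓝[<] 1) (𝓝 1))
include hsv hℓ hD

omit hsv hℓ in
lemma tendsto_powerSum_div_rpow_mul :
    Tendsto (fun X : ℝ => powerSum v (Real.exp (-(1 / X))) / (X ^ ρ * ℓ X)) atTop (𝓝 1) := by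
  refine (tendsto_nhdsLT_one_iff.1 hD).congr' ?_
  filter_upwards [eventually_gt_atTop 0] with X hX
  rw [Real.log_exp, neg_neg, neg_div_neg_eq, one_div_one_div, one_div, Real.inv_rpow hX.le,
    ← div_eq_mul_inv, div_div]

omit hsv hD in
lemma eventually_pos_rpow_mul : ∀ᶠ X : ℝ in atTop, 0 < X ^ ρ * ℓ X := by
  obtain ⟨⟨A, hA, -⟩, -⟩ := hℓ
  filter_upwards [eventually_gt_atTop 0, eventually_ge_atTop A] with X h1 h2
  exact mul_pos (Real.rpow_pos_of_pos h1 _) (hA X h2)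

/-- The denominator of the power series method is regularly varying in the variable `exp (-1/X)`. -/
lemma regVar_powerSum : RegVar (fun X => powerSum v (Real.exp (-(1 / X)))) ρ := by
  have hT := tendsto_powerSum_div_rpow_mul hD
  have hg := eventually_pos_rpow_mul (ρ := ρ) hℓ
  have hpos : ∀ᶠ X in atTop, 0 < powerSum v (Real.exp (-(1 / X))) := by
    filter_upwards [hT.eventually (lt_mem_nhds one_pos), hg] with X h1 h2
    exact (div_pos_iff_of_pos_right h2).1 h1
  have htend : ∀ c : ℝ, 0 < c → Tendsto (fun X : ℝ => powerSum v (Real.exp (-(1 / (c * X)))) /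
      powerSum v (Real.exp (-(1 / X)))) atTop (𝓝 (c ^ ρ)) := by
    intro c hc
    have hcX : Tendsto (fun X : ℝ => c * X) atTop atTop := tendsto_id.const_mul_atTop hc
    have h1 := ((hT.comp hcX).mul ((hℓ.2 c hc).const_mul (c ^ ρ))).mul (hT.inv₀ one_ne_zero)
    rw [one_mul, mul_one, inv_one, mul_one] at h1
    refine h1.congr' ?_
    filter_upwards [hg, hcX.eventually hg, eventually_gt_atTop 0, hpos] with X a1 a2 a3 a4
    simp only [Function.comp_apply]
    rw [Real.mul_rpow hc.le a3.le] at a2 ⊢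
    have hXρ := Real.rpow_pos_of_pos a3 ρ
    have hcρ := Real.rpow_pos_of_pos hc ρ
    have b1 : ℓ X ≠ 0 := by rintro h0; simp [h0] at a1
    have b2 : ℓ (c * X) ≠ 0 := by rintro h0; simp [h0] at a2
    field_simp
  refine ⟨hpos, htend, fun ε hε => ?_⟩
  -- Continuity of `X ↦ D(exp (-1/X))` gives the local uniformity through the Baire argument.
  refine exists_forall_abs_div_sub_one_le (ρ := ρ) (fun x hx => ?_) hpos
    (fun c hc => (htend c hc).comp tendsto_natCast_atTop_atTop) hε
  refine ContinuousAt.continuousWithinAt ?_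
  have h1 : Real.exp (-(1 / x)) < 1 := by
    have : Real.exp (-(1 / x)) < Real.exp 0 := Real.exp_lt_exp.2 (by simpa using hx)
    rwa [Real.exp_zero] at this
  obtain ⟨b, hb1, hb2⟩ := exists_between h1
  have h2 : ContinuousAt (powerSum v) (Real.exp (-(1 / x))) :=
    (continuousOn_powerSum hsv hb2).continuousAt (Icc_mem_nhds (Real.exp_pos _) hb1)
  have h3 : ContinuousAt (fun x : ℝ => Real.exp (-(1 / x))) x :=
    Real.continuous_exp.continuousAt.comp (continuousAt_const.div continuousAt_id hx.ne').neg
  exact ContinuousAt.comp (f := fun x : ℝ => Real.exp (-(1 / x))) h2 h3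

end

lemma tendsto_mul_one_sub_exp :
    Tendsto (fun X : ℝ => X * (1 - Real.exp (-(1 / X)))) atTop (𝓝 1) := by
  have h1 : Tendsto (fun X : ℝ => (1 + 1 / X)⁻¹) atTop (𝓝 1) := by
    have : Tendsto (fun X : ℝ => 1 + 1 / X) atTop (𝓝 (1 + 0)) := by
      simpa using (tendsto_inv_atTop_zero (𝕜 := ℝ)).const_add 1
    simpa using this.inv₀ (by norm_num)
  refine tendsto_of_tendsto_of_tendsto_of_le_of_le' h1 tendsto_const_nhds ?_ ?_
  · filter_upwards [eventually_gt_atTop 0] with X hX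
    have h2 := Real.add_one_le_exp (1 / X)
    have h3 : Real.exp (-(1 / X)) ≤ (1 / X + 1)⁻¹ := by
      rw [Real.exp_neg]
      exact inv_anti₀ (by positivity) h2
    have h4 : (1 + 1 / X)⁻¹ = X * (1 - (1 / X + 1)⁻¹) := by
      field_simp
      ring
    rw [h4]
    gcongr
  · filter_upwards [eventually_gt_atTop 0] with X hX
    have h2 := Real.add_one_le_exp (-(1 / X))
    have h3 : X * (1 - Real.exp (-(1 / X))) ≤ X * (1 / X) := by gcongr; linarith
    rwa [mul_one_div_cancel hX.ne'] at h3

/-! ### Both halves of Karamata's theorem for (iii) -/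

section
variable {a v : ℕ → ℝ} {ρ c : ℝ} (hρ : -1 < ρ)
  (H : RegVar (fun X => powerSum v (Real.exp (-(1 / X)))) ρ)
include hρ H

/-- At `x = exp (-1/X)` the factor `1 - x` is asymptotic to `1 / X`, which cancels the `X` in `Γ(1 +
ρ) X g(X)`, and `g(X) = D(x)`. This makes `g` the right weight for the partial sums `A`. -/
lemma tendsto_one_sub_mul_powerSum_div :
    Tendsto (fun x => (1 - x) * powerSum (fun n : ℕ => powerSum v (Real.exp (-(1 / (n : ℝ))))) x
      / powerSum v x) (𝓝[<] 1) (𝓝 (Real.Gamma (1 + ρ))) := by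
  rw [tendsto_nhdsLT_one_iff]
  have h1 := tendsto_mul_one_sub_exp.mul (H.tendsto_powerSum hρ).2
  rw [one_mul] at h1
  refine h1.congr' ?_
  filter_upwards [eventually_gt_atTop 0, H.pos] with X hX hp
  field_simp

lemma tendsto_powerSum_weights_atTop :
    Tendsto (powerSum fun n : ℕ => powerSum v (Real.exp (-(1 / (n : ℝ))))) (𝓝[<] 1) atTop := by
  rw [tendsto_nhdsLT_one_iff]
  refine ((H.tendsto_powerSum hρ).2.pos_mul_atTop (Real.Gamma_pos_of_pos (by linarith))
    (H.tendsto_mul_self hρ)).congr' ?_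
  filter_upwards [eventually_gt_atTop 0, H.pos] with X hX hp
  field_simp

/-- The Abelian half of Karamata's theorem. -/
lemma tendsto_powerSum_div_of_tendsto_cumSum_div
    (h : Tendsto (fun n : ℕ => cumSum a n / powerSum v (Real.exp (-(1 / (n : ℝ))))) atTop (𝓝 c)) :
    (∀ x, 0 ≤ x → x < 1 → Summable fun n => a n * x ^ n) ∧
      Tendsto (fun x => powerSum a x / powerSum v x) (𝓝[<] 1) (𝓝 (c * Real.Gamma (1 + ρ))) := by
  have hΩ := tendsto_powerSum_weights_atTop hρ H
  have hgpos : ∀ᶠ n : ℕ in atTop, 0 < powerSum v (Real.exp (-(1 / (n : ℝ)))) :=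
    tendsto_natCast_atTop_atTop.eventually H.pos
  obtain ⟨h1, h2⟩ := tendsto_powerSum_div one_pos hgpos
    (H.tendsto_powerSum hρ).1 hΩ h
  have hsa : ∀ x, 0 ≤ x → x < 1 → Summable fun n => a n * x ^ n :=
    fun x h0 hx => summable_of_cumSum (h1 x h0 hx)
  refine ⟨hsa, (h2.mul (tendsto_one_sub_mul_powerSum_div hρ H)).congr' ?_⟩
  filter_upwards [eventually_mem_Ico_left one_pos, hΩ.eventually_gt_atTop 0] with x hx hp
  rw [(summable_cumSum hx.1 hx.2 (hsa x hx.1 hx.2)).2, mul_div_assoc' _ _ (powerSum v x)]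
  congr 1
  field_simp

/-- A partial sum up to `n` is at most `e` times the power series at `exp (-1/n)`, which the Abelian
theorem evaluates as about `Γ(1 + ρ) n g(n)`. -/
lemma eventually_cumSum_trunc_le (N : ℕ)
    (hN : ∀ n ≥ N, 0 < powerSum v (Real.exp (-(1 / (n : ℝ))))) :
    ∃ C > 0, ∀ᶠ n : ℕ in atTop,
      cumSum (trunc N 1 fun n : ℕ => powerSum v (Real.exp (-(1 / (n : ℝ))))) n ≤
      C * (n * trunc N 1 (fun n : ℕ => powerSum v (Real.exp (-(1 / (n : ℝ))))) n) := by
  obtain ⟨hs, hlim⟩ := H.tendsto_powerSum hρ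
  set g : ℕ → ℝ := fun n => powerSum v (Real.exp (-(1 / (n : ℝ)))) with hg
  have heq := trunc_eventuallyEq N 1 g
  obtain ⟨L, hL⟩ := exists_tendsto_powerSum_sub heq hs
  have hlim' := tendsto_div_of_sub (H.tendsto_mul_self hρ) hlim (tendsto_nhdsLT_one_iff.1 hL)
    (g' := fun X : ℝ => X * powerSum v (Real.exp (-(1 / X)))) (M := 0) (by simp)
  have hev := (hlim'.comp tendsto_natCast_atTop_atTop).eventually
    (ge_mem_nhds (lt_add_one (Real.Gamma (1 + ρ))))
  have hΓ := Real.Gamma_pos_of_pos (show 0 < 1 + ρ by linarith)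
  refine ⟨Real.exp 1 * (Real.Gamma (1 + ρ) + 1), by positivity, ?_⟩
  filter_upwards [hev, eventually_ge_atTop N, eventually_ge_atTop 1] with n h1 hn hn1
  have hn0 : (0 : ℝ) < n := by exact_mod_cast hn1
  have hp := hN n hn
  refine (cumSum_le_exp_one_mul_powerSum (trunc_one_pos hN)
    (fun x h0 hx => summable_congr_eventually heq (hs x h0 hx)) hn1).trans ?_
  simp only [Function.comp_apply] at h1
  rw [div_le_iff₀ (by positivity)] at h1
  rw [mul_assoc, trunc_of_le hn]
  exact mul_le_mul_of_nonneg_left h1 (Real.exp_pos 1).le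

/-- The Tauberian half of Karamata's theorem, under slow decrease. -/
lemma tendsto_cumSum_div_of_slowDecrease (hU : ∀ n, 0 ≤ cumSum a n) (hc : 0 ≤ c)
    (hsa : ∀ x, 0 ≤ x → x < 1 → Summable fun n => a n * x ^ n)
    (h : Tendsto (fun x => powerSum a x / powerSum v x) (𝓝[<] 1) (𝓝 (c * Real.Gamma (1 + ρ))))
    (hslow : ∀ ε > 0, ∃ δ > 0, ∀ᶠ n : ℕ in atTop, ∀ m : ℕ, n ≤ m → (m : ℝ) ≤ (1 + δ) * n →
      cumSum a n - ε * powerSum v (Real.exp (-(1 / (n : ℝ)))) ≤ cumSum a m) :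
    Tendsto (fun n : ℕ => cumSum a n / powerSum v (Real.exp (-(1 / (n : ℝ))))) atTop (𝓝 c) := by
  have hΓ := Real.Gamma_pos_of_pos (show 0 < 1 + ρ by linarith)
  have hΩ := tendsto_powerSum_weights_atTop hρ H
  obtain ⟨hs, -⟩ := H.tendsto_powerSum hρ
  have hgpos := tendsto_natCast_atTop_atTop.eventually H.pos
  have hgr := H.ratioNearOne
  have hgu : Tendsto (cumSum fun n : ℕ => powerSum v (Real.exp (-(1 / (n : ℝ))))) atTop atTop :=
    tendsto_cumSum_atTop_of_mul ((H.tendsto_mul_self hρ).comp tendsto_natCast_atTop_atTop)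
  obtain ⟨N, hN⟩ := eventually_atTop.1 hgpos
  obtain ⟨C, hC, hCG⟩ := eventually_cumSum_trunc_le hρ H N hN
  have hrat := tendsto_one_sub_mul_powerSum_div hρ H
  set g : ℕ → ℝ := fun n => powerSum v (Real.exp (-(1 / (n : ℝ)))) with hg
  have heq : trunc N 1 g =ᶠ[atTop] g := trunc_eventuallyEq N 1 g
  have hUs : ∀ x, 0 ≤ x → x < 1 → Summable fun n => cumSum a n * x ^ n :=
    fun x h0 h1 => (summable_cumSum h0 h1 (hsa x h0 h1)).1
  have hgf : Tendsto (fun x => powerSum (cumSum a) x / powerSum g x) (𝓝[<] 1) (𝓝 c) := by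
    have h1 := h.div hrat hΓ.ne'
    rw [mul_div_cancel_right₀ _ hΓ.ne'] at h1
    refine h1.congr' ?_
    filter_upwards [eventually_mem_Ico_left one_pos, hΩ.eventually_gt_atTop 0,
      eventually_nhdsLT_one (P := fun x => 0 < powerSum v x) H.pos] with x hx h2 h3
    have h4 : 0 < 1 - x := by linarith [hx.2]
    simp only [Pi.div_apply]
    rw [(summable_cumSum hx.1 hx.2 (hsa x hx.1 hx.2)).2]
    field_simp
  -- Nonnegativity of the partial sums is the one-sided condition with constant `0`, so Karamata's
  -- theorem applies to `A` as a coefficient sequence with weights `g`.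
  have hmean := tendsto_cumSum_div (C := 0) hgpos hgr hgu hs hUs
    (Eventually.of_forall fun n => by simpa using hU n) hgf
  have hmean' := tendsto_cumSum_div_congr EventuallyEq.rfl heq hgu hmean
  refine (tendsto_div_of_slowDecrease (trunc_one_pos hN) (hgr.congr heq) hC hCG hc hmean'
    fun ε hε => ?_).congr' ?_
  · obtain ⟨δ, hδ, hev⟩ := hslow ε hε
    refine ⟨δ, hδ, ?_⟩
    filter_upwards [hev, heq] with n h1 h2
    rw [h2]
    exact h1
  · filter_upwards [heq] with n h1
    rw [h1]

omit hρ in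
lemma tendsto_floor_div_iff {U : ℕ → ℝ} :
    Tendsto (fun x : ℝ => U ⌊x⌋₊ / powerSum v (Real.exp (-(1 / x)))) atTop (𝓝 c) ↔
      Tendsto (fun n : ℕ => U n / powerSum v (Real.exp (-(1 / (n : ℝ))))) atTop (𝓝 c) := by
  constructor
  · intro h
    simpa [Function.comp_def] using h.comp tendsto_natCast_atTop_atTop
  · intro h
    have h1 := (h.comp (tendsto_nat_floor_atTop (α := ℝ))).mul H.tendsto_floor_div_self
    rw [mul_one] at h1
    refine h1.congr' ?_
    have hfl : Tendsto (fun x : ℝ => (⌊x⌋₊ : ℝ)) atTop atTop :=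
      tendsto_natCast_atTop_atTop.comp tendsto_nat_floor_atTop
    filter_upwards [hfl.eventually H.pos] with x hx
    simp only [Function.comp_apply]
    field_simp

end

/-! ### The slow decrease condition -/

section
variable {p q s : ℕ → ℝ} {g : ℝ → ℝ}

lemma sum_Ioc_term_eq {x t : ℝ} (hx : 0 ≤ x) (ht : 1 ≤ t) :
    ∑ k ∈ Finset.Ioc ⌊x⌋₊ ⌊t * x⌋₊, term p q s k =
      cumSum (term p q s) ⌊t * x⌋₊ - cumSum (term p q s) ⌊x⌋₊ :=
  (cumSum_sub_cumSum _ (Nat.floor_mono (le_mul_of_one_le_left hx ht))).symm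

/-- Together with `slowDecrease_of_forall`, this replaces the limit of extended-real lower limits by
an `ε`-`c` statement. -/
lemma SlowDecrease.exists_forall_le (h : SlowDecrease p q s g) {ε : ℝ} (hε : 0 < ε) :
    ∃ c > 1, ∀ᶠ x : ℝ in atTop, ∀ t, 1 ≤ t → t ≤ c →
      -ε ≤ (1 / g x) * ∑ k ∈ Finset.Ioc ⌊x⌋₊ ⌊t * x⌋₊, term p q s k := by
  obtain ⟨L, hL, hlim⟩ := h
  have hlt : ((-ε : ℝ) : EReal) < L :=
    lt_of_lt_of_le (EReal.coe_lt_coe_iff.2 (neg_lt_zero.2 hε)) hL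
  obtain ⟨c, hc, hc1⟩ := ((hlim.eventually (lt_mem_nhds hlt)).and self_mem_nhdsWithin).exists
  refine ⟨c, hc1, ?_⟩
  filter_upwards [eventually_lt_of_lt_liminf hc] with x hx t ht1 htc
  exact EReal.coe_le_coe_iff.1 (hx.le.trans (iInf₂_le t ⟨ht1, htc⟩))

lemma slowDecrease_of_forall (h : ∀ ε > 0, ∃ c > 1, ∀ᶠ x : ℝ in atTop, ∀ t, 1 ≤ t → t ≤ c →
    -ε ≤ (1 / g x) * ∑ k ∈ Finset.Ioc ⌊x⌋₊ ⌊t * x⌋₊, term p q s k) : SlowDecrease p q s g := by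
  refine ⟨0, le_rfl, tendsto_order.2 ⟨fun b hb => ?_, fun b hb => ?_⟩⟩
  · obtain ⟨y, hby, hy⟩ := EReal.lt_iff_exists_real_btwn.1 hb
    have hy0 : y < 0 := by exact_mod_cast hy
    obtain ⟨c, hc, hev⟩ := h (-y) (by linarith)
    filter_upwards [Ioo_mem_nhdsGT hc] with d hd
    refine hby.trans_le (le_liminf_of_le (by isBoundedDefault) ?_)
    filter_upwards [hev] with x hx
    refine le_iInf₂ fun t ht => EReal.coe_le_coe_iff.2 ?_
    have := hx t ht.1 (ht.2.trans hd.2.le)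
    rwa [neg_neg] at this
  · filter_upwards [self_mem_nhdsWithin] with d hd
    have hd1 : (1 : ℝ) < d := hd
    refine lt_of_le_of_lt ?_ hb
    refine (liminf_le_liminf (v := fun _ => (0 : EReal)) (Eventually.of_forall fun x => ?_)
      (by isBoundedDefault) (by isBoundedDefault)).trans (liminf_const _).le
    -- At `t = 1` the block is empty, so the infimum is at most `0`; hence the limit is exactly `0`.
    refine (iInf₂_le (1 : ℝ) ⟨le_rfl, hd1.le⟩).trans ?_
    simp

variable {v : ℕ → ℝ} {ρ c : ℝ} (H : RegVar (fun X => powerSum v (Real.exp (-(1 / X)))) ρ)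
  (hT : Tendsto (fun X : ℝ => powerSum v (Real.exp (-(1 / X))) / g X) atTop (𝓝 1))
  (hg : ∀ᶠ X in atTop, 0 < g X)
include H hT hg

omit H in
lemma SlowDecrease.cumSum_le (h : SlowDecrease p q s g) {ε : ℝ} (hε : 0 < ε) :
    ∃ δ > 0, ∀ᶠ n : ℕ in atTop, ∀ m : ℕ, n ≤ m → (m : ℝ) ≤ (1 + δ) * n →
      cumSum (term p q s) n - ε * powerSum v (Real.exp (-(1 / (n : ℝ)))) ≤
        cumSum (term p q s) m := by
  -- Half of `ε` suffices because eventually `g n / 2 ≤ D(exp (-1/n))`. The condition is used at `x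
  -- = n`, `t = m / n`.
  obtain ⟨c, hc, hev⟩ := h.exists_forall_le (half_pos hε)
  refine ⟨c - 1, by linarith, ?_⟩
  filter_upwards [tendsto_natCast_atTop_atTop.eventually hev,
    tendsto_natCast_atTop_atTop.eventually hg, eventually_gt_atTop 0,
    tendsto_natCast_atTop_atTop.eventually
      (hT.eventually (le_mem_nhds (show (1 / 2 : ℝ) < 1 by norm_num)))] with n h1 h2 hn h3 m hnm hm
  have hn0 : (0 : ℝ) < n := by exact_mod_cast hn
  have ht1 : 1 ≤ (m : ℝ) / n := by
    rw [le_div_iff₀ hn0, one_mul]; exact_mod_cast hnm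
  have h4 := h1 (m / n) ht1 (by rw [div_le_iff₀ hn0]; linarith)
  rw [sum_Ioc_term_eq hn0.le ht1, div_mul_cancel₀ _ hn0.ne', Nat.floor_natCast,
    Nat.floor_natCast, one_div, inv_mul_eq_div, le_div_iff₀ h2] at h4
  rw [le_div_iff₀ h2] at h3
  have h5 := mul_le_mul_of_nonneg_left h3 hε.le
  linarith

/-- Both partial sums are within `η` of `c` in relative terms, and the weights at `x` and `t x`
agree up to `η`. The difference of the sums is therefore at least `-(c + 3) η D`, and `D ≤ 2 g`. -/
lemma slowDecrease_of_tendsto (hc : 0 ≤ c)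
    (h : Tendsto (fun x : ℝ => cumSum (term p q s) ⌊x⌋₊ / powerSum v (Real.exp (-(1 / x)))) atTop
      (𝓝 c)) : SlowDecrease p q s g := by
  refine slowDecrease_of_forall fun ε hε => ?_
  obtain ⟨η, hη, hη1, hηε⟩ : ∃ η > 0, η ≤ 1 ∧ 2 * (c + 3) * η ≤ ε := by
    refine ⟨min 1 (ε / (2 * (c + 3))), by positivity, min_le_left _ _, ?_⟩
    have h1 : min 1 (ε / (2 * (c + 3))) ≤ ε / (2 * (c + 3)) := min_le_right _ _
    rw [le_div_iff₀ (by positivity)] at h1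
    linarith
  obtain ⟨δ, hδ, X₁, hX₁, hloc⟩ := H.near_one η hη
  obtain ⟨X₂, hX₂⟩ := eventually_atTop.1 ((Metric.tendsto_nhds.1 h η hη).and H.pos)
  refine ⟨1 + δ, by linarith, ?_⟩
  filter_upwards [eventually_ge_atTop X₁, eventually_ge_atTop X₂, hg,
    hT.eventually (ge_mem_nhds (show (1 : ℝ) < 2 by norm_num))] with x hx1 hx2 hgx hTx t ht1 ht
  have hx0 : 0 < x := hX₁.trans_le hx1
  have hxt : x ≤ t * x := le_mul_of_one_le_left hx0.le ht1
  have hl := abs_le.1 (hloc x hx1 (t * x) hxt (by gcongr))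
  obtain ⟨a1, p1⟩ := hX₂ x hx2
  obtain ⟨a2, p2⟩ := hX₂ (t * x) (hx2.trans hxt)
  rw [Real.dist_eq, abs_lt] at a1 a2
  rw [sum_Ioc_term_eq hx0.le ht1, one_div, inv_mul_eq_div, le_div_iff₀ hgx]
  rw [div_le_iff₀ hgx] at hTx
  generalize powerSum v (Real.exp (-(1 / x))) = A at *
  generalize powerSum v (Real.exp (-(1 / (t * x)))) = B at *
  have b1 : cumSum (term p q s) ⌊x⌋₊ ≤ (c + η) * A := (div_le_iff₀ p1).1 (by linarith)
  have b2 : (c - η) * B ≤ cumSum (term p q s) ⌊t * x⌋₊ := (le_div_iff₀ p2).1 (by linarith)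
  have b3 : B ≤ (1 + η) * A := (div_le_iff₀ p1).1 (by linarith)
  have b4 : (1 - η) * A ≤ B := (le_div_iff₀ p1).1 (by linarith)
  have b5 := mul_le_mul_of_nonneg_left b4 hc
  have b6 := mul_le_mul_of_nonneg_left b3 hη.le
  have b7 : η * (η * A) ≤ 1 * (η * A) := mul_le_mul_of_nonneg_right hη1 (by positivity)
  have b8 : (c + 3) * η * A ≤ (c + 3) * η * (2 * g x) :=
    mul_le_mul_of_nonneg_left hTx (by positivity)
  have b9 : 2 * (c + 3) * η * g x ≤ ε * g x := mul_le_mul_of_nonneg_right hηε hgx.le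
  linarith

omit H in
lemma contMeanTendsto_iff {Γ l : ℝ} (hΓ : 0 < Γ) :
    ContMeanTendsto p q (fun x => g x / Γ) s l ↔
      Tendsto (fun x : ℝ => cumSum (term p q s) ⌊x⌋₊ / powerSum v (Real.exp (-(1 / x)))) atTop
        (𝓝 (l / Γ)) := by
  have key : ∀ᶠ x in atTop, 0 < powerSum v (Real.exp (-(1 / x))) := by
    filter_upwards [hT.eventually (lt_mem_nhds one_pos), hg] with X h1 h2
    exact (div_pos_iff_of_pos_right h2).1 h1
  constructor
  · intro h
    have h1 := (h.mul (hT.inv₀ one_ne_zero)).div_const Γ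
    rw [inv_one, mul_one] at h1
    refine h1.congr' ?_
    filter_upwards [key, hg] with x h2 h3
    change 1 / (g x / Γ) * cumSum (term p q s) ⌊x⌋₊ * _ / Γ = _
    field_simp
  · intro h
    have h1 := (h.mul hT).mul_const Γ
    rw [mul_one, div_mul_cancel₀ _ hΓ.ne'] at h1
    refine h1.congr' ?_
    filter_upwards [key, hg] with x h2 h3
    change _ = 1 / (g x / Γ) * cumSum (term p q s) ⌊x⌋₊
    field_simp

end

end Voronoi

/-! ### The five statements -/

theorem theorem9 (p q u s : ℕ → ℝ) (l : ℝ) :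
    -- (i)
    (∀ R : ℝ, 0 < R →
      (∀ n, 0 < Voronoi.diff u n) →
      Tendsto u atTop atTop →
      Voronoi.radius (Voronoi.diff u) = ENNReal.ofReal R →
      Tendsto (Voronoi.powerSum (Voronoi.diff u)) (𝓝[<] R) atTop →
      Voronoi.MeanTendsto p q u s l →
      Voronoi.PowerTendsto p q (Voronoi.diff u) R s l) ∧
    -- (ii)
    (∀ ρ : ℝ, -1 ≤ ρ →
      Voronoi.RegVarSeq (Voronoi.diff u) ρ →
      Tendsto u atTop atTop →
      Voronoi.radius (Voronoi.diff u) = 1 →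
      Voronoi.IsBigOL (fun n => Voronoi.term p q s n / Voronoi.diff u n) (fun _ => 1) →
      Voronoi.PowerTendsto p q (Voronoi.diff u) 1 s l →
      Voronoi.MeanTendsto p q u s l) ∧
    -- (iii)
    (∀ (ρ : ℝ) (ℓ : ℝ → ℝ), -1 < ρ →
      Voronoi.SlowlyVarying ℓ →
      0 ≤ l →
      (∀ x : ℝ, 0 ≤ x → 0 ≤ Voronoi.partialSum p q s x) →
      (∀ σ : ℝ, 0 < σ → MeasureTheory.IntegrableOn
        (fun x : ℝ => Real.exp (-(σ * x)) * Voronoi.partialSum p q s x) (Set.Ioi 0)) →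
      (∀ x : ℝ, 0 ≤ x → x < 1 → Summable fun n => Voronoi.diff u n * x ^ n) →
      Tendsto (fun x : ℝ => Voronoi.powerSum (Voronoi.diff u) x * (-Real.log x) ^ ρ
        / ℓ (-1 / Real.log x)) (𝓝[<] 1) (𝓝 1) →
      (Voronoi.ContMeanTendsto p q (fun x => x ^ ρ * ℓ x / Real.Gamma (1 + ρ)) s l →
        Voronoi.PowerTendsto p q (Voronoi.diff u) 1 s l) ∧
      (Voronoi.PowerTendsto p q (Voronoi.diff u) 1 s l →
        (Voronoi.ContMeanTendsto p q (fun x => x ^ ρ * ℓ x / Real.Gamma (1 + ρ)) s l ↔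
          Voronoi.SlowDecrease p q s (fun x => x ^ ρ * ℓ x)))) ∧
    -- (iv)
    (∀ ρ : ℝ, -1 ≤ ρ → (∀ k : ℕ, ρ ≠ k) →
      Voronoi.RegVarSeq (Voronoi.diff u) ρ →
      Tendsto u atTop atTop →
      Voronoi.radius (Voronoi.diff u) = 1 →
      Voronoi.IsBigOL
        (fun n => Voronoi.term p q s (n + 1) / Voronoi.diff u (n + 1)
          - Voronoi.term p q s n / Voronoi.diff u n)
        (fun n => Voronoi.diff u (n + 1) / u (n + 1)) →
      Voronoi.PowerTendsto p q (Voronoi.diff u) 1 s l →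
      Tendsto (fun n => Voronoi.term p q s n / Voronoi.diff u n) atTop (𝓝 l)) ∧
    -- (v)
    ((∀ n, 0 < Voronoi.diff u n) →
      Voronoi.diff u =O[atTop] (fun n : ℕ => 1 / (n : ℝ)) →
      Tendsto u atTop atTop →
      Voronoi.radius (Voronoi.diff u) = 1 →
      (fun n => Voronoi.term p q s (n + 1) / Voronoi.diff u (n + 1)
          - Voronoi.term p q s n / Voronoi.diff u n)
        =o[atTop] (fun n => Voronoi.diff u (n + 1) / u (n + 1)) →
      Voronoi.PowerTendsto p q (Voronoi.diff u) 1 s l →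
      Tendsto (fun n => Voronoi.term p q s n / Voronoi.diff u n) atTop (𝓝 l)) := by
  open Voronoi in
  refine ⟨fun R hR hv hu hr hD h => powerTendsto_of_meanTendsto hR hv hu hr hD h, ?_, ?_, ?_, ?_⟩
  · intro ρ _ hv hu _ ⟨C, hC⟩ ⟨hsv, hsa, h⟩
    rw [meanTendsto_iff]
    refine tendsto_cumSum_div (C := C) hv.1 hv.ratioNearOne (by rwa [cumSum_diff]) hsv hsa ?_ h
    filter_upwards [hv.1, hC] with n h1 h2
    rw [mul_one, le_div_iff₀ h1] at h2
    linarith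
  · intro ρ ℓ hρ hℓ hl hU _ hsv hD
    have H := regVar_powerSum hsv hℓ hD
    have hT := tendsto_powerSum_div_rpow_mul hD
    have hg := eventually_pos_rpow_mul (ρ := ρ) hℓ
    have hΓ := Real.Gamma_pos_of_pos (show 0 < 1 + ρ by linarith)
    -- The factor `Γ(1 + ρ)` in `w` turns the limit `l` into `l / Γ(1 + ρ)` for the weights `D(exp
    -- (-1/x))`, and the Karamata lemmas multiply it back.
    have hiff := contMeanTendsto_iff (p := p) (q := q) (s := s) (l := l) hT hg hΓ
    refine ⟨fun h => ?_, fun ⟨_, hsa, h⟩ => ⟨fun hm => ?_, fun hsd => ?_⟩⟩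
    · obtain ⟨hsa, hlim⟩ := tendsto_powerSum_div_of_tendsto_cumSum_div hρ H
        ((tendsto_floor_div_iff H).1 (hiff.1 h))
      rw [div_mul_cancel₀ _ hΓ.ne'] at hlim
      exact ⟨hsv, hsa, hlim⟩
    · exact slowDecrease_of_tendsto H hT hg (div_nonneg hl hΓ.le) (hiff.1 hm)
    · refine hiff.2 ((tendsto_floor_div_iff H).2 (tendsto_cumSum_div_of_slowDecrease hρ H
        (fun n => ?_) (div_nonneg hl hΓ.le) hsa ?_ fun ε hε => hsd.cumSum_le hT hg hε))
      · simpa [partialSum, cumSum] using hU n (Nat.cast_nonneg n)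
      · rwa [div_mul_cancel₀ _ hΓ.ne']
  · intro ρ _ _ hv hu _ hstep ⟨hsv, hsa, h⟩
    exact tendsto_div_of_isBigOL hv.1 hv.ratioNearOne (by rwa [cumSum_diff]) hsv hsa
      (by rwa [cumSum_diff]) h
  · intro hv hvO hu _ hstep ⟨hsv, hsa, h⟩
    exact tendsto_div_of_isLittleO hv hvO (by rwa [cumSum_diff]) hsv hsa (by rwa [cumSum_diff]) h
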